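/- Let $R_0$ be an Artinian local ring with infinite residue field, let $R=R_0[x_1,\dots,x_n]$ be the polynomial ring with its standard grading, $R_+=(x_1,\dots,x_n)$, and let $I\subset R_+$ be a homogeneous ideal such that $\dim R/I=d\ge 1$. Put $c=n-d$. Write $\ell$ for length over $R_0$, $h_{R/I}(t)=\ell((R/I)_t)$ for the Hilbert function, $HP_{R/I}(z)=\sum_{t\ge 0}h_{R/I}(t)z^t$ for the Hilbert–Poincaré series, and let the integers $e_0(R/I),\dots,e_{d-1}(R/I)$ be the Hilbert coefficients, defined by $$h_{R/I}(t)=\sum_{i=0}^{d-1}(-1)^i e_i(R/I)\binom{t+d-1-i}{d-1-i}\qquad\text{for all } t\gg 0.$$ Let $\operatorname{reg}(R/I)=\max\{a_i(R/I)+i \mid 0\le i\le d\}$, where $a_i(R/I)=\sup\{t\in\mathbb Z\mid H^i_{R_+}(R/I)_t\ne 0\}$, be the Castelnuovo–Mumford regularity. Then $\operatorname{reg}(R/I)$ is a non-negative integer and $$e_0(R/I)\le \ell(R_0)\binom{\operatorname{reg}(R/I)+c}{c}.$$ Equality holds if and only if $R/I$ is a Cohen–Macaulay ring and $$HP_{R/I}(z)=\frac{\sum_{i=0}^{a}\ell(R_0)\binom{c+i-1}{i}z^i}{(1-z)^d}\quad\text{for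 some integer } a\ge 0,$$ where $\binom{-1}{0}=1$ if $c=0$. -/

import Mathlib

attribute [local instance] MvPolynomial.gradedAlgebra

noncomputable section

namespace HilbertReg

open MvPolynomial

universe u v

section GradedModules

variable {R₀ : Type u} [CommRing R₀] {n : ℕ}
variable {M : Type v} [AddCommGroup M] [Module R₀ M] [Module (MvPolynomial (Fin n) R₀) M]

/-- The multiplicative set of monomials in the variables `x_i`, `i ∈ σ`. Inverting it is the same
as inverting the single element `∏ i ∈ σ, x_i`. -/
def monomialsOn (R₀ : Type u) [CommRing R₀] {n : ℕ} (σ : Finset (Fin n)) :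
    Submonoid (MvPolynomial (Fin n) R₀) :=
  Submonoid.closure {f | ∃ i ∈ σ, f = X i}

theorem monomialsOn_mono {σ τ : Finset (Fin n)} (h : σ ⊆ τ) :
    monomialsOn R₀ σ ≤ monomialsOn R₀ τ :=
  Submonoid.closure_mono fun _ ⟨i, hi, hf⟩ => ⟨i, h hi, hf⟩

/-- The Čech cochains of degree `p`: the product of the localizations of `M` at the products of
`p` distinct variables. -/
abbrev CechCochains (R₀ : Type u) [CommRing R₀] (n : ℕ)
    (M : Type v) [AddCommGroup M] [Module (MvPolynomial (Fin n) R₀) M] (p : ℕ) : Type (max u v) :=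
  (σ : {σ : Finset (Fin n) // σ.card = p}) → LocalizedModule (monomialsOn R₀ σ.1) M

/-- The localization map from the component at `τ \ {j}` to the component at `τ`. -/
def cechFace (R₀ : Type u) [CommRing R₀] {n : ℕ}
    (M : Type v) [AddCommGroup M] [Module (MvPolynomial (Fin n) R₀) M]
    (τ : Finset (Fin n)) (j : Fin n) :
    LocalizedModule (monomialsOn R₀ (τ.erase j)) M →ₗ[MvPolynomial (Fin n) R₀]
      LocalizedModule (monomialsOn R₀ τ) M :=
  LocalizedModule.liftOfLE _ _ (monomialsOn_mono (Finset.erase_subset j τ))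

/-- The Čech differential: the component at `τ = {j₀ < ⋯ < j_p}` of the image of `c` is the
alternating sum over `k` of the images of the components of `c` at `τ \ {j_k}`, with sign
`(-1)^k`. -/
def cechDiff (R₀ : Type u) [CommRing R₀] (n : ℕ)
    (M : Type v) [AddCommGroup M] [Module (MvPolynomial (Fin n) R₀) M] (p : ℕ) :
    CechCochains R₀ n M p →ₗ[MvPolynomial (Fin n) R₀] CechCochains R₀ n M (p + 1) :=
  LinearMap.pi fun τ => ∑ j : {j // j ∈ τ.1},
    ((-1 : MvPolynomial (Fin n) R₀) ^ (τ.1.filter (· < j.1)).card) •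
      (cechFace R₀ M τ.1 j.1 ∘ₗ LinearMap.proj (⟨τ.1.erase j.1, by
        rw [Finset.card_erase_of_mem j.2, τ.2, Nat.add_sub_cancel]⟩ :
          {σ : Finset (Fin n) // σ.card = p}))

/-- The homogeneous component of degree `t` of the localization of a graded module `(M, ℳ)` at the
monomials in the variables `x_i`, `i ∈ σ`: it is generated by the fractions `m / s` with `s` such a
monomial of some degree `e` and `m` homogeneous of degree `t + e`. -/
def localizedPiece (ℳ : ℤ → Submodule R₀ M) (σ : Finset (Fin n)) (t : ℤ) :
    AddSubgroup (LocalizedModule (monomialsOn R₀ σ) M) :=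
  AddSubgroup.closure {z | ∃ (e : ℕ) (m : M) (s : monomialsOn R₀ σ),
    (s : MvPolynomial (Fin n) R₀).IsHomogeneous e ∧ m ∈ ℳ (t + e) ∧ z = LocalizedModule.mk m s}

/-- The homogeneous Čech cochains of cohomological degree `p` and internal degree `t`. -/
def cechPiece (ℳ : ℤ → Submodule R₀ M) (p : ℕ) (t : ℤ) :
    AddSubgroup (CechCochains R₀ n M p) :=
  AddSubgroup.pi Set.univ fun σ => localizedPiece ℳ σ.1 t

/-- The cocycles of internal degree `t`. -/
def cechCocycles (ℳ : ℤ → Submodule R₀ M) (p : ℕ) (t : ℤ) :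
    AddSubgroup (CechCochains R₀ n M p) :=
  (LinearMap.ker (cechDiff R₀ n M p)).toAddSubgroup ⊓ cechPiece ℳ p t

/-- The coboundaries of internal degree `t`. -/
def cechCoboundaries (ℳ : ℤ → Submodule R₀ M) (p : ℕ) (t : ℤ) :
    AddSubgroup (CechCochains R₀ n M p) :=
  match p with
  | 0 => ⊥
  | q + 1 => (cechPiece ℳ q t).map (cechDiff R₀ n M q).toAddMonoidHom

/-- The homogeneous component `H^p_{R_+}(M)_t` of the `p`-th local cohomology module of the graded
module `(M, ℳ)` over `R = R₀[x_1, …, x_n]`, computed by the Čech complex on `x_1, …, x_n`. -/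
abbrev LocalCohomologyPiece (n : ℕ) [Module (MvPolynomial (Fin n) R₀) M]
    (ℳ : ℤ → Submodule R₀ M) (p : ℕ) (t : ℤ) : Type (max u v) :=
  cechCocycles (n := n) ℳ p t ⧸ (cechCoboundaries (n := n) ℳ p t).addSubgroupOf (cechCocycles ℳ p t)

/-- `a_p(M) = sup {t | H^p_{R_+}(M)_t ≠ 0}`, which is `-∞` if `H^p_{R_+}(M) = 0`. -/
def aInvariant (n : ℕ) [Module (MvPolynomial (Fin n) R₀) M]
    (ℳ : ℤ → Submodule R₀ M) (p : ℕ) : EReal :=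
  ⨆ (t : ℤ) (_ : Nontrivial (LocalCohomologyPiece n ℳ p t)), ((t : ℝ) : EReal)

/-- The Castelnuovo–Mumford regularity `max {a_p(M) + p | 0 ≤ p ≤ dim M}`. -/
def regularity (n : ℕ) [Module (MvPolynomial (Fin n) R₀) M]
    (ℳ : ℤ → Submodule R₀ M) : EReal :=
  ⨆ (p : ℕ) (_ : (p : WithBot ℕ∞) ≤ Module.supportDim (MvPolynomial (Fin n) R₀) M),
    (aInvariant n ℳ p + ((p : ℝ) : EReal))

/-- The Hilbert function `t ↦ ℓ_{R₀}(M_t)`. -/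
def hilbertFunction (ℳ : ℤ → Submodule R₀ M) (t : ℤ) : ℕ :=
  (Module.length R₀ (ℳ t)).toNat

/-- `e 0, …, e (d - 1)` are the Hilbert coefficients of a graded module of dimension `d`:
the Hilbert polynomial, i.e. the polynomial which agrees with the Hilbert function in all large
degrees, is `∑_{i < d} (-1)^i e_i binom(t + d - 1 - i, d - 1 - i)`. -/
def IsHilbertCoefficients (ℳ : ℤ → Submodule R₀ M) (d : ℕ) (e : ℕ → ℤ) : Prop :=
  ∀ᶠ t : ℕ in Filter.atTop, (hilbertFunction ℳ t : ℤ) =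
    ∑ i ∈ Finset.range d, (-1) ^ i * e i * ((t + (d - 1 - i)).choose (d - 1 - i) : ℤ)

/-- The Hilbert–Poincaré series `∑_{t ≥ 0} ℓ_{R₀}(M_t) z^t`. -/
def hilbertSeries (ℳ : ℤ → Submodule R₀ M) : PowerSeries ℤ :=
  PowerSeries.mk fun t => (hilbertFunction ℳ t : ℤ)

end GradedModules

/-- The grading of `R₀[x_1, …, x_n] / I` by the images of the homogeneous polynomials. -/
def quotientGrading {R₀ : Type u} [CommRing R₀] {n : ℕ} (I : Ideal (MvPolynomial (Fin n) R₀))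
    (t : ℤ) : Submodule R₀ (MvPolynomial (Fin n) R₀ ⧸ I) :=
  if 0 ≤ t then
    (homogeneousSubmodule (Fin n) R₀ t.toNat).map (Ideal.Quotient.mkₐ R₀ I).toLinearMap
  else ⊥

/-- A Noetherian local ring is Cohen–Macaulay if it has a regular sequence (necessarily in its
maximal ideal) whose length is the Krull dimension. -/
def IsCohenMacaulayLocalRing (A : Type u) [CommRing A] : Prop :=
  IsNoetherianRing A ∧ IsLocalRing A ∧
    ∃ rs : List A, RingTheory.Sequence.IsRegular A rs ∧ (rs.length : WithBot ℕ∞) = ringKrullDim A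

/-- A Noetherian ring is Cohen–Macaulay if its localizations at all maximal ideals are. -/
def IsCohenMacaulayRing (A : Type u) [CommRing A] : Prop :=
  IsNoetherianRing A ∧ ∀ (m : Ideal A) [m.IsMaximal],
    IsCohenMacaulayLocalRing (Localization.AtPrime m)

end HilbertReg

end

noncomputable section

namespace HilbertReg

open MvPolynomial

universe u v w

/-! ### The Čech complex: restriction maps, `d² = 0`, functoriality. -/

section Cech

variable {R₀ : Type u} [CommRing R₀] {n : ℕ}
variable {M : Type v} [AddCommGroup M] [Module (MvPolynomial (Fin n) R₀) M]
variable {M' : Type w} [AddCommGroup M'] [Module (MvPolynomial (Fin n) R₀) M']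

/-! The proof cuts `R / I` by general linear forms `y_0, y_1, …` and compares everything with the
last section. Write `J_j` for `I` plus the first `j` forms (`sectionIdeal`). The infinite residue
field allows the forms to be chosen with linearly independent reductions, so that `y_0, …, y_{n-1}`
span the same `R₀`-module as the variables, and so that each `y_j` avoids the associated primes of
`R / J_j` that do not contain all variables (`exists_general_linearForms`). Then multiplication by
`y_j` on `R / J_j` has `R_+`-torsion kernel, and `R / J_d` has finite length
(`satIdeal_sectionIdeal_eq_top`).

Bound. The long exact sequence of local cohomology passes the vanishing of `H^p` in degrees `t + p >
r` on to hyperplane sections, so `R / J_d` is zero above degree `r = reg(R/I)`. In degree `t` it is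
a quotient of the forms of degree `t` in the remaining `c` linear forms, so its total length is at
most `ℓ(R₀) binom(r + c, c)`. A section multiplies the Hilbert series by `1 - z` and adds `z` times
the series of the kernel of `y_j`, a polynomial. In the numerator at `z = 1` only the last kernel
survives: `e_0 = ℓ(R / J_d) - ℓ(ker y_{d-1})` (`exists_numerator`, `exists_numerator_le`).

Equality. If the bound is attained, the last kernel is zero and `R / J_d` has the largest possible
Hilbert function up to degree `r`. Saturation climbs back from `J_{d-1}` to `I`, so all `y_j` with
`j < d` are regular (`mem_sectionIdeal_of_mul_mem`); this gives the Hilbert series. The monomials of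
degree at most `r` in the other forms are then a basis of `R / I` over `R₀[y_0, …, y_{d-1}]`, and an
algebra of finite type and dimension at most `d` that is flat over a polynomial ring in `d`
variables with Artinian base is Cohen–Macaulay (`isCohenMacaulayRing_of_flat`).

Converse. Localize at the graded maximal ideal, where `R / I` has depth equal to dimension, say
`d'`. Positive depth forces the `J_j` with `j < d'` to be saturated, and `R / J_{d'}` has finite
length (`exists_regular_of_isCohenMacaulayLocalRing`). The numerator is nonzero at `z = 1`, hence
`d' = d`, and the series then shows `R / J_d` to vanish above degree `a`. Because higher cohomology
is torsion, the regularity is controlled by the `H^0` of the sections alone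
(`VanishesAbove.of_sectionIdeal`), so `reg(R/I) ≤ a` and `e_0 = ℓ(R₀) binom(a + c, c)` reaches the
bound. -/

theorem X_mem_monomialsOn {σ : Finset (Fin n)} {i : Fin n} (hi : i ∈ σ) :
    (X i : MvPolynomial (Fin n) R₀) ∈ monomialsOn R₀ σ :=
  Submonoid.subset_closure ⟨i, hi, rfl⟩

theorem exists_isHomogeneous_of_mem_monomialsOn {σ : Finset (Fin n)}
    {s : MvPolynomial (Fin n) R₀} (hs : s ∈ monomialsOn R₀ σ) : ∃ e, s.IsHomogeneous e := by
  induction hs using Submonoid.closure_induction with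
  | mem x hx =>
    obtain ⟨i, -, rfl⟩ := hx
    exact ⟨1, isHomogeneous_X _ _⟩
  | one => exact ⟨0, isHomogeneous_one _ _⟩
  | mul x y _ _ hx hy =>
    obtain ⟨e, he⟩ := hx
    obtain ⟨f, hf⟩ := hy
    exact ⟨_, he.mul hf⟩

/-- A monomial in the variables of `σ ∪ {i}` is a power of `x_i` times a monomial in the variables
of `σ`. -/
theorem exists_eq_mul_pow_of_mem_monomialsOn_insert {σ τ : Finset (Fin n)} {i : Fin n}
    (h : τ ⊆ insert i σ) {s : MvPolynomial (Fin n) R₀} (hs : s ∈ monomialsOn R₀ τ) :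
    ∃ k, ∃ s' ∈ monomialsOn R₀ σ, s = X i ^ k * s' := by
  induction hs using Submonoid.closure_induction with
  | mem x hx =>
    obtain ⟨j, hj, rfl⟩ := hx
    rcases Finset.mem_insert.1 (h hj) with rfl | hj
    · exact ⟨1, 1, Submonoid.one_mem _, by simp⟩
    · exact ⟨0, X j, X_mem_monomialsOn hj, by simp⟩
  | one => exact ⟨0, 1, Submonoid.one_mem _, by simp⟩
  | mul x y _ _ hx hy =>
    obtain ⟨k, s, hs, rfl⟩ := hx
    obtain ⟨l, t, ht, rfl⟩ := hy
    exact ⟨k + l, s * t, Submonoid.mul_mem _ hs ht, by ring⟩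

/-- The localization map from the component at `ρ` to the component at `τ ⊇ ρ`. -/
def cechRes (R₀ : Type u) [CommRing R₀] {n : ℕ}
    (M : Type v) [AddCommGroup M] [Module (MvPolynomial (Fin n) R₀) M]
    {ρ τ : Finset (Fin n)} (h : ρ ⊆ τ) :
    LocalizedModule (monomialsOn R₀ ρ) M →ₗ[MvPolynomial (Fin n) R₀]
      LocalizedModule (monomialsOn R₀ τ) M :=
  LocalizedModule.liftOfLE _ _ (monomialsOn_mono h)

theorem cechRes_mk {ρ τ : Finset (Fin n)} (h : ρ ⊆ τ) (m : M) (s : monomialsOn R₀ ρ) :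
    cechRes R₀ M h (LocalizedModule.mk m s) =
      LocalizedModule.mk m ⟨s.1, monomialsOn_mono h s.2⟩ := by
  simp only [cechRes, LocalizedModule.liftOfLE, IsLocalizedModule.mk_eq_mk',
    IsLocalizedModule.liftOfLE_mk']

theorem cechRes_cechRes {ρ τ υ : Finset (Fin n)} (h : ρ ⊆ τ) (h' : τ ⊆ υ)
    (z : LocalizedModule (monomialsOn R₀ ρ) M) :
    cechRes R₀ M h' (cechRes R₀ M h z) = cechRes R₀ M (h.trans h') z := by
  induction z using LocalizedModule.induction_on with
  | _ m s => simp only [cechRes_mk]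

theorem cechDiff_apply {p : ℕ} (c : CechCochains R₀ n M p)
    (τ : {σ : Finset (Fin n) // σ.card = p + 1}) :
    cechDiff R₀ n M p c τ = ∑ j : {j // j ∈ τ.1},
      ((-1 : MvPolynomial (Fin n) R₀) ^ (τ.1.filter (· < j.1)).card) •
        cechRes R₀ M (Finset.erase_subset j.1 τ.1) (c ⟨τ.1.erase j.1, by
          rw [Finset.card_erase_of_mem j.2, τ.2, Nat.add_sub_cancel]⟩) := by
  simp only [cechDiff, LinearMap.pi_apply, LinearMap.sum_apply, LinearMap.smul_apply,
    LinearMap.comp_apply, LinearMap.proj_apply]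
  rfl

/-- The type of a component depends on its index set, so two descriptions of the same index cannot
be exchanged by rewriting; this lemma carries the exchange. -/
theorem cechRes_congr {p : ℕ} (c : CechCochains R₀ n M p) {τ : Finset (Fin n)}
    {ρ ρ' : {σ : Finset (Fin n) // σ.card = p}} (h : ρ = ρ') (hρ : ρ.1 ⊆ τ) :
    cechRes R₀ M hρ (c ρ) = cechRes R₀ M (h ▸ hρ) (c ρ') := by
  subst h; rfl

/-- Exchanging the order in which two elements are removed changes the sign. -/
theorem cech_sign_swap (τ : Finset (Fin n)) {j k : Fin n} (hj : j ∈ τ)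
    (hjk : j < k) :
    (τ.filter (· < j)).card + ((τ.erase j).filter (· < k)).card + 1 =
      (τ.filter (· < k)).card + ((τ.erase k).filter (· < j)).card := by
  have h1 : (τ.erase k).filter (· < j) = τ.filter (· < j) := by
    ext x; simp only [Finset.mem_filter, Finset.mem_erase]
    constructor
    · rintro ⟨⟨_, h⟩, h'⟩; exact ⟨h, h'⟩
    · rintro ⟨h, h'⟩; exact ⟨⟨(h'.trans hjk).ne, h⟩, h'⟩
  have h2 : (τ.erase j).filter (· < k) = (τ.filter (· < k)).erase j := by
    ext x; simp only [Finset.mem_filter, Finset.mem_erase]; tauto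
  have h3 : j ∈ τ.filter (· < k) := by simp [hj, hjk]
  rw [h1, h2, Finset.card_erase_of_mem h3]
  have := Finset.card_pos.2 ⟨j, h3⟩
  omega

/-- The terms of the double sum are indexed by ordered pairs of removed elements. Swapping the pair
is a fixed-point-free involution that reverses the sign. -/
theorem cechDiff_cechDiff {p : ℕ} (c : CechCochains R₀ n M p) :
    cechDiff R₀ n M (p + 1) (cechDiff R₀ n M p c) = 0 := by
  funext τ
  rw [cechDiff_apply]
  simp only [cechDiff_apply, map_sum, map_smul, Finset.smul_sum, cechRes_cechRes, smul_smul,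
    Pi.zero_apply, ← pow_add]
  rw [Finset.sum_sigma']
  refine Finset.sum_involution
    (fun a _ => ⟨⟨a.2.1, Finset.mem_of_mem_erase a.2.2⟩,
      ⟨a.1.1, Finset.mem_erase.2 ⟨(Finset.ne_of_mem_erase a.2.2).symm, a.1.2⟩⟩⟩)
    ?_ ?_ (fun _ _ => Finset.mem_univ _) (fun _ _ => rfl)
  · rintro ⟨⟨j, hj⟩, ⟨k, hk⟩⟩ -
    have hne := Finset.ne_of_mem_erase hk
    have hkτ := Finset.mem_of_mem_erase hk
    dsimp only
    have hcard : ((τ.1.erase j).erase k).card = p := by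
      rw [Finset.card_erase_of_mem hk, Finset.card_erase_of_mem hj, τ.2]; omega
    rw [cechRes_congr c (ρ := ⟨(τ.1.erase j).erase k, hcard⟩)
      (ρ' := ⟨(τ.1.erase k).erase j, by rwa [Finset.erase_right_comm]⟩)
      (Subtype.ext Finset.erase_right_comm)
      ((Finset.erase_subset _ _).trans (Finset.erase_subset _ _)), ← add_smul]
    refine (congrArg (· • _) ?_).trans (zero_smul (MvPolynomial (Fin n) R₀) _)
    rcases lt_or_gt_of_ne hne with h | h
    · have := cech_sign_swap τ.1 hkτ h
      simp only at this ⊢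
      rw [← this, pow_succ]; ring
    · have := cech_sign_swap τ.1 hj h
      rw [← this, pow_succ]; ring
  · rintro ⟨⟨j, hj⟩, ⟨k, hk⟩⟩ - - h
    have hne := Finset.ne_of_mem_erase hk
    simp only [Sigma.mk.injEq, Subtype.mk.injEq] at h
    exact hne h.1

/-- The map of Čech complexes induced by a linear map. -/
def cechMap (f : M →ₗ[MvPolynomial (Fin n) R₀] M') (σ : Finset (Fin n)) :
    LocalizedModule (monomialsOn R₀ σ) M →ₗ[MvPolynomial (Fin n) R₀]
      LocalizedModule (monomialsOn R₀ σ) M' :=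
  (LocalizedModule.map (monomialsOn R₀ σ) f).restrictScalars _

theorem cechMap_mk (f : M →ₗ[MvPolynomial (Fin n) R₀] M') (σ : Finset (Fin n)) (m : M)
    (s : monomialsOn R₀ σ) :
    cechMap f σ (LocalizedModule.mk m s) = LocalizedModule.mk (f m) s :=
  LocalizedModule.map_mk _ _ _ _

theorem cechMap_cechRes (f : M →ₗ[MvPolynomial (Fin n) R₀] M') {ρ τ : Finset (Fin n)} (h : ρ ⊆ τ)
    (z : LocalizedModule (monomialsOn R₀ ρ) M) :
    cechMap f τ (cechRes R₀ M h z) = cechRes R₀ M' h (cechMap f ρ z) := by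
  induction z using LocalizedModule.induction_on with
  | _ m s => simp only [cechRes_mk, cechMap_mk]

/-- The map on Čech cochains induced by a linear map. -/
def cechCochainsMap (f : M →ₗ[MvPolynomial (Fin n) R₀] M') (p : ℕ) :
    CechCochains R₀ n M p →ₗ[MvPolynomial (Fin n) R₀] CechCochains R₀ n M' p :=
  LinearMap.pi fun σ => cechMap f σ.1 ∘ₗ LinearMap.proj σ

theorem cechCochainsMap_apply (f : M →ₗ[MvPolynomial (Fin n) R₀] M') {p : ℕ}
    (c : CechCochains R₀ n M p) (σ : {σ : Finset (Fin n) // σ.card = p}) :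
    cechCochainsMap f p c σ = cechMap f σ.1 (c σ) := rfl

theorem cechDiff_cechCochainsMap (f : M →ₗ[MvPolynomial (Fin n) R₀] M') {p : ℕ}
    (c : CechCochains R₀ n M p) :
    cechDiff R₀ n M' p (cechCochainsMap f p c) = cechCochainsMap f (p + 1) (cechDiff R₀ n M p c) := by
  funext τ
  simp only [cechDiff_apply, cechCochainsMap_apply, map_sum, map_smul, cechMap_cechRes]

end Cech

/-! ### Internal degrees of cochains, and `H^0` as torsion. -/

section Graded

variable {R₀ : Type u} [CommRing R₀] {n : ℕ}
variable {M : Type v} [AddCommGroup M] [Module R₀ M] [Module (MvPolynomial (Fin n) R₀) M]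

/-- Homogeneous polynomials of degree `e` shift the degrees of the graded module by `e`. -/
def IsGradedAction (n : ℕ) [Module (MvPolynomial (Fin n) R₀) M] (ℳ : ℤ → Submodule R₀ M) : Prop :=
  ∀ ⦃e : ℕ⦄ ⦃f : MvPolynomial (Fin n) R₀⦄ ⦃t : ℤ⦄ ⦃m : M⦄, f.IsHomogeneous e → m ∈ ℳ t →
    f • m ∈ ℳ (t + e)

variable {ℳ : ℤ → Submodule R₀ M}

/-- Fractions of degree `t` over a common denominator again have degree `t`, so the generating set
is already a subgroup and the closure adds nothing. -/
theorem mem_localizedPiece (hℳ : IsGradedAction n ℳ) {σ : Finset (Fin n)} {t : ℤ}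
    {z : LocalizedModule (monomialsOn R₀ σ) M} :
    z ∈ localizedPiece ℳ σ t ↔ ∃ (e : ℕ) (m : M) (s : monomialsOn R₀ σ),
      (s : MvPolynomial (Fin n) R₀).IsHomogeneous e ∧ m ∈ ℳ (t + e) ∧
        z = LocalizedModule.mk m s := by
  refine ⟨fun hz => ?_, fun h => AddSubgroup.subset_closure h⟩
  induction hz using AddSubgroup.closure_induction with
  | mem x hx => exact hx
  | zero => exact ⟨0, 0, 1, isHomogeneous_one _ _, zero_mem _, (LocalizedModule.zero_mk _).symm⟩
  | add x y _ _ hx hy =>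
    obtain ⟨e, m, s, hs, hm, rfl⟩ := hx
    obtain ⟨e', m', s', hs', hm', rfl⟩ := hy
    refine ⟨e + e', _, _, hs.mul hs', ?_, LocalizedModule.mk_add_mk⟩
    refine add_mem ?_ ?_
    · rw [Submonoid.smul_def, Nat.cast_add, ← add_assoc]; exact hℳ hs' hm
    · rw [Submonoid.smul_def, Nat.cast_add, add_comm (e : ℤ), ← add_assoc]; exact hℳ hs hm'
  | neg x _ hx =>
    obtain ⟨e, m, s, hs, hm, rfl⟩ := hx
    exact ⟨e, -m, s, hs, neg_mem hm, (LocalizedModule.mk_neg).symm⟩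

theorem mk_mem_localizedPiece {σ : Finset (Fin n)} {t : ℤ} {e : ℕ} {m : M}
    {s : monomialsOn R₀ σ} (hs : (s : MvPolynomial (Fin n) R₀).IsHomogeneous e)
    (hm : m ∈ ℳ (t + e)) : LocalizedModule.mk m s ∈ localizedPiece ℳ σ t :=
  AddSubgroup.subset_closure ⟨e, m, s, hs, hm, rfl⟩

theorem smul_mem_localizedPiece (hℳ : IsGradedAction n ℳ) {σ : Finset (Fin n)} {t : ℤ} {k : ℕ}
    {f : MvPolynomial (Fin n) R₀} (hf : f.IsHomogeneous k)
    {z : LocalizedModule (monomialsOn R₀ σ) M} (hz : z ∈ localizedPiece ℳ σ t) :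
    f • z ∈ localizedPiece ℳ σ (t + k) := by
  obtain ⟨e, m, s, hs, hm, rfl⟩ := (mem_localizedPiece hℳ).1 hz
  rw [LocalizedModule.smul'_mk]
  refine mk_mem_localizedPiece hs ?_
  convert hℳ hf hm using 2; ring

theorem neg_one_pow_smul_mem_localizedPiece {σ : Finset (Fin n)} {t : ℤ} (k : ℕ)
    {z : LocalizedModule (monomialsOn R₀ σ) M} (hz : z ∈ localizedPiece ℳ σ t) :
    (-1 : MvPolynomial (Fin n) R₀) ^ k • z ∈ localizedPiece ℳ σ t := by
  rcases neg_one_pow_eq_or (MvPolynomial (Fin n) R₀) k with h | h <;> rw [h]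
  · rwa [one_smul]
  · rw [neg_one_smul]; exact neg_mem hz

theorem cechRes_mem_localizedPiece (hℳ : IsGradedAction n ℳ) {ρ τ : Finset (Fin n)} (h : ρ ⊆ τ)
    {t : ℤ} {z : LocalizedModule (monomialsOn R₀ ρ) M} (hz : z ∈ localizedPiece ℳ ρ t) :
    cechRes R₀ M h z ∈ localizedPiece ℳ τ t := by
  obtain ⟨e, m, s, hs, hm, rfl⟩ := (mem_localizedPiece hℳ).1 hz
  rw [cechRes_mk]
  exact mk_mem_localizedPiece hs hm

theorem mem_cechPiece {p : ℕ} {t : ℤ} {c : CechCochains R₀ n M p} :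
    c ∈ cechPiece ℳ p t ↔ ∀ σ, c σ ∈ localizedPiece ℳ σ.1 t := by
  simp [cechPiece, AddSubgroup.mem_pi]

theorem cechDiff_mem_cechPiece (hℳ : IsGradedAction n ℳ) {p : ℕ} {t : ℤ}
    {c : CechCochains R₀ n M p} (hc : c ∈ cechPiece ℳ p t) :
    cechDiff R₀ n M p c ∈ cechPiece ℳ (p + 1) t := by
  rw [mem_cechPiece] at hc ⊢
  intro τ
  rw [cechDiff_apply]
  refine sum_mem fun j _ => ?_
  apply neg_one_pow_smul_mem_localizedPiece
  apply cechRes_mem_localizedPiece hℳ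
  exact hc ⟨τ.1.erase j.1, _⟩

theorem smul_mem_cechPiece (hℳ : IsGradedAction n ℳ) {p : ℕ} {t : ℤ} {k : ℕ}
    {f : MvPolynomial (Fin n) R₀} (hf : f.IsHomogeneous k) {c : CechCochains R₀ n M p}
    (hc : c ∈ cechPiece ℳ p t) : f • c ∈ cechPiece ℳ p (t + k) := by
  rw [mem_cechPiece] at hc ⊢
  exact fun σ => smul_mem_localizedPiece hℳ hf (hc σ)

/-- The vanishing of `H^p_{R_+}(M)_t`, in terms of cochains. -/
def CohomologyVanishes (n : ℕ) [Module (MvPolynomial (Fin n) R₀) M]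
    (ℳ : ℤ → Submodule R₀ M) (p : ℕ) (t : ℤ) : Prop :=
  ∀ b : CechCochains R₀ n M p, b ∈ cechPiece ℳ p t → cechDiff R₀ n M p b = 0 →
    b ∈ cechCoboundaries (n := n) ℳ p t

theorem nontrivial_localCohomologyPiece_iff {p : ℕ} {t : ℤ} :
    Nontrivial (LocalCohomologyPiece n ℳ p t) ↔ ¬ CohomologyVanishes n ℳ p t := by
  have h := QuotientAddGroup.subsingleton_iff (N := (cechCoboundaries (n := n) ℳ p t).addSubgroupOf
    (cechCocycles ℳ p t))
  rw [AddSubgroup.addSubgroupOf_eq_top] at h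
  rw [← not_subsingleton_iff_nontrivial, not_iff_not]
  refine h.trans ?_
  constructor
  · exact fun h b hb hb' => h ⟨hb', hb⟩
  · exact fun h b hb => h b hb.2 hb.1

theorem mem_cechCoboundaries_succ {p : ℕ} {t : ℤ} {b : CechCochains R₀ n M (p + 1)} :
    b ∈ cechCoboundaries (n := n) ℳ (p + 1) t ↔
      ∃ a ∈ cechPiece ℳ p t, cechDiff R₀ n M p a = b := Iff.rfl

theorem monomialsOn_empty : monomialsOn R₀ (∅ : Finset (Fin n)) = ⊥ := by
  simp [monomialsOn]

theorem mem_localizedPiece_empty {t : ℤ} {z : LocalizedModule (monomialsOn R₀ (∅ : Finset (Fin n))) M}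
    (hℳ : IsGradedAction n ℳ) :
    z ∈ localizedPiece ℳ ∅ t ↔ ∃ m ∈ ℳ t, z = LocalizedModule.mk m 1 := by
  constructor
  · intro hz
    obtain ⟨e, m, ⟨s, hs'⟩, hs, hm, rfl⟩ := (mem_localizedPiece hℳ).1 hz
    obtain rfl : s = 1 := by
      rwa [monomialsOn_empty, Submonoid.mem_bot] at hs'
    -- Over the zero ring the denominator `1` is homogeneous of every degree, so its degree
    -- determines nothing there.
    rcases subsingleton_or_nontrivial R₀ with h | h
    · have : Subsingleton M := Module.subsingleton (MvPolynomial (Fin n) R₀) M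
      exact ⟨0, zero_mem _, by rw [Subsingleton.elim m 0]; rfl⟩
    · obtain rfl : e = 0 := hs.inj_right (isHomogeneous_one _ _) one_ne_zero
      exact ⟨m, by simpa using hm, rfl⟩
  · rintro ⟨m, hm, rfl⟩
    exact mk_mem_localizedPiece (e := 0) (isHomogeneous_one _ _) (by simpa using hm)

omit [Module R₀ M] in
theorem cechRes_mk_one_singleton_eq_zero_iff {ρ : Finset (Fin n)} {i : Fin n} (h : ρ ⊆ {i}) (m : M) :
    cechRes R₀ M h (LocalizedModule.mk m 1) = 0 ↔
      ∃ N : ℕ, (X i : MvPolynomial (Fin n) R₀) ^ N • m = 0 := by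
  have hmon : ∀ s : MvPolynomial (Fin n) R₀, s ∈ monomialsOn R₀ {i} ↔ ∃ N : ℕ, X i ^ N = s := by
    intro s
    rw [← Submonoid.mem_powers_iff, Submonoid.powers_eq_closure, monomialsOn]
    simp
  rw [cechRes_mk, ← LocalizedModule.zero_mk 1, LocalizedModule.mk_eq]
  simp only [one_smul, smul_zero]
  constructor
  · rintro ⟨⟨u, hu⟩, h⟩
    obtain ⟨N, rfl⟩ := (hmon u).1 hu
    exact ⟨N, h⟩
  · rintro ⟨N, h⟩
    exact ⟨⟨X i ^ N, (hmon _).2 ⟨N, rfl⟩⟩, h⟩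

/-- `H^0_{R_+}(M)_t` consists of the elements of `M_t` killed by powers of all variables. -/
theorem cohomologyVanishes_zero_iff (hℳ : IsGradedAction n ℳ) {t : ℤ} :
    CohomologyVanishes n ℳ 0 t ↔ ∀ m ∈ ℳ t, (∀ i : Fin n, ∃ N : ℕ,
      (X i : MvPolynomial (Fin n) R₀) ^ N • m = 0) → m = 0 := by
  have hcob : ∀ b : CechCochains R₀ n M 0, b ∈ cechCoboundaries (n := n) ℳ 0 t ↔ b = 0 :=
    fun b => Iff.rfl
  -- On singletons the differential has one face, with sign `+1`: the localization map `M →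
  -- M_{x_i}`.
  have hsum : ∀ (c : CechCochains R₀ n M 0) (τ : {σ : Finset (Fin n) // σ.card = 0 + 1}) (i : Fin n)
      (hi : τ.1 = {i}), cechDiff R₀ n M 0 c τ = cechRes R₀ M (Finset.empty_subset _)
        (c ⟨∅, Finset.card_empty⟩) := by
    rintro c ⟨τ, hτ⟩ i hi
    obtain rfl : τ = {i} := hi
    rw [cechDiff_apply, Fintype.sum_eq_single ⟨i, Finset.mem_singleton_self i⟩
      (fun j hj => absurd (Subtype.ext (Finset.mem_singleton.1 j.2)) hj)]
    have h0 : Finset.filter (· < i) {i} = ∅ := by simp [Finset.filter_singleton]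
    simp only [h0, Finset.card_empty, pow_zero, one_smul]
    have hc : (({i} : Finset (Fin n)).erase i).card = 0 := by simp
    exact cechRes_congr c (ρ := ⟨({i} : Finset (Fin n)).erase i, hc⟩)
      (ρ' := ⟨∅, Finset.card_empty⟩) (Subtype.ext (Finset.erase_singleton i))
      (Finset.erase_subset _ _)
  have hσ : ∀ σ : {σ : Finset (Fin n) // σ.card = 0}, σ = ⟨∅, Finset.card_empty⟩ :=
    fun σ => Subtype.ext (Finset.card_eq_zero.1 σ.2)
  constructor
  · intro h m hm htors
    let c : CechCochains R₀ n M 0 := fun σ => (LocalizedModule.mk m 1 : LocalizedModule (monomialsOn R₀ σ.1) M)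
    have hc : c = 0 := by
      have h1 : c ∈ cechPiece ℳ 0 t → cechDiff R₀ n M 0 c = 0 → c = 0 :=
        fun h1 h2 => (hcob c).1 (h c h1 h2)
      refine h1 ?_ ?_
      · rw [mem_cechPiece]
        intro σ
        exact mk_mem_localizedPiece (e := 0) (isHomogeneous_one _ _) (by simpa using hm)
      · funext τ
        obtain ⟨i, hi⟩ := Finset.card_eq_one.1 τ.2
        rw [hsum c τ i hi]
        obtain ⟨τ, hτ⟩ := τ
        obtain rfl : τ = {i} := hi
        exact (cechRes_mk_one_singleton_eq_zero_iff _ m).2 (htors i)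
    have := congrFun hc ⟨∅, Finset.card_empty⟩
    have h1 : (LocalizedModule.mk m 1 : LocalizedModule (monomialsOn R₀ (∅ : Finset (Fin n))) M) = 0 :=
      this
    rw [← LocalizedModule.zero_mk 1, LocalizedModule.mk_eq] at h1
    obtain ⟨⟨u, hu⟩, h1⟩ := h1
    obtain rfl : u = 1 := by rwa [monomialsOn_empty, Submonoid.mem_bot] at hu
    simpa [Submonoid.smul_def] using h1
  · intro h b hb hb'
    rw [hcob]
    obtain ⟨m, hm, hbm⟩ := (mem_localizedPiece_empty hℳ).1 (mem_cechPiece.1 hb ⟨∅, Finset.card_empty⟩)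
    have hm0 : m = 0 := by
      refine h m hm fun i => ?_
      have := congrFun hb' ⟨{i}, Finset.card_singleton i⟩
      rw [hsum b _ i rfl, hbm] at this
      exact (cechRes_mk_one_singleton_eq_zero_iff _ m).1 this
    funext σ
    rw [hσ σ, hbm, hm0]
    exact LocalizedModule.zero_mk _

end Graded
-- Hyperplane sections and the long exact sequence.
section HyperplaneSection

variable {R₀ : Type u} [CommRing R₀] {n : ℕ}
variable {M : Type v} [AddCommGroup M] [Module R₀ M] [Module (MvPolynomial (Fin n) R₀) M]
variable {M' : Type w} [AddCommGroup M'] [Module R₀ M'] [Module (MvPolynomial (Fin n) R₀) M']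

/-- `f` exhibits the graded module `(M', ℳ')` as `M / y M` for a linear form `y` such that the
kernel of the multiplication by `y` on `M` is `R_+`-torsion. -/
structure IsHyperplaneSection (ℳ : ℤ → Submodule R₀ M) (ℳ' : ℤ → Submodule R₀ M')
    (y : MvPolynomial (Fin n) R₀) (f : M →ₗ[MvPolynomial (Fin n) R₀] M') : Prop where
  gradedAction : IsGradedAction n ℳ
  gradedAction' : IsGradedAction n ℳ'
  isHomogeneous : y.IsHomogeneous 1
  map_mem : ∀ ⦃t m⦄, m ∈ ℳ t → f m ∈ ℳ' t
  exists_map_eq : ∀ ⦃t m'⦄, m' ∈ ℳ' t → ∃ m ∈ ℳ t, f m = m'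
  map_smul_eq_zero : ∀ m, f (y • m) = 0
  exists_smul_eq : ∀ ⦃t m⦄, m ∈ ℳ t → f m = 0 → ∃ m₀ ∈ ℳ (t - 1), y • m₀ = m
  torsion : ∀ ⦃m : M⦄, y • m = 0 → ∀ i : Fin n, ∃ N : ℕ,
    (X i : MvPolynomial (Fin n) R₀) ^ N • m = 0

variable {ℳ : ℤ → Submodule R₀ M} {ℳ' : ℤ → Submodule R₀ M'}
  {y : MvPolynomial (Fin n) R₀} {f : M →ₗ[MvPolynomial (Fin n) R₀] M'}

namespace IsHyperplaneSection

theorem cechMap_mem (hf : IsHyperplaneSection ℳ ℳ' y f) {σ : Finset (Fin n)} {t : ℤ}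
    {z : LocalizedModule (monomialsOn R₀ σ) M} (hz : z ∈ localizedPiece ℳ σ t) :
    cechMap f σ z ∈ localizedPiece ℳ' σ t := by
  obtain ⟨e, m, s, hs, hm, rfl⟩ := (mem_localizedPiece hf.gradedAction).1 hz
  rw [cechMap_mk]
  exact mk_mem_localizedPiece hs (hf.map_mem hm)

theorem exists_cechMap_eq (hf : IsHyperplaneSection ℳ ℳ' y f) {σ : Finset (Fin n)} {t : ℤ}
    {z : LocalizedModule (monomialsOn R₀ σ) M'} (hz : z ∈ localizedPiece ℳ' σ t) :
    ∃ w ∈ localizedPiece ℳ σ t, cechMap f σ w = z := by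
  obtain ⟨e, m, s, hs, hm, rfl⟩ := (mem_localizedPiece hf.gradedAction').1 hz
  obtain ⟨m₁, hm₁, rfl⟩ := hf.exists_map_eq hm
  exact ⟨_, mk_mem_localizedPiece hs hm₁, cechMap_mk _ _ _ _⟩

/-- Vanishing in the localization is vanishing after multiplication by a monomial `u`; then `u • m`
is `y` times something, and `u` is put back into the denominator to restore the degree. -/
theorem exists_smul_eq_of_cechMap (hf : IsHyperplaneSection ℳ ℳ' y f) {σ : Finset (Fin n)} {t : ℤ}
    {z : LocalizedModule (monomialsOn R₀ σ) M} (hz : z ∈ localizedPiece ℳ σ t)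
    (h0 : cechMap f σ z = 0) : ∃ w ∈ localizedPiece ℳ σ (t - 1), y • w = z := by
  obtain ⟨e, m, s, hs, hm, rfl⟩ := (mem_localizedPiece hf.gradedAction).1 hz
  rw [cechMap_mk, ← LocalizedModule.zero_mk 1, LocalizedModule.mk_eq] at h0
  obtain ⟨u, hu⟩ := h0
  obtain ⟨k, hk⟩ := exists_isHomogeneous_of_mem_monomialsOn u.2
  rw [one_smul, smul_zero, smul_zero, Submonoid.smul_def, ← map_smul] at hu
  obtain ⟨m₀, hm₀, h⟩ := hf.exists_smul_eq (hf.gradedAction hk hm) hu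
  refine ⟨LocalizedModule.mk m₀ (u * s), mk_mem_localizedPiece (e := k + e) (hk.mul hs) ?_, ?_⟩
  · convert hm₀ using 2
    push_cast; ring
  · rw [LocalizedModule.smul'_mk, h]
    exact LocalizedModule.mk_cancel_common_left u s m

/-- The kernel of `y` is torsion, so it dies as soon as one variable is inverted. This needs `σ`
nonempty, which is why `y` is injective only on cochains of positive degree. -/
theorem eq_zero_of_smul_eq_zero (hf : IsHyperplaneSection ℳ ℳ' y f) {σ : Finset (Fin n)}
    (hσ : σ.Nonempty) {z : LocalizedModule (monomialsOn R₀ σ) M} (h0 : y • z = 0) : z = 0 := by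
  obtain ⟨i, hi⟩ := hσ
  induction z using LocalizedModule.induction_on with
  | _ m s =>
  rw [LocalizedModule.smul'_mk, ← LocalizedModule.zero_mk 1, LocalizedModule.mk_eq] at h0
  obtain ⟨u, hu⟩ := h0
  rw [one_smul, smul_zero, smul_zero, Submonoid.smul_def, smul_comm] at hu
  obtain ⟨N, hN⟩ := hf.torsion hu i
  rw [← LocalizedModule.zero_mk 1, LocalizedModule.mk_eq]
  refine ⟨⟨X i ^ N, Submonoid.pow_mem _ (X_mem_monomialsOn hi) N⟩ * u, ?_⟩
  rw [one_smul, smul_zero, smul_zero, mul_smul]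
  exact hN

theorem exists_cechCochainsMap_eq (hf : IsHyperplaneSection ℳ ℳ' y f) {p : ℕ} {t : ℤ}
    {c' : CechCochains R₀ n M' p} (hc' : c' ∈ cechPiece ℳ' p t) :
    ∃ c ∈ cechPiece ℳ p t, cechCochainsMap f p c = c' := by
  rw [mem_cechPiece] at hc'
  choose c hc h using fun σ => hf.exists_cechMap_eq (hc' σ)
  exact ⟨c, mem_cechPiece.2 hc, funext h⟩

theorem cechCochainsMap_mem (hf : IsHyperplaneSection ℳ ℳ' y f) {p : ℕ} {t : ℤ}
    {c : CechCochains R₀ n M p} (hc : c ∈ cechPiece ℳ p t) :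
    cechCochainsMap f p c ∈ cechPiece ℳ' p t := by
  rw [mem_cechPiece] at hc ⊢
  exact fun σ => hf.cechMap_mem (hc σ)

theorem exists_smul_eq_of_cechCochainsMap (hf : IsHyperplaneSection ℳ ℳ' y f) {p : ℕ} {t : ℤ}
    {c : CechCochains R₀ n M p} (hc : c ∈ cechPiece ℳ p t) (h0 : cechCochainsMap f p c = 0) :
    ∃ a ∈ cechPiece ℳ p (t - 1), y • a = c := by
  rw [mem_cechPiece] at hc
  choose a ha h using fun σ => hf.exists_smul_eq_of_cechMap (hc σ) (congrFun h0 σ)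
  exact ⟨a, mem_cechPiece.2 ha, funext h⟩

theorem cochain_eq_zero_of_smul_eq_zero (hf : IsHyperplaneSection ℳ ℳ' y f) {p : ℕ}
    {c : CechCochains R₀ n M (p + 1)} (h0 : y • c = 0) : c = 0 :=
  funext fun σ => hf.eq_zero_of_smul_eq_zero (Finset.card_pos.1 (by rw [σ.2]; omega))
    (congrFun h0 σ)

theorem cechCochainsMap_smul (hf : IsHyperplaneSection ℳ ℳ' y f) {p : ℕ}
    (c : CechCochains R₀ n M p) : cechCochainsMap f p (y • c) = 0 := by
  funext σ
  rw [cechCochainsMap_apply, Pi.smul_apply]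
  generalize c σ = z
  induction z using LocalizedModule.induction_on with
  | _ m s =>
    rw [LocalizedModule.smul'_mk, cechMap_mk, hf.map_smul_eq_zero]
    exact LocalizedModule.zero_mk _

theorem smul_mem_cechPiece (hf : IsHyperplaneSection ℳ ℳ' y f) {p : ℕ} {t : ℤ}
    {c : CechCochains R₀ n M p} (hc : c ∈ cechPiece ℳ p (t - 1)) : y • c ∈ cechPiece ℳ p t := by
  have := HilbertReg.smul_mem_cechPiece hf.gradedAction hf.isHomogeneous hc
  rwa [Nat.cast_one, sub_add_cancel] at this

/-- The part `H^p(M)_t → H^p(M/yM)_t → H^{p+1}(M)_{t-1}` of the long exact sequence. -/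
theorem cohomologyVanishes_section (hf : IsHyperplaneSection ℳ ℳ' y f) {p : ℕ} {t : ℤ}
    (h1 : CohomologyVanishes n ℳ p t) (h2 : CohomologyVanishes n ℳ (p + 1) (t - 1)) :
    CohomologyVanishes n ℳ' p t := by
  intro c' hc' hd'
  obtain ⟨c, hc, rfl⟩ := hf.exists_cechCochainsMap_eq hc'
  rw [cechDiff_cechCochainsMap] at hd'
  obtain ⟨b, hb, hyb⟩ := hf.exists_smul_eq_of_cechCochainsMap
    (cechDiff_mem_cechPiece hf.gradedAction hc) hd'
  have hdb : cechDiff R₀ n M (p + 1) b = 0 := by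
    refine hf.cochain_eq_zero_of_smul_eq_zero ?_
    rw [← map_smul, hyb, cechDiff_cechDiff]
  -- The cocycle `b` represents the connecting image. As it bounds `a`, the lift `c` can be
  -- corrected to the cocycle `c - y • a` without changing its image.
  obtain ⟨a, ha, hab⟩ := mem_cechCoboundaries_succ.1 (h2 b hb hdb)
  have hcob := h1 (c - y • a) (sub_mem hc (hf.smul_mem_cechPiece ha))
    (by rw [map_sub, map_smul, hab, hyb, sub_self])
  have hmap : cechCochainsMap f p c = cechCochainsMap f p (c - y • a) := by
    rw [map_sub, hf.cechCochainsMap_smul, sub_zero]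
  rw [hmap]
  match p with
  | 0 =>
    have h0 : c - y • a = 0 := hcob
    rw [h0, map_zero]
    exact zero_mem _
  | q + 1 =>
    obtain ⟨e, he, hde⟩ := mem_cechCoboundaries_succ.1 hcob
    rw [← hde, ← cechDiff_cechCochainsMap]
    exact mem_cechCoboundaries_succ.2 ⟨_, hf.cechCochainsMap_mem he, rfl⟩

/-- If `H^p(M/yM)_t = 0`, then the multiplication `y : H^{p+1}(M)_{t-1} → H^{p+1}(M)_t` is
injective. -/
theorem mem_cechCoboundaries_of_smul_mem (hf : IsHyperplaneSection ℳ ℳ' y f) {p : ℕ} {t : ℤ}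
    (h : CohomologyVanishes n ℳ' p t) {b : CechCochains R₀ n M (p + 1)}
    (hyb : y • b ∈ cechCoboundaries (n := n) ℳ (p + 1) t) :
    b ∈ cechCoboundaries (n := n) ℳ (p + 1) (t - 1) := by
  obtain ⟨c, hc, hdc⟩ := mem_cechCoboundaries_succ.1 hyb
  have hcob := h (cechCochainsMap f p c) (hf.cechCochainsMap_mem hc)
    (by rw [cechDiff_cechCochainsMap, hdc, hf.cechCochainsMap_smul])
  -- The image of `c` is a coboundary; subtracting the differential of a lift moves `c` into the
  -- kernel of the section map while keeping its own differential.
  have key : ∃ c₁ ∈ cechPiece ℳ p t, cechDiff R₀ n M p c₁ = y • b ∧ cechCochainsMap f p c₁ = 0 := by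
    match p with
    | 0 => exact ⟨c, hc, hdc, hcob⟩
    | q + 1 =>
      obtain ⟨e', he', hde'⟩ := mem_cechCoboundaries_succ.1 hcob
      obtain ⟨e, he, rfl⟩ := hf.exists_cechCochainsMap_eq he'
      refine ⟨c - cechDiff R₀ n M q e, sub_mem hc (cechDiff_mem_cechPiece hf.gradedAction he), ?_, ?_⟩
      · rw [map_sub, cechDiff_cechDiff, sub_zero, hdc]
      · rw [map_sub, ← hde', cechDiff_cechCochainsMap, sub_self]
  obtain ⟨c₁, hc₁, hdc₁, h0⟩ := key
  obtain ⟨a, ha, rfl⟩ := hf.exists_smul_eq_of_cechCochainsMap hc₁ h0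
  refine mem_cechCoboundaries_succ.2 ⟨a, ha, ?_⟩
  rw [map_smul] at hdc₁
  have := hf.cochain_eq_zero_of_smul_eq_zero (c := cechDiff R₀ n M p a - b)
    (by rw [smul_sub, hdc₁, sub_self])
  exact sub_eq_zero.1 this

end IsHyperplaneSection

end HyperplaneSection

/-! ### Higher local cohomology is `R_+`-torsion. -/

section Torsion

variable {R₀ : Type u} [CommRing R₀] {n : ℕ}
variable {M : Type v} [AddCommGroup M] [Module R₀ M] [Module (MvPolynomial (Fin n) R₀) M]
variable {ℳ : ℤ → Submodule R₀ M}

-- A nonzero homogeneous element has only one degree; this makes the degrees of denominators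
-- comparable.
omit [Module R₀ M] in
theorem ne_zero_of_mem_monomialsOn [Nontrivial R₀] {σ : Finset (Fin n)}
    {s : MvPolynomial (Fin n) R₀} (hs : s ∈ monomialsOn R₀ σ) : s ≠ 0 := by
  refine nonZeroDivisors.ne_zero (?_ : s ∈ nonZeroDivisors _)
  refine (Submonoid.closure_le (S := nonZeroDivisors (MvPolynomial (Fin n) R₀))).2 ?_ hs
  rintro _ ⟨i, -, rfl⟩
  exact isRegular_X.mem_nonZeroDivisors

/-- Passing from `ρ` to `ρ ∪ {i}` only introduces powers of `x_i` in denominators, which a power of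
`x_i` clears. Allowing every `N ≥ k` lets finitely many components share one exponent. -/
theorem exists_cechRes_eq_pow_smul (hℳ : IsGradedAction n ℳ) {ρ τ : Finset (Fin n)} {i : Fin n}
    (h : ρ ⊆ τ) (hτ : τ ⊆ insert i ρ) {t : ℤ} {z : LocalizedModule (monomialsOn R₀ τ) M}
    (hz : z ∈ localizedPiece ℳ τ t) :
    ∃ k : ℕ, ∀ N ≥ k, ∃ w ∈ localizedPiece ℳ ρ (t + N),
      cechRes R₀ M h w = (X i : MvPolynomial (Fin n) R₀) ^ N • z := by
  rcases subsingleton_or_nontrivial R₀ with h0 | h0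
  · have := Module.subsingleton (MvPolynomial (Fin n) R₀) (LocalizedModule (monomialsOn R₀ τ) M)
    exact ⟨0, fun N _ => ⟨0, zero_mem _, Subsingleton.elim _ _⟩⟩
  obtain ⟨e, m, ⟨s, hs⟩, hse, hm, rfl⟩ := (mem_localizedPiece hℳ).1 hz
  obtain ⟨k, s', hs', rfl⟩ := exists_eq_mul_pow_of_mem_monomialsOn_insert hτ hs
  obtain ⟨e', he'⟩ := exists_isHomogeneous_of_mem_monomialsOn hs'
  have hk := isHomogeneous_X_pow (R := R₀) i k
  obtain rfl : e = k + e' := hse.inj_right (hk.mul he') (ne_zero_of_mem_monomialsOn hs)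
  refine ⟨k, fun N hN => ⟨LocalizedModule.mk ((X i : MvPolynomial (Fin n) R₀) ^ (N - k) • m)
    ⟨s', hs'⟩, mk_mem_localizedPiece he' ?_, ?_⟩⟩
  · convert hℳ (isHomogeneous_X_pow (R := R₀) i (N - k)) hm using 2
    push_cast [hN]; ring
  · rw [cechRes_mk, LocalizedModule.smul'_mk, LocalizedModule.mk_eq]
    refine ⟨1, ?_⟩
    simp only [Submonoid.smul_def, smul_smul]
    congr 2
    rw [mul_right_comm, ← pow_add, Nat.add_sub_cancel' hN, mul_comm]

omit [Module R₀ M] in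
theorem exists_pow_smul_eq_zero_of_cechRes {ρ τ : Finset (Fin n)} {i : Fin n} (h : ρ ⊆ τ)
    (hτ : τ ⊆ insert i ρ) {z : LocalizedModule (monomialsOn R₀ ρ) M}
    (hz : cechRes R₀ M h z = 0) :
    ∃ k : ℕ, ∀ N ≥ k, (X i : MvPolynomial (Fin n) R₀) ^ N • z = 0 := by
  induction z using LocalizedModule.induction_on with
  | _ m s =>
  rw [cechRes_mk, ← LocalizedModule.zero_mk 1, LocalizedModule.mk_eq] at hz
  obtain ⟨⟨u, hu⟩, hz⟩ := hz
  rw [one_smul, smul_zero, smul_zero, Submonoid.smul_def] at hz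
  obtain ⟨k, s', hs', rfl⟩ := exists_eq_mul_pow_of_mem_monomialsOn_insert hτ hu
  refine ⟨k, fun N hN => ?_⟩
  rw [LocalizedModule.smul'_mk, ← LocalizedModule.zero_mk 1, LocalizedModule.mk_eq]
  refine ⟨⟨s', hs'⟩, ?_⟩
  rw [one_smul, smul_zero, smul_zero, Submonoid.smul_def, smul_smul]
  have : s' * X i ^ N = X i ^ (N - k) * (X i ^ k * s') := by
    rw [← mul_assoc, ← pow_add, Nat.sub_add_cancel hN, mul_comm]
  simp only [this, mul_smul _ (X i ^ k * s'), hz, smul_zero]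

omit [Module R₀ M] in
theorem cechDiff_apply_of_forall_ne {p : ℕ} {c : CechCochains R₀ n M p} {i : Fin n}
    (hc : ∀ σ, i ∈ σ.1 → c σ = 0) {τ : {σ : Finset (Fin n) // σ.card = p + 1}} (hi : i ∈ τ.1) :
    cechDiff R₀ n M p c τ = ((-1 : MvPolynomial (Fin n) R₀) ^ (τ.1.filter (· < i)).card) •
      cechRes R₀ M (Finset.erase_subset i τ.1) (c ⟨τ.1.erase i, by
        rw [Finset.card_erase_of_mem hi, τ.2, Nat.add_sub_cancel]⟩) := by
  rw [cechDiff_apply, Fintype.sum_eq_single ⟨i, hi⟩]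
  intro j hj
  have hj' : i ≠ j.1 := fun h => hj (Subtype.ext h.symm)
  rw [hc _ (Finset.mem_erase.2 ⟨hj', hi⟩), map_zero, smul_zero]

theorem smul_mem_cechCoboundaries (hℳ : IsGradedAction n ℳ) {p : ℕ} {t : ℤ} {k : ℕ}
    {f : MvPolynomial (Fin n) R₀} (hf : f.IsHomogeneous k) {b : CechCochains R₀ n M (p + 1)}
    (hb : b ∈ cechCoboundaries (n := n) ℳ (p + 1) t) :
    f • b ∈ cechCoboundaries (n := n) ℳ (p + 1) (t + k) := by
  obtain ⟨a, ha, rfl⟩ := mem_cechCoboundaries_succ.1 hb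
  exact mem_cechCoboundaries_succ.2 ⟨f • a, smul_mem_cechPiece hℳ hf ha, map_smul _ _ _⟩

-- For `i ∉ σ`, the component of the differential at `σ ∪ {i}` is, up to sign, the restriction of `c
-- σ`. Its vanishing means that a power of `x_i` kills `c σ`.
omit [Module R₀ M] in
theorem cochain_eq_zero_of_cechDiff_eq_zero {p : ℕ} {c : CechCochains R₀ n M p} {i : Fin n}
    (hc : ∀ σ, i ∈ σ.1 → c σ = 0) (hd : cechDiff R₀ n M p c = 0) :
    ∃ N : ℕ, (X i : MvPolynomial (Fin n) R₀) ^ N • c = 0 := by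
  have h : ∀ σ, ∃ k : ℕ, ∀ N ≥ k, (X i : MvPolynomial (Fin n) R₀) ^ N • c σ = 0 := by
    intro σ
    by_cases hi : i ∈ σ.1
    · exact ⟨0, fun N _ => by rw [hc σ hi, smul_zero]⟩
    · have hins : (insert i σ.1).card = p + 1 := by rw [Finset.card_insert_of_notMem hi, σ.2]
      have h1 := congrFun hd ⟨insert i σ.1, hins⟩
      rw [cechDiff_apply_of_forall_ne hc (Finset.mem_insert_self i σ.1)] at h1
      have h2 : cechRes R₀ M (Finset.subset_insert i σ.1) (c σ) = 0 := by
        have hcard : ((insert i σ.1).erase i).card = p := by rw [Finset.erase_insert hi, σ.2]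
        have h3 := cechRes_congr c (ρ := ⟨(insert i σ.1).erase i, hcard⟩) (ρ' := σ)
          (Subtype.ext (Finset.erase_insert hi)) (Finset.erase_subset i (insert i σ.1))
        rw [← h3]
        rcases neg_one_pow_eq_or (MvPolynomial (Fin n) R₀) ((insert i σ.1).filter (· < i)).card
          with h4 | h4
        · rwa [h4, one_smul] at h1
        · rw [h4, neg_one_smul] at h1
          exact neg_eq_zero.1 h1
      exact exists_pow_smul_eq_zero_of_cechRes _ (Finset.Subset.refl _) h2
  choose k hk using h
  exact ⟨Finset.univ.sup k, funext fun σ => hk σ _ (Finset.le_sup (Finset.mem_univ σ))⟩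

/-- Every class in `H^{p+1}_{R_+}(M)` is killed by a power of each variable. -/
theorem exists_X_pow_smul_mem_cechCoboundaries (hℳ : IsGradedAction n ℳ) (i : Fin n) {p : ℕ} {t : ℤ}
    {b : CechCochains R₀ n M (p + 1)} (hb : b ∈ cechPiece ℳ (p + 1) t)
    (hdb : cechDiff R₀ n M (p + 1) b = 0) :
    ∃ N : ℕ, (X i : MvPolynomial (Fin n) R₀) ^ N • b ∈
      cechCoboundaries (n := n) ℳ (p + 1) (t + N) := by
  rw [mem_cechPiece] at hb
  have h : ∀ τ : {σ : Finset (Fin n) // σ.card = p + 1}, ∃ k : ℕ, ∀ N ≥ k,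
      ∃ w ∈ localizedPiece ℳ (τ.1.erase i) (t + N),
        cechRes R₀ M (Finset.erase_subset i τ.1) w =
          (X i : MvPolynomial (Fin n) R₀) ^ N • b τ := fun τ =>
    exists_cechRes_eq_pow_smul hℳ _ (by
      intro x hx
      by_cases h : x = i <;> simp [h, hx]) (hb τ)
  choose k hk using h
  set N := Finset.univ.sup k
  -- This is the contracting homotopy at `i`: the component at `σ` is `± x_i^N` times `b` at `σ ∪
  -- {i}` if `i ∉ σ`, and `0` otherwise. The factor `x_i^N` makes it descend to the localization at
  -- `σ`.
  have h : ∀ σ : {σ : Finset (Fin n) // σ.card = p}, ∃ w ∈ localizedPiece ℳ σ.1 (t + N),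
      (i ∈ σ.1 → w = 0) ∧ ∀ (τ : {σ : Finset (Fin n) // σ.card = p + 1}) (hστ : σ.1 ⊆ τ.1),
        i ∈ τ.1 → σ.1 = τ.1.erase i →
        ((-1 : MvPolynomial (Fin n) R₀) ^ (τ.1.filter (· < i)).card) •
          cechRes R₀ M hστ w = (X i : MvPolynomial (Fin n) R₀) ^ N • b τ := by
    rintro ⟨σ, hσ⟩
    by_cases hi : i ∈ σ
    · refine ⟨0, zero_mem _, fun _ => rfl, fun τ _ _ h => ?_⟩
      rw [show σ = _ from h] at hi
      exact absurd hi (Finset.notMem_erase i τ.1)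
    · have hins : (insert i σ).card = p + 1 := by rw [Finset.card_insert_of_notMem hi, hσ]
      obtain ⟨w, hw, hwb⟩ := hk ⟨insert i σ, hins⟩ N (Finset.le_sup (Finset.mem_univ _))
      have hσe : (insert i σ).erase i = σ := Finset.erase_insert hi
      have key : ∀ ρ : Finset (Fin n), ρ = σ → ∀ (hρ : ρ ⊆ insert i σ)
          (w : LocalizedModule (monomialsOn R₀ ρ) M), w ∈ localizedPiece ℳ ρ (t + N) →
          ∃ w' ∈ localizedPiece ℳ σ (t + N),
            cechRes R₀ M (Finset.subset_insert i σ) w' = cechRes R₀ M hρ w := by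
        rintro ρ rfl hρ w hw
        exact ⟨w, hw, rfl⟩
      obtain ⟨w', hw', hww'⟩ := key _ hσe (Finset.erase_subset i _) w hw
      refine ⟨((-1 : MvPolynomial (Fin n) R₀) ^ ((insert i σ).filter (· < i)).card) • w',
        neg_one_pow_smul_mem_localizedPiece _ hw', fun h => absurd h hi, ?_⟩
      rintro ⟨τ, hτ⟩ hστ hiτ h
      obtain rfl : τ = insert i σ := by
        rw [show σ = _ from h]; exact (Finset.insert_erase hiτ).symm
      rw [map_smul, smul_smul, ← mul_pow, neg_one_mul, neg_neg, one_pow, one_smul]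
      exact hww'.trans hwb
  choose a ha ha0 hab using h
  have haP : a ∈ cechPiece ℳ p (t + N) := mem_cechPiece.2 ha
  -- The difference between `x_i^N • b` and the differential of `a` is a cocycle without components
  -- at sets containing `i`, so a further power of `x_i` kills it.
  obtain ⟨N', hN'⟩ := cochain_eq_zero_of_cechDiff_eq_zero
    (c := (X i : MvPolynomial (Fin n) R₀) ^ N • b - cechDiff R₀ n M p a) (i := i) (by
      intro τ hi
      have hcard : (τ.1.erase i).card = p := by
        rw [Finset.card_erase_of_mem hi, τ.2, Nat.add_sub_cancel]
      rw [Pi.sub_apply, cechDiff_apply_of_forall_ne ha0 hi, sub_eq_zero]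
      exact (hab ⟨τ.1.erase i, hcard⟩ τ (Finset.erase_subset i τ.1) hi rfl).symm) (by
      rw [map_sub, map_smul, hdb, smul_zero, cechDiff_cechDiff, sub_zero])
  refine ⟨N + N', mem_cechCoboundaries_succ.2 ⟨(X i : MvPolynomial (Fin n) R₀) ^ N' • a, ?_, ?_⟩⟩
  · convert smul_mem_cechPiece hℳ (isHomogeneous_X_pow (R := R₀) i N') haP using 2
    push_cast; ring
  · rw [smul_sub, sub_eq_zero, smul_smul, ← pow_add] at hN'
    rw [map_smul, ← hN', add_comm N' N]

/-- Pigeonhole: a monomial of degree `∑ k i + 1` has some exponent at least `k i`. The extra `1`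
covers the case of no variables. -/
theorem exists_pow_smul_mem_cechCoboundaries (hℳ : IsGradedAction n ℳ) {p : ℕ} {t : ℤ}
    {y : MvPolynomial (Fin n) R₀} (hy : y.IsHomogeneous 1)
    {b : CechCochains R₀ n M (p + 1)} (hb : b ∈ cechPiece ℳ (p + 1) t)
    (hdb : cechDiff R₀ n M (p + 1) b = 0) :
    ∃ N : ℕ, y ^ N • b ∈ cechCoboundaries (n := n) ℳ (p + 1) (t + N) := by
  choose k hk using fun i => exists_X_pow_smul_mem_cechCoboundaries hℳ i hb hdb
  refine ⟨∑ i, k i + 1, ?_⟩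
  have hyN : (y ^ (∑ i, k i + 1)).IsHomogeneous (∑ i, k i + 1) := by simpa using hy.pow _
  rw [(y ^ (∑ i, k i + 1)).as_sum, Finset.sum_smul]
  refine sum_mem fun α hα => ?_
  have hαd : α.degree = ∑ i, k i + 1 := by
    by_contra h
    exact (mem_support_iff.1 hα) (hyN.coeff_eq_zero h)
  obtain ⟨i, hi⟩ : ∃ i, k i ≤ α i := by
    by_contra! h
    have h1 : α.degree ≤ ∑ i, k i := by
      rw [Finsupp.degree_eq_sum]
      exact Finset.sum_le_sum fun i _ => (h i).le
    omega
  have hle : Finsupp.single i (k i) ≤ α := by simpa using hi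
  obtain ⟨β, rfl⟩ := exists_add_of_le hle
  have hβ : β.degree + k i = ∑ i, k i + 1 := by
    rw [← hαd, map_add, Finsupp.degree_single, add_comm]
  have hmon : monomial (Finsupp.single i (k i) + β) (coeff (Finsupp.single i (k i) + β)
      (y ^ (∑ i, k i + 1))) = monomial β (coeff (Finsupp.single i (k i) + β)
      (y ^ (∑ i, k i + 1))) * X i ^ k i := by
    rw [X_pow_eq_monomial, monomial_mul, mul_one, add_comm]
  rw [hmon, mul_smul]
  convert smul_mem_cechCoboundaries hℳ (isHomogeneous_monomial _ (rfl : β.degree = _)) (hk i) using 2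
  rw [← hβ]; push_cast; ring

end Torsion

variable {R₀ : Type u} [CommRing R₀] {n : ℕ}
variable {M : Type v} [AddCommGroup M] [Module R₀ M] [Module (MvPolynomial (Fin n) R₀) M]
variable {M' : Type w} [AddCommGroup M'] [Module R₀ M'] [Module (MvPolynomial (Fin n) R₀) M']
variable {ℳ : ℤ → Submodule R₀ M} {ℳ' : ℤ → Submodule R₀ M'}
  {y : MvPolynomial (Fin n) R₀} {f : M →ₗ[MvPolynomial (Fin n) R₀] M'}

/-- If `H^p(M/yM)` vanishes in all degrees `≥ t`, then `H^{p+1}(M)_{t-1} = 0`. -/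
theorem IsHyperplaneSection.cohomologyVanishes_succ (hf : IsHyperplaneSection ℳ ℳ' y f) {p : ℕ}
    {t : ℤ} (h : ∀ s ≥ t, CohomologyVanishes n ℳ' p s) : CohomologyVanishes n ℳ (p + 1) (t - 1) := by
  intro b hb hdb
  obtain ⟨N, hN⟩ := exists_pow_smul_mem_cechCoboundaries hf.gradedAction hf.isHomogeneous hb hdb
  clear hb hdb
  -- Multiplication by `y` is injective on the classes in question, so one factor of `y` is removed
  -- at a time; the degrees `t + N` that occur for `H^p` of the section are all at least `t`.
  induction N with
  | zero => simpa using hN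
  | succ N ih =>
    refine ih (?_ : _ ∈ _)
    have := hf.mem_cechCoboundaries_of_smul_mem (h (t + N) (by omega)) (b := y ^ N • b) (by
      rw [smul_smul, ← pow_succ']
      convert hN using 2
      push_cast; ring)
    convert this using 2
    ring

/-! ### Graded quotients of the polynomial ring and saturation. -/

section Quotients

variable {R₀ : Type u} [CommRing R₀] {n : ℕ}

/-- Homogeneity of an ideal of the polynomial ring for the standard grading. -/
abbrev IsHomog (J : Ideal (MvPolynomial (Fin n) R₀)) : Prop :=
  J.IsHomogeneous (homogeneousSubmodule (Fin n) R₀)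

theorem IsHomog.component_mem {J : Ideal (MvPolynomial (Fin n) R₀)} (hJ : IsHomog J) (k : ℕ)
    {f : MvPolynomial (Fin n) R₀} (hf : f ∈ J) : homogeneousComponent k f ∈ J := by
  have := hJ k hf
  rwa [← decomposition.decompose'_apply]

theorem IsHomog.sup_span {J : Ideal (MvPolynomial (Fin n) R₀)} (hJ : IsHomog J)
    {y : MvPolynomial (Fin n) R₀} {k : ℕ} (hy : y.IsHomogeneous k) :
    IsHomog (J ⊔ Ideal.span {y}) := by
  refine Ideal.IsHomogeneous.sup hJ (Ideal.homogeneous_span _ _ ?_)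
  rintro x hx
  obtain rfl := Set.mem_singleton_iff.1 hx
  exact ⟨k, hy⟩

theorem homogeneousComponent_mul_of_isHomogeneous {f g : MvPolynomial (Fin n) R₀} {k : ℕ}
    (hf : f.IsHomogeneous k) (t : ℕ) :
    homogeneousComponent (k + t) (f * g) = f * homogeneousComponent t g := by
  conv_lhs => rw [← sum_homogeneousComponent g, Finset.mul_sum, map_sum]
  have h : ∀ i, homogeneousComponent (k + t) (f * homogeneousComponent i g) =
      if i = t then f * homogeneousComponent i g else 0 := by
    intro i
    rw [homogeneousComponent_of_mem (hf.mul (homogeneousComponent_isHomogeneous i g))]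
    simp [eq_comm]
  simp only [h, Finset.sum_ite_eq', Finset.mem_range]
  split_ifs with h
  · rfl
  · rw [homogeneousComponent_eq_zero _ _ (by omega), mul_zero]

theorem homogeneousComponent_mul_of_lt {f g : MvPolynomial (Fin n) R₀} {k t : ℕ}
    (hf : f.IsHomogeneous k) (ht : t < k) : homogeneousComponent t (f * g) = 0 := by
  conv_lhs => rw [← sum_homogeneousComponent g, Finset.mul_sum, map_sum]
  refine Finset.sum_eq_zero fun i _ => ?_
  rw [homogeneousComponent_of_mem (hf.mul (homogeneousComponent_isHomogeneous i g)), if_neg]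
  omega

theorem mem_quotientGrading_natCast {J : Ideal (MvPolynomial (Fin n) R₀)} {t : ℕ}
    {m : MvPolynomial (Fin n) R₀ ⧸ J} :
    m ∈ quotientGrading J (t : ℤ) ↔ ∃ f : MvPolynomial (Fin n) R₀, f.IsHomogeneous t ∧
      Ideal.Quotient.mk J f = m := by
  simp [quotientGrading, Submodule.mem_map, mem_homogeneousSubmodule]

theorem quotientGrading_of_neg {J : Ideal (MvPolynomial (Fin n) R₀)} {t : ℤ} (ht : t < 0) :
    quotientGrading J t = ⊥ := if_neg (by omega)

theorem isGradedAction_quotientGrading (J : Ideal (MvPolynomial (Fin n) R₀)) :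
    IsGradedAction n (quotientGrading J) := by
  intro e f t m hf hm
  rcases lt_or_ge t 0 with ht | ht
  · rw [quotientGrading_of_neg ht, Submodule.mem_bot] at hm
    rw [hm, smul_zero]
    exact zero_mem _
  · lift t to ℕ using ht
    obtain ⟨g, hg, rfl⟩ := mem_quotientGrading_natCast.1 hm
    rw [← Nat.cast_add]
    exact mem_quotientGrading_natCast.2 ⟨f * g, by rw [add_comm]; exact hf.mul hg, rfl⟩

/-- The elements `f` whose class in `R / J` is `R_+`-torsion. -/
def satIdeal (J : Ideal (MvPolynomial (Fin n) R₀)) : Ideal (MvPolynomial (Fin n) R₀) where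
  carrier := {f | ∀ i, ∃ N : ℕ, X i ^ N * f ∈ J}
  zero_mem' := fun i => ⟨0, by simp⟩
  add_mem' := by
    intro a b ha hb i
    obtain ⟨N, hN⟩ := ha i
    obtain ⟨N', hN'⟩ := hb i
    refine ⟨N + N', ?_⟩
    rw [mul_add]
    refine J.add_mem ?_ ?_
    · rw [pow_add, mul_right_comm]; exact J.mul_mem_right _ hN
    · rw [pow_add, mul_assoc]; exact J.mul_mem_left _ hN'
  smul_mem' := by
    intro c a ha i
    obtain ⟨N, hN⟩ := ha i
    refine ⟨N, ?_⟩
    rw [smul_eq_mul, mul_left_comm]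
    exact J.mul_mem_left _ hN

theorem mem_satIdeal {J : Ideal (MvPolynomial (Fin n) R₀)} {f : MvPolynomial (Fin n) R₀} :
    f ∈ satIdeal J ↔ ∀ i, ∃ N : ℕ, X i ^ N * f ∈ J := Iff.rfl

theorem le_satIdeal (J : Ideal (MvPolynomial (Fin n) R₀)) : J ≤ satIdeal J :=
  fun _ hf _ => ⟨0, by simpa using hf⟩

theorem mem_satIdeal_of_X_pow_mul_mem {J : Ideal (MvPolynomial (Fin n) R₀)}
    {f : MvPolynomial (Fin n) R₀} (h : ∀ i, ∃ N : ℕ, X i ^ N * f ∈ satIdeal J) :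
    f ∈ satIdeal J := by
  intro i
  obtain ⟨N, hN⟩ := h i
  obtain ⟨N', hN'⟩ := hN i
  exact ⟨N' + N, by rwa [pow_add, mul_assoc]⟩

theorem IsHomog.satIdeal {J : Ideal (MvPolynomial (Fin n) R₀)} (hJ : IsHomog J) {k : ℕ}
    {f : MvPolynomial (Fin n) R₀} (hf : f ∈ satIdeal J) :
    homogeneousComponent k f ∈ HilbertReg.satIdeal J := by
  intro i
  obtain ⟨N, hN⟩ := hf i
  refine ⟨N, ?_⟩
  rw [← homogeneousComponent_mul_of_isHomogeneous (isHomogeneous_X_pow i N)]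
  exact hJ.component_mem _ hN

/-- `y` is filter-regular on `R / J`: the kernel of the multiplication by `y` is `R_+`-torsion. -/
def FilterRegular (J : Ideal (MvPolynomial (Fin n) R₀)) (y : MvPolynomial (Fin n) R₀) : Prop :=
  ∀ f, y * f ∈ J → f ∈ satIdeal J

/-- Taking the degree `t` component of `a + g y` replaces the cofactor `g` by a homogeneous one; in
degree `0` the multiple of `y` contributes nothing. -/
theorem exists_sub_mul_mem_of_mem_sup_span {J : Ideal (MvPolynomial (Fin n) R₀)} (hJ : IsHomog J)
    {y : MvPolynomial (Fin n) R₀} (hy : y.IsHomogeneous 1) {t : ℕ} {f : MvPolynomial (Fin n) R₀}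
    (hf : f.IsHomogeneous t) (h : f ∈ J ⊔ Ideal.span {y}) :
    (t = 0 ∧ f ∈ J) ∨ ∃ s, t = s + 1 ∧ ∃ g, g.IsHomogeneous s ∧ f - y * g ∈ J := by
  obtain ⟨a, ha, b, hb, rfl⟩ := Submodule.mem_sup.1 h
  obtain ⟨g, rfl⟩ := Ideal.mem_span_singleton'.1 hb
  have hf' : homogeneousComponent t (a + g * y) = a + g * y := by
    rw [homogeneousComponent_of_mem hf, if_pos rfl]
  rcases t with _ | s
  · left
    refine ⟨rfl, ?_⟩
    rw [← hf', map_add, mul_comm, homogeneousComponent_mul_of_lt hy one_pos, add_zero]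
    exact hJ.component_mem _ ha
  · right
    refine ⟨s, rfl, homogeneousComponent s g, homogeneousComponent_isHomogeneous _ _, ?_⟩
    have : homogeneousComponent (s + 1) (g * y) = y * homogeneousComponent s g := by
      rw [mul_comm, add_comm, homogeneousComponent_mul_of_isHomogeneous hy]
    rw [← hf', map_add, this, add_sub_cancel_right]
    exact hJ.component_mem _ ha

theorem isHyperplaneSection_factor {J : Ideal (MvPolynomial (Fin n) R₀)} (hJ : IsHomog J)
    {y : MvPolynomial (Fin n) R₀} (hy : y.IsHomogeneous 1) (h : FilterRegular J y) :
    IsHyperplaneSection (quotientGrading J) (quotientGrading (J ⊔ Ideal.span {y})) y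
      (Ideal.Quotient.factorₐ (MvPolynomial (Fin n) R₀)
        (le_sup_left : J ≤ J ⊔ Ideal.span {y})).toLinearMap where
  gradedAction := isGradedAction_quotientGrading _
  gradedAction' := isGradedAction_quotientGrading _
  isHomogeneous := hy
  map_mem := by
    intro t m hm
    rcases lt_or_ge t 0 with ht | ht
    · rw [quotientGrading_of_neg ht, Submodule.mem_bot] at hm
      rw [hm, map_zero]
      exact zero_mem _
    · lift t to ℕ using ht
      obtain ⟨g, hg, rfl⟩ := mem_quotientGrading_natCast.1 hm
      exact mem_quotientGrading_natCast.2 ⟨g, hg, rfl⟩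
  exists_map_eq := by
    intro t m hm
    rcases lt_or_ge t 0 with ht | ht
    · rw [quotientGrading_of_neg ht, Submodule.mem_bot] at hm
      exact ⟨0, zero_mem _, by rw [hm, map_zero]⟩
    · lift t to ℕ using ht
      obtain ⟨g, hg, rfl⟩ := mem_quotientGrading_natCast.1 hm
      exact ⟨Ideal.Quotient.mk J g, mem_quotientGrading_natCast.2 ⟨g, hg, rfl⟩, rfl⟩
  map_smul_eq_zero := by
    intro m
    obtain ⟨f, rfl⟩ := Ideal.Quotient.mk_surjective m
    refine (Ideal.Quotient.eq_zero_iff_mem (I := J ⊔ Ideal.span {y}) (a := y * f)).2 ?_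
    exact Ideal.mul_mem_right _ _ (Ideal.mem_sup_right (Ideal.mem_span_singleton_self y))
  exists_smul_eq := by
    intro t m hm hm0
    rcases lt_or_ge t 0 with ht | ht
    · rw [quotientGrading_of_neg ht, Submodule.mem_bot] at hm
      exact ⟨0, zero_mem _, by rw [hm, smul_zero]⟩
    · lift t to ℕ using ht
      obtain ⟨f, hf, rfl⟩ := mem_quotientGrading_natCast.1 hm
      have hm0' : f ∈ J ⊔ Ideal.span {y} := Ideal.Quotient.eq_zero_iff_mem.1 hm0
      rcases exists_sub_mul_mem_of_mem_sup_span hJ hy hf hm0' with ⟨rfl, h0⟩ | ⟨s, rfl, g, hg, hfg⟩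
      · exact ⟨0, zero_mem _, by rw [smul_zero, Ideal.Quotient.eq_zero_iff_mem.2 h0]⟩
      · refine ⟨Ideal.Quotient.mk J g, ?_, (Ideal.Quotient.eq.2 hfg).symm⟩
        rw [Nat.cast_succ, add_sub_cancel_right]
        exact mem_quotientGrading_natCast.2 ⟨g, hg, rfl⟩
  torsion := by
    intro m hm i
    obtain ⟨f, rfl⟩ := Ideal.Quotient.mk_surjective m
    have hm' : y * f ∈ J := Ideal.Quotient.eq_zero_iff_mem.1 hm
    obtain ⟨N, hN⟩ := h f hm' i
    exact ⟨N, Ideal.Quotient.eq_zero_iff_mem.2 hN⟩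

theorem cohomologyVanishes_zero_quotientGrading_iff {J : Ideal (MvPolynomial (Fin n) R₀)} {t : ℕ} :
    CohomologyVanishes n (quotientGrading J) 0 t ↔
      ∀ f : MvPolynomial (Fin n) R₀, f.IsHomogeneous t → f ∈ satIdeal J → f ∈ J := by
  rw [cohomologyVanishes_zero_iff (isGradedAction_quotientGrading J)]
  constructor
  · intro h f hf hfs
    refine Ideal.Quotient.eq_zero_iff_mem.1
      (h (Ideal.Quotient.mk J f) (mem_quotientGrading_natCast.2 ⟨f, hf, rfl⟩) fun i => ?_)
    obtain ⟨N, hN⟩ := hfs i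
    exact ⟨N, Ideal.Quotient.eq_zero_iff_mem.2 hN⟩
  · intro h m hm hm'
    obtain ⟨f, hf, rfl⟩ := mem_quotientGrading_natCast.1 hm
    refine Ideal.Quotient.eq_zero_iff_mem.2 (h f hf fun i => ?_)
    obtain ⟨N, hN⟩ := hm' i
    exact ⟨N, Ideal.Quotient.eq_zero_iff_mem.1 hN⟩

theorem mem_pow_idealOfVars_of_isHomogeneous {f : MvPolynomial (Fin n) R₀} {t : ℕ}
    (hf : f.IsHomogeneous t) : f ∈ idealOfVars (Fin n) R₀ ^ t := by
  rw [mem_pow_idealOfVars_iff]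
  intro x hx
  by_contra h
  exact mem_support_iff.1 hx (hf.coeff_eq_zero (by omega))

/-- By finite generation some power `R_+^K` multiplies the saturation into `J`. Artin–Rees puts
elements of the saturation lying in `R_+^t`, for large `t`, into `R_+^K` times the saturation. Thus
`H^0` lives in finitely many degrees. -/
theorem exists_forall_isHomogeneous_mem_of_mem_satIdeal [IsNoetherianRing R₀]
    (J : Ideal (MvPolynomial (Fin n) R₀)) :
    ∃ D : ℕ, ∀ t ≥ D, ∀ f : MvPolynomial (Fin n) R₀, f.IsHomogeneous t → f ∈ satIdeal J → f ∈ J := by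
  have hrad : idealOfVars (Fin n) R₀ ≤ (Submodule.colon J (satIdeal J : Set _)).radical := by
    rw [Ideal.span_le]
    rintro _ ⟨i, rfl⟩
    obtain ⟨G, hG⟩ := (isNoetherianRing_iff_ideal_fg _).1 inferInstance (satIdeal J)
    have hG' : ∀ g : G, ∃ N : ℕ, X i ^ N * g.1 ∈ J := fun g =>
      (hG ▸ Ideal.subset_span g.2 : g.1 ∈ satIdeal J) i
    choose N hN using hG'
    refine ⟨Finset.univ.sup N, Submodule.mem_colon.2 fun s hs => ?_⟩
    have hs' : s ∈ Ideal.span (G : Set (MvPolynomial (Fin n) R₀)) := hG ▸ hs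
    clear hs
    induction hs' using Submodule.span_induction with
    | mem x hx =>
      have hle : N ⟨x, hx⟩ ≤ Finset.univ.sup N := Finset.le_sup (Finset.mem_univ _)
      rw [smul_eq_mul, ← Nat.sub_add_cancel hle, pow_add, mul_assoc]
      exact J.mul_mem_left _ (hN ⟨x, hx⟩)
    | zero => rw [smul_zero]; exact J.zero_mem
    | add x y _ _ hx hy => rw [smul_add]; exact J.add_mem hx hy
    | smul a x _ hx => rw [smul_comm]; exact J.mul_mem_left _ hx
  obtain ⟨K, hK⟩ := Ideal.exists_pow_le_of_le_radical_of_fg hrad (idealOfVars_fg _ _)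
  obtain ⟨k, hk⟩ := Ideal.exists_pow_inf_eq_pow_smul (idealOfVars (Fin n) R₀) (satIdeal J)
  refine ⟨k + K, fun t ht f hf hfs => ?_⟩
  have h1 : f ∈ idealOfVars (Fin n) R₀ ^ t • ⊤ ⊓ satIdeal J := by
    refine ⟨?_, hfs⟩
    simpa using mem_pow_idealOfVars_of_isHomogeneous hf
  rw [hk t (by omega)] at h1
  refine Submodule.smul_induction_on h1 ?_ fun _ _ => J.add_mem
  intro r hr s hs
  exact Submodule.mem_colon.1 (hK (Ideal.pow_le_pow_right (by omega) hr)) s hs.2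

end Quotients

/-! ### Avoiding finitely many proper submodules. -/

section Avoidance

/-- Over a local ring with infinite residue field, a module is not a finite union of proper
submodules. -/
theorem exists_forall_notMem_of_infinite_residueField {A : Type u} [CommRing A] [IsLocalRing A]
    [Infinite (IsLocalRing.ResidueField A)] {V : Type v} [AddCommGroup V] [Module A V]
    (s : Finset (Submodule A V)) (hs : ⊤ ∉ s) : ∃ v, ∀ W ∈ s, v ∉ W := by
  by_contra! h
  -- B. H. Neumann: in a finite cover by subgroups, some member has finite index.
  obtain ⟨W, hW, hfin⟩ := Submodule.exists_finiteIndex_of_cover (p := id) (s := s) (by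
    refine Set.eq_univ_of_forall fun v => ?_
    obtain ⟨W, hW, hv⟩ := h v
    exact Set.mem_biUnion hW hv)
  have : W.toAddSubgroup.FiniteIndex := hfin
  have hfin' : Finite (V ⧸ W) := AddSubgroup.finite_quotient_of_finiteIndex (H := W.toAddSubgroup)
  obtain ⟨v, -, hv⟩ := SetLike.exists_of_lt (lt_top_iff_ne_top.2 (ne_of_mem_of_not_mem hW hs))
  -- Lifts of distinct residues differ by a unit, so their multiples of `v ∉ W` stay distinct modulo
  -- `W`.
  have hinf : Infinite (V ⧸ W) := by
    choose S hS using IsLocalRing.residue_surjective (R := A)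
    refine Infinite.of_injective (fun c => W.mkQ (S c • v)) fun c c' h => ?_
    by_contra hne
    have h1 : S c • v - S c' • v ∈ W := (Submodule.Quotient.eq W).1 h
    rw [← sub_smul] at h1
    have hu : IsUnit (S c - S c') := by
      by_contra hu
      have := (IsLocalRing.residue_eq_zero_iff _).2 ((IsLocalRing.mem_maximalIdeal _).2 hu)
      rw [map_sub, hS, hS, sub_eq_zero] at this
      exact hne this
    exact hv ((W.smul_mem_iff_of_isUnit hu).1 h1)
  exact not_finite (V ⧸ W)

end Avoidance

/-! ### General linear forms. -/

section LinearForms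

variable {R₀ : Type u} [CommRing R₀] {n : ℕ}

/-- The linear form with given coefficients. -/
def linearForm : (Fin n → R₀) →ₗ[R₀] MvPolynomial (Fin n) R₀ :=
  Fintype.linearCombination R₀ X

theorem linearForm_apply (a : Fin n → R₀) : linearForm a = ∑ i, a i • X i := rfl

theorem isHomogeneous_linearForm (a : Fin n → R₀) : (linearForm a).IsHomogeneous 1 :=
  (homogeneousSubmodule (Fin n) R₀ 1).sum_mem fun i _ =>
    Submodule.smul_mem _ _ (isHomogeneous_X R₀ i)

theorem linearForm_single [DecidableEq (Fin n)] (i : Fin n) :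
    linearForm (Pi.single i (1 : R₀)) = X i := by
  simp [linearForm_apply, Pi.single_apply]

/-- If `y f ∈ J`, every minimal prime over the annihilator of the class of `f` is an associated
prime of `R / J` containing `y`, hence containing each variable. So a power of each variable kills
the class. -/
theorem filterRegular_of_forall_associatedPrimes [IsNoetherianRing R₀]
    {J : Ideal (MvPolynomial (Fin n) R₀)} {y : MvPolynomial (Fin n) R₀}
    (h : ∀ P ∈ associatedPrimes (MvPolynomial (Fin n) R₀) (MvPolynomial (Fin n) R₀ ⧸ J),
      y ∈ P → ∀ i, X i ∈ P) : FilterRegular J y := by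
  intro f hf i
  let N : Submodule (MvPolynomial (Fin n) R₀) (MvPolynomial (Fin n) R₀ ⧸ J) :=
    Submodule.span _ {Ideal.Quotient.mk J f}
  have hann : ∀ g, g ∈ Module.annihilator (MvPolynomial (Fin n) R₀) N ↔ g * f ∈ J := by
    intro g
    rw [← Submodule.annihilator, Submodule.mem_annihilator_span_singleton]
    exact Ideal.Quotient.eq_zero_iff_mem
  have hX : X i ∈ (Module.annihilator (MvPolynomial (Fin n) R₀) N).radical := by
    rw [← Ideal.sInf_minimalPrimes, Ideal.mem_sInf]
    intro P hP
    have hP' := associatedPrimes.subset_of_injective N.injective_subtype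
      (Module.associatedPrimes.minimalPrimes_annihilator_subset_associatedPrimes _ N hP)
    exact h P hP' (hP.1.2 ((hann y).2 hf)) i
  obtain ⟨k, hk⟩ := hX
  exact ⟨k, (hann _).1 hk⟩

/-- The ideal generated by `I` and the linear forms with coefficient vectors `a i`, `i < j`. -/
def sectionIdeal (I : Ideal (MvPolynomial (Fin n) R₀)) (a : ℕ → Fin n → R₀) (j : ℕ) :
    Ideal (MvPolynomial (Fin n) R₀) :=
  I ⊔ Ideal.span ((fun i => linearForm (a i)) '' Set.Iio j)

theorem sectionIdeal_zero (I : Ideal (MvPolynomial (Fin n) R₀)) (a : ℕ → Fin n → R₀) :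
    sectionIdeal I a 0 = I := by
  simp [sectionIdeal]

theorem sectionIdeal_succ (I : Ideal (MvPolynomial (Fin n) R₀)) (a : ℕ → Fin n → R₀) (j : ℕ) :
    sectionIdeal I a (j + 1) = sectionIdeal I a j ⊔ Ideal.span {linearForm (a j)} := by
  rw [sectionIdeal, sectionIdeal, sup_assoc, ← Ideal.span_union, Set.union_singleton,
    ← Set.image_insert_eq (f := fun i => linearForm (a i)), ← Order.Iio_succ_eq_insert]
  rfl

theorem sectionIdeal_congr (I : Ideal (MvPolynomial (Fin n) R₀)) {a b : ℕ → Fin n → R₀} {j : ℕ}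
    (h : ∀ i < j, a i = b i) : sectionIdeal I a j = sectionIdeal I b j := by
  rw [sectionIdeal, sectionIdeal]
  congr 2
  exact Set.image_congr fun i hi => by rw [h i hi]

theorem isHomog_sectionIdeal {I : Ideal (MvPolynomial (Fin n) R₀)} (hI : IsHomog I)
    (a : ℕ → Fin n → R₀) (j : ℕ) : IsHomog (sectionIdeal I a j) := by
  induction j with
  | zero => rwa [sectionIdeal_zero]
  | succ j ih =>
    rw [sectionIdeal_succ]
    exact ih.sup_span (isHomogeneous_linearForm _)

theorem le_sectionIdeal (I : Ideal (MvPolynomial (Fin n) R₀)) (a : ℕ → Fin n → R₀) (j : ℕ) :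
    I ≤ sectionIdeal I a j := le_sup_left

theorem linearForm_mem_sectionIdeal (I : Ideal (MvPolynomial (Fin n) R₀)) (a : ℕ → Fin n → R₀)
    {i j : ℕ} (h : i < j) : linearForm (a i) ∈ sectionIdeal I a j :=
  Ideal.mem_sup_right (Ideal.subset_span ⟨i, h, rfl⟩)

theorem sectionIdeal_mono (I : Ideal (MvPolynomial (Fin n) R₀)) (a : ℕ → Fin n → R₀) {i j : ℕ}
    (h : i ≤ j) : sectionIdeal I a i ≤ sectionIdeal I a j :=
  sup_le_sup_left (Ideal.span_mono (Set.image_mono (Set.Iio_subset_Iio h))) _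

variable [IsLocalRing R₀]

/-- The reduction of a coefficient vector modulo the maximal ideal. -/
def residueVec : (Fin n → R₀) →ₗ[R₀] (Fin n → IsLocalRing.ResidueField R₀) :=
  LinearMap.pi fun i => (Algebra.linearMap R₀ (IsLocalRing.ResidueField R₀)) ∘ₗ LinearMap.proj i

theorem residueVec_surjective : Function.Surjective (residueVec (R₀ := R₀) (n := n)) := by
  intro v
  choose w hw using fun i => IsLocalRing.residue_surjective (v i)
  exact ⟨w, funext hw⟩

/-- Avoidance is applied to coefficient vectors: each associated prime missing some variable pulls
back to a proper submodule, since unit vectors map to variables. The subspace `W` is there to be the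
span of the reductions of the forms already chosen. -/
theorem exists_filterRegular_linearForm [IsNoetherianRing R₀]
    [Infinite (IsLocalRing.ResidueField R₀)] (J : Ideal (MvPolynomial (Fin n) R₀))
    (W : Submodule (IsLocalRing.ResidueField R₀) (Fin n → IsLocalRing.ResidueField R₀))
    (hW : W ≠ ⊤) :
    ∃ a : Fin n → R₀, residueVec a ∉ W ∧
      ∀ P ∈ associatedPrimes (MvPolynomial (Fin n) R₀) (MvPolynomial (Fin n) R₀ ⧸ J),
        linearForm a ∈ P → ∀ i, X i ∈ P := by
  classical
  have hfin : {P ∈ associatedPrimes (MvPolynomial (Fin n) R₀) (MvPolynomial (Fin n) R₀ ⧸ J) |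
      ¬ ∀ i, X i ∈ P}.Finite :=
    (associatedPrimes.finite _ _).subset fun _ h => h.1
  let toSub : Ideal (MvPolynomial (Fin n) R₀) → Submodule R₀ (Fin n → R₀) := fun P =>
    (P.restrictScalars R₀).comap linearForm
  let s : Finset (Submodule R₀ (Fin n → R₀)) :=
    insert ((W.restrictScalars R₀).comap residueVec) (hfin.toFinset.image toSub)
  have hs : ⊤ ∉ s := by
    intro h
    rcases Finset.mem_insert.1 h with h | h
    · apply hW
      rw [eq_top_iff]
      intro v _
      obtain ⟨w, rfl⟩ := residueVec_surjective v
      have : w ∈ (⊤ : Submodule R₀ (Fin n → R₀)) := trivial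
      rw [h] at this
      exact this
    · obtain ⟨P, hP, h⟩ := Finset.mem_image.1 h
      refine ((Set.Finite.mem_toFinset _).1 hP).2 fun i => ?_
      have : Pi.single i (1 : R₀) ∈ toSub P := by rw [h]; trivial
      rw [← linearForm_single i]
      exact this
  obtain ⟨a, ha⟩ := exists_forall_notMem_of_infinite_residueField s hs
  refine ⟨a, fun h => ha _ (Finset.mem_insert_self _ _) h, fun P hP hPa => ?_⟩
  by_contra hX
  refine ha (toSub P) (Finset.mem_insert_of_mem (Finset.mem_image_of_mem _ ?_)) hPa
  exact (Set.Finite.mem_toFinset _).2 ⟨hP, hX⟩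

/-- A general sequence of linear forms: linearly independent modulo the maximal ideal, and each of
them avoids the relevant associated primes of the quotient by the previous ones. -/
theorem exists_general_linearForms [IsNoetherianRing R₀]
    [Infinite (IsLocalRing.ResidueField R₀)] (I : Ideal (MvPolynomial (Fin n) R₀)) :
    ∃ a : ℕ → Fin n → R₀,
      (∀ j < n, residueVec (a j) ∉
        Submodule.span (IsLocalRing.ResidueField R₀) ((fun i => residueVec (a i)) '' Set.Iio j)) ∧
      ∀ j < n, ∀ P ∈ associatedPrimes (MvPolynomial (Fin n) R₀)
        (MvPolynomial (Fin n) R₀ ⧸ sectionIdeal I a j), linearForm (a j) ∈ P → ∀ i, X i ∈ P := by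
  suffices h : ∀ k ≤ n, ∃ a : ℕ → Fin n → R₀,
      (∀ j < k, residueVec (a j) ∉
        Submodule.span (IsLocalRing.ResidueField R₀) ((fun i => residueVec (a i)) '' Set.Iio j)) ∧
      ∀ j < k, ∀ P ∈ associatedPrimes (MvPolynomial (Fin n) R₀)
        (MvPolynomial (Fin n) R₀ ⧸ sectionIdeal I a j), linearForm (a j) ∈ P → ∀ i, X i ∈ P from
    h n le_rfl
  intro k
  induction k with
  | zero => exact fun _ => ⟨0, by simp, by simp⟩
  | succ k ih =>
    intro hk
    classical
    obtain ⟨a, ha1, ha2⟩ := ih (by omega)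
    obtain ⟨v, hv1, hv2⟩ := exists_filterRegular_linearForm (sectionIdeal I a k)
      (Submodule.span (IsLocalRing.ResidueField R₀) ((fun i => residueVec (a i)) '' Set.Iio k)) (by
        intro h
        have h1 := finrank_span_finset_le_card (R := IsLocalRing.ResidueField R₀)
          ((Finset.range k).image fun i => residueVec (a i))
        rw [Set.finrank, Finset.coe_image, Finset.coe_range, h, finrank_top,
          Module.finrank_fin_fun] at h1
        have := h1.trans Finset.card_image_le
        rw [Finset.card_range] at this
        omega)
    -- All conditions of index below `k`, and the ideals of index at most `k`, involve only the old
    -- vectors, so they survive the change at `k`.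
    have hb : ∀ i < k, Function.update a k v i = a i := fun i hi =>
      Function.update_of_ne hi.ne _ _
    have himg : ∀ j ≤ k, (fun i => residueVec (Function.update a k v i)) '' Set.Iio j =
        (fun i => residueVec (a i)) '' Set.Iio j := fun j hj =>
      Set.image_congr fun i hi => by rw [hb i (lt_of_lt_of_le hi hj)]
    have hsec : ∀ j ≤ k, sectionIdeal I (Function.update a k v) j = sectionIdeal I a j :=
      fun j hj => sectionIdeal_congr I fun i hi => hb i (by omega)
    refine ⟨Function.update a k v, fun j hj => ?_, fun j hj => ?_⟩
    · rw [himg j (by omega)]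
      rcases (Nat.lt_succ_iff.1 hj).lt_or_eq with h | rfl
      · rw [hb j h]; exact ha1 j h
      · rwa [Function.update_self]
    · rw [hsec j (by omega)]
      rcases (Nat.lt_succ_iff.1 hj).lt_or_eq with h | rfl
      · rw [hb j h]; exact ha2 j h
      · rwa [Function.update_self]

omit [IsLocalRing R₀] in
theorem linearIndependent_of_forall_notMem_span_image {K V : Type*} [DivisionRing K]
    [AddCommGroup V] [Module K V] {v : ℕ → V} {k : ℕ}
    (h : ∀ j < k, v j ∉ Submodule.span K (v '' Set.Iio j)) :
    LinearIndependent K (fun i : Fin k => v i) := by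
  induction k with
  | zero => exact linearIndependent_empty_type
  | succ k ih =>
    rw [linearIndependent_finSucc']
    refine ⟨ih fun j hj => h j (by omega), fun hmem => h k (by omega) ?_⟩
    refine Submodule.span_mono ?_ hmem
    rintro _ ⟨i, rfl⟩
    exact ⟨i, i.2, rfl⟩

/-- Linear forms whose reductions are linearly independent generate the same `R₀`-module as the
variables. -/
theorem exists_X_eq_sum_linearForm {a : ℕ → Fin n → R₀}
    (ha : ∀ j < n, residueVec (a j) ∉
      Submodule.span (IsLocalRing.ResidueField R₀) ((fun i => residueVec (a i)) '' Set.Iio j)) :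
    ∃ b : Fin n → Fin n → R₀, ∀ i, X i = ∑ j : Fin n, b i j • linearForm (a j) := by
  classical
  have hli : LinearIndependent (IsLocalRing.ResidueField R₀) (fun j : Fin n => residueVec (a j)) :=
    linearIndependent_of_forall_notMem_span_image (v := fun i => residueVec (a i)) ha
  let A : Matrix (Fin n) (Fin n) R₀ := Matrix.of fun i => a i
  have hA : IsUnit (A.map (IsLocalRing.residue R₀)) := Matrix.linearIndependent_rows_iff_isUnit.1 hli
  -- A determinant that is a unit in the residue field is a unit in the local ring, so the
  -- coefficient matrix can be inverted over `R₀`.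
  have hdet : IsUnit A.det := by
    rw [Matrix.isUnit_iff_isUnit_det, ← RingHom.mapMatrix_apply, ← RingHom.map_det,
      isUnit_map_iff] at hA
    exact hA
  refine ⟨fun i j => A⁻¹ i j, fun i => ?_⟩
  simp only [← map_smul, ← map_sum, ← linearForm_single (R₀ := R₀) i]
  congr 1
  funext k
  have := congrFun (congrFun (Matrix.nonsing_inv_mul A hdet) i) k
  rw [Matrix.mul_apply] at this
  rw [Finset.sum_apply, Pi.single_apply]
  simp only [Matrix.one_apply, eq_comm (a := i)] at this
  exact this.symm

end LinearForms

/-! ### Minimal primes and dimension of linear sections. -/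

section Dimension

variable {R₀ : Type u} [CommRing R₀] {n : ℕ}

/-- The homogeneous ideal generated by the maximal ideal of `R₀` and the variables. -/
def gradedMaximalIdeal (R₀ : Type u) [CommRing R₀] [IsLocalRing R₀] (n : ℕ) :
    Ideal (MvPolynomial (Fin n) R₀) :=
  (IsLocalRing.maximalIdeal R₀).comap constantCoeff

theorem mem_idealOfVars_iff {f : MvPolynomial (Fin n) R₀} :
    f ∈ idealOfVars (Fin n) R₀ ↔ constantCoeff f = 0 := by
  rw [← pow_one (idealOfVars (Fin n) R₀), mem_pow_idealOfVars_iff', constantCoeff_eq]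
  constructor
  · exact fun h => h 0 (by simp)
  · intro h x hx
    rw [Nat.lt_one_iff, Finsupp.degree_eq_zero_iff] at hx
    rwa [hx]

theorem sub_C_constantCoeff_mem_idealOfVars (f : MvPolynomial (Fin n) R₀) :
    f - C (constantCoeff f) ∈ idealOfVars (Fin n) R₀ := by
  rw [mem_idealOfVars_iff, map_sub, constantCoeff_C, sub_self]

theorem C_constantCoeff_mem_of_isHomog {J : Ideal (MvPolynomial (Fin n) R₀)} (hJ : IsHomog J)
    {f : MvPolynomial (Fin n) R₀} (hf : f ∈ J) : C (constantCoeff f) ∈ J := by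
  have := hJ.component_mem 0 hf
  rwa [homogeneousComponent_zero] at this

theorem idealOfVars_le_of_forall_X_mem {P : Ideal (MvPolynomial (Fin n) R₀)}
    (h : ∀ i, X i ∈ P) : idealOfVars (Fin n) R₀ ≤ P := by
  rw [Ideal.span_le]
  rintro _ ⟨i, rfl⟩
  exact h i

/-- The homogeneous core of a prime is prime and still contains `J`, so minimality makes the prime
equal to its core. -/
theorem isHomog_of_mem_minimalPrimes {J P : Ideal (MvPolynomial (Fin n) R₀)} (hJ : IsHomog J)
    (hP : P ∈ J.minimalPrimes) : IsHomog P := by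
  have hprime : P.IsPrime := hP.1.1
  have hle : J ≤ (P.homogeneousCore (homogeneousSubmodule (Fin n) R₀)).toIdeal := by
    rw [← hJ.toIdeal_homogeneousCore_eq_self]
    exact Ideal.homogeneousCore_mono _ hP.1.2
  have := hP.2 ⟨hprime.homogeneousCore, hle⟩ (Ideal.toIdeal_homogeneousCore_le _ _)
  rw [le_antisymm this (Ideal.toIdeal_homogeneousCore_le _ _)]
  exact HomogeneousIdeal.isHomogeneous _

theorem eq_top_satIdeal_iff {J : Ideal (MvPolynomial (Fin n) R₀)} :
    satIdeal J = ⊤ ↔ ∀ i, X i ∈ J.radical := by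
  rw [Ideal.eq_top_iff_one, mem_satIdeal]
  simp [Ideal.mem_radical_iff]

theorem satIdeal_mono {J J' : Ideal (MvPolynomial (Fin n) R₀)} (h : J ≤ J') :
    satIdeal J ≤ satIdeal J' := by
  intro f hf i
  obtain ⟨N, hN⟩ := hf i
  exact ⟨N, h hN⟩

open scoped Pointwise in
theorem smul_top_quotient_eq_map {A : Type u} [CommRing A] (J : Ideal A) (y : A) :
    (y • ⊤ : Submodule A (A ⧸ J)) = Submodule.map J.mkQ (Ideal.span {y}) := by
  rw [Ideal.span, Submodule.map_span, Set.image_singleton]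
  ext m
  rw [Submodule.mem_span_singleton, Submodule.mem_smul_pointwise_iff_exists]
  constructor
  · rintro ⟨b, -, rfl⟩
    obtain ⟨b, rfl⟩ := Ideal.Quotient.mk_surjective b
    exact ⟨b, congrArg (Ideal.Quotient.mk J) (mul_comm b y)⟩
  · rintro ⟨b, rfl⟩
    exact ⟨Ideal.Quotient.mk J b, trivial, congrArg (Ideal.Quotient.mk J) (mul_comm y b)⟩

/-- The quotient of `A / J` by `y`. -/
def quotSMulTopQuotientEquiv {A : Type u} [CommRing A] (J : Ideal A) (y : A) :
    QuotSMulTop y (A ⧸ J) ≃ₗ[A] A ⧸ (J ⊔ Ideal.span {y}) :=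
  (Submodule.quotEquivOfEq _ _ (smul_top_quotient_eq_map J y)).trans
    (Submodule.quotientQuotientEquivQuotientSup J (Ideal.span {y}))

theorem supportDim_quotSMulTop_quotient {A : Type u} [CommRing A] (J : Ideal A) (y : A) :
    Module.supportDim A (QuotSMulTop y (A ⧸ J)) = ringKrullDim (A ⧸ (J ⊔ Ideal.span {y})) := by
  rw [← Module.supportDim_quotient_eq_ringKrullDim]
  exact Module.supportDim_eq_of_equiv (quotSMulTopQuotientEquiv J y)

theorem ringKrullDim_quotient_sup_span_add_one_le {A : Type u} [CommRing A] {J : Ideal A} {y : A}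
    (h : ∀ P ∈ J.minimalPrimes, y ∉ P) :
    ringKrullDim (A ⧸ (J ⊔ Ideal.span {y})) + 1 ≤ ringKrullDim (A ⧸ J) := by
  rw [← supportDim_quotSMulTop_quotient, ← Module.supportDim_quotient_eq_ringKrullDim]
  refine Module.supportDim_quotSMulTop_succ_le_of_notMem_minimalPrimes ?_
  rwa [Ideal.annihilator_quotient]

theorem withBot_enat_le_zero_of_add_le {A : WithBot ℕ∞} {d : ℕ} (h : A + d ≤ d) : A ≤ 0 := by
  induction A using WithBot.recBotCoe with
  | bot => exact bot_le
  | coe a =>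
    induction a using ENat.recTopCoe with
    | top =>
      have h' : ((⊤ + (d : ℕ∞) : ℕ∞) : WithBot ℕ∞) ≤ ((d : ℕ∞) : WithBot ℕ∞) := h
      rw [WithBot.coe_le_coe, top_add, top_le_iff] at h'
      exact absurd h' (ENat.natCast_ne_top d)
    | coe a =>
      norm_cast at h ⊢
      omega

variable [IsLocalRing R₀]

instance isPrime_gradedMaximalIdeal : (gradedMaximalIdeal R₀ n).IsPrime :=
  Ideal.IsPrime.comap _

theorem X_mem_gradedMaximalIdeal (i : Fin n) : X i ∈ gradedMaximalIdeal R₀ n := by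
  simp [gradedMaximalIdeal]

variable [IsArtinianRing R₀]

/-- The contraction of `P` is a prime of an Artinian local ring, hence its maximal ideal. -/
theorem C_mem_iff_mem_maximalIdeal {P : Ideal (MvPolynomial (Fin n) R₀)} [P.IsPrime] {c : R₀} :
    C c ∈ P ↔ c ∈ IsLocalRing.maximalIdeal R₀ := by
  have : (P.comap (C : R₀ →+* MvPolynomial (Fin n) R₀)).IsMaximal :=
    IsArtinianRing.isMaximal_of_isPrime _
  rw [← Ideal.mem_comap, IsLocalRing.eq_maximalIdeal this]

theorem le_gradedMaximalIdeal_of_isHomog {P : Ideal (MvPolynomial (Fin n) R₀)} [P.IsPrime]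
    (hP : IsHomog P) : P ≤ gradedMaximalIdeal R₀ n := fun _ hf =>
  C_mem_iff_mem_maximalIdeal.1 (C_constantCoeff_mem_of_isHomog hP hf)

theorem gradedMaximalIdeal_le_of_forall_X_mem {P : Ideal (MvPolynomial (Fin n) R₀)} [P.IsPrime]
    (hP : ∀ i, X i ∈ P) : gradedMaximalIdeal R₀ n ≤ P := by
  intro f hf
  rw [← sub_add_cancel f (C (constantCoeff f))]
  exact P.add_mem (idealOfVars_le_of_forall_X_mem hP (sub_C_constantCoeff_mem_idealOfVars f))
    (C_mem_iff_mem_maximalIdeal.2 hf)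

/-- If the graded maximal ideal is a minimal prime of a homogeneous ideal `J`, then it is the only
one. -/
theorem satIdeal_eq_top_of_mem_minimalPrimes {J : Ideal (MvPolynomial (Fin n) R₀)} (hJ : IsHomog J)
    (h : gradedMaximalIdeal R₀ n ∈ J.minimalPrimes) : satIdeal J = ⊤ := by
  rw [eq_top_satIdeal_iff]
  intro i
  rw [← Ideal.sInf_minimalPrimes, Ideal.mem_sInf]
  intro Q hQ
  have hQprime : Q.IsPrime := hQ.1.1
  have hle := le_gradedMaximalIdeal_of_isHomog (isHomog_of_mem_minimalPrimes hJ hQ)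
  exact h.2 hQ.1 hle (X_mem_gradedMaximalIdeal i)

/-- In dimension zero all primes over `J` are maximal, so a minimal prime below the graded maximal
ideal coincides with it. -/
theorem satIdeal_eq_top_of_ringKrullDim_le_zero {J : Ideal (MvPolynomial (Fin n) R₀)}
    (hJ : IsHomog J) (hJle : J ≤ gradedMaximalIdeal R₀ n)
    (h : ringKrullDim (MvPolynomial (Fin n) R₀ ⧸ J) ≤ 0) : satIdeal J = ⊤ := by
  apply satIdeal_eq_top_of_mem_minimalPrimes hJ
  obtain ⟨Q, hQ, hle⟩ := Ideal.exists_minimalPrimes_le hJle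
  have : Ring.KrullDimLE 0 (MvPolynomial (Fin n) R₀ ⧸ J) := Ring.krullDimLE_iff.2 (by simpa using h)
  have hQprime : Q.IsPrime := hQ.1.1
  have hQ' : (Q.map (Ideal.Quotient.mk J)).IsPrime :=
    Ideal.map_isPrime_of_surjective Ideal.Quotient.mk_surjective (by rw [Ideal.mk_ker]; exact hQ.1.2)
  have hmax := Ideal.isMaximal_of_isPrime (Q.map (Ideal.Quotient.mk J))
  have hQmax : Q.IsMaximal := by
    have := Ideal.comap_isMaximal_of_surjective (Ideal.Quotient.mk J)
      Ideal.Quotient.mk_surjective (K := Q.map (Ideal.Quotient.mk J))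
    rwa [Ideal.comap_map_of_surjective' _ Ideal.Quotient.mk_surjective, Ideal.mk_ker,
      sup_eq_left.2 hQ.1.2] at this
  rwa [← hQmax.eq_of_le isPrime_gradedMaximalIdeal.ne_top hle]

omit [IsLocalRing R₀] [IsArtinianRing R₀] in
theorem sectionIdeal_le_idealOfVars {I : Ideal (MvPolynomial (Fin n) R₀)}
    (hI : I ≤ idealOfVars (Fin n) R₀) (a : ℕ → Fin n → R₀) (j : ℕ) :
    sectionIdeal I a j ≤ idealOfVars (Fin n) R₀ := by
  refine sup_le hI (Ideal.span_le.2 ?_)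
  rintro _ ⟨i, -, rfl⟩
  have := mem_pow_idealOfVars_of_isHomogeneous (isHomogeneous_linearForm (a i))
  rwa [pow_one] at this

omit [IsArtinianRing R₀] in
theorem idealOfVars_le_gradedMaximalIdeal : idealOfVars (Fin n) R₀ ≤ gradedMaximalIdeal R₀ n :=
  idealOfVars_le_of_forall_X_mem X_mem_gradedMaximalIdeal

/-- After `d` general linear sections a quotient of dimension `d` becomes a module of finite
length. -/
theorem satIdeal_sectionIdeal_eq_top {I : Ideal (MvPolynomial (Fin n) R₀)} (hI : IsHomog I)
    (hIX : I ≤ idealOfVars (Fin n) R₀) {d : ℕ} (hdn : d ≤ n)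
    (hdim : ringKrullDim (MvPolynomial (Fin n) R₀ ⧸ I) ≤ d) {a : ℕ → Fin n → R₀}
    (ha : ∀ j < n, ∀ P ∈ associatedPrimes (MvPolynomial (Fin n) R₀)
        (MvPolynomial (Fin n) R₀ ⧸ sectionIdeal I a j), linearForm (a j) ∈ P → ∀ i, X i ∈ P) :
    satIdeal (sectionIdeal I a d) = ⊤ := by
  -- The dimension drops at each step unless finite length has been reached already; after that a
  -- general form may lie in a minimal prime.
  have key : ∀ j ≤ d, satIdeal (sectionIdeal I a j) = ⊤ ∨
      ringKrullDim (MvPolynomial (Fin n) R₀ ⧸ sectionIdeal I a j) + j ≤ d := by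
    intro j
    induction j with
    | zero => intro _; right; rwa [sectionIdeal_zero, Nat.cast_zero, add_zero]
    | succ j ih =>
      intro hj
      rcases ih (by omega) with h | h
      · left
        rw [eq_top_iff, ← h]
        exact satIdeal_mono (sectionIdeal_mono I a j.le_succ)
      by_cases hmin : ∃ P ∈ (sectionIdeal I a j).minimalPrimes, linearForm (a j) ∈ P
      · left
        obtain ⟨P, hP, hyP⟩ := hmin
        have hPprime : P.IsPrime := hP.1.1
        have hass : P ∈ associatedPrimes (MvPolynomial (Fin n) R₀)
            (MvPolynomial (Fin n) R₀ ⧸ sectionIdeal I a j) := by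
          refine Module.associatedPrimes.minimalPrimes_annihilator_subset_associatedPrimes _ _ ?_
          rwa [Ideal.annihilator_quotient]
        -- Generality puts all variables into a minimal prime that contains the form, so that prime
        -- is the graded maximal ideal.
        have hle := gradedMaximalIdeal_le_of_forall_X_mem (ha j (by omega) P hass hyP)
        have hle' := le_gradedMaximalIdeal_of_isHomog
          (isHomog_of_mem_minimalPrimes (isHomog_sectionIdeal hI a j) hP)
        rw [le_antisymm hle' hle] at hP
        rw [eq_top_iff, ← satIdeal_eq_top_of_mem_minimalPrimes (isHomog_sectionIdeal hI a j) hP]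
        exact satIdeal_mono (sectionIdeal_mono I a j.le_succ)
      · right
        push Not at hmin
        refine le_trans ?_ h
        rw [sectionIdeal_succ, Nat.cast_succ, add_comm (j : WithBot ℕ∞), ← add_assoc]
        gcongr
        exact ringKrullDim_quotient_sup_span_add_one_le hmin
  rcases key d le_rfl with h | h
  · exact h
  · exact satIdeal_eq_top_of_ringKrullDim_le_zero (isHomog_sectionIdeal hI a d)
      ((sectionIdeal_le_idealOfVars hIX a d).trans idealOfVars_le_gradedMaximalIdeal)
      (withBot_enat_le_zero_of_add_le h)

end Dimension

/-! ### Regularity through linear sections. -/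

section Regularity

variable {R₀ : Type u} [CommRing R₀] {n : ℕ}

/-- `H^p_{R_+}(R / J)_t = 0` for `p ≤ e` and `t + p > r`. -/
def VanishesAbove (J : Ideal (MvPolynomial (Fin n) R₀)) (e : ℕ) (r : ℤ) : Prop :=
  ∀ p ≤ e, ∀ t : ℤ, r < t + p → CohomologyVanishes n (quotientGrading J) p t

/-- In the long exact sequence `H^p` of the section in degree `t` sits between `H^p(R/J)_t` and
`H^{p+1}(R/J)_{t-1}`, which have the same sum of degrees. The second one costs a cohomological
degree. -/
theorem VanishesAbove.sup_span {J : Ideal (MvPolynomial (Fin n) R₀)} (hJ : IsHomog J)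
    {y : MvPolynomial (Fin n) R₀} (hy : y.IsHomogeneous 1) (hreg : FilterRegular J y) {e : ℕ} {r : ℤ}
    (h : VanishesAbove J (e + 1) r) : VanishesAbove (J ⊔ Ideal.span {y}) e r := fun p hp t ht =>
  (isHyperplaneSection_factor hJ hy hreg).cohomologyVanishes_section (h p (by omega) t ht)
    (h (p + 1) (by omega) (t - 1) (by push_cast; omega))

/-- Positive cohomological degrees are recovered from the section because higher cohomology is
torsion; `H^0` is not seen this way and has to be supplied. -/
theorem VanishesAbove.of_sup_span {J : Ideal (MvPolynomial (Fin n) R₀)} (hJ : IsHomog J)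
    {y : MvPolynomial (Fin n) R₀} (hy : y.IsHomogeneous 1) (hreg : FilterRegular J y) {e : ℕ} {r : ℤ}
    (h : VanishesAbove (J ⊔ Ideal.span {y}) e r)
    (h0 : ∀ t : ℤ, r < t → CohomologyVanishes n (quotientGrading J) 0 t) :
    VanishesAbove J (e + 1) r := by
  intro p hp t ht
  rcases p with _ | p
  · exact h0 t (by simpa using ht)
  · have := (isHyperplaneSection_factor hJ hy hreg).cohomologyVanishes_succ (p := p) (t := t + 1)
      fun s hs => h p (by omega) s (by push_cast at ht; omega)
    rwa [add_sub_cancel_right] at this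

theorem VanishesAbove.sectionIdeal {I : Ideal (MvPolynomial (Fin n) R₀)} (hI : IsHomog I)
    {a : ℕ → Fin n → R₀} {d : ℕ}
    (ha : ∀ j < d, FilterRegular (sectionIdeal I a j) (linearForm (a j))) {r : ℤ}
    (h : VanishesAbove I d r) : ∀ j ≤ d, VanishesAbove (sectionIdeal I a j) (d - j) r := by
  intro j
  induction j with
  | zero => intro _; rwa [sectionIdeal_zero]
  | succ j ih =>
    intro hj
    rw [sectionIdeal_succ]
    refine (VanishesAbove.sup_span (isHomog_sectionIdeal hI a j) (isHomogeneous_linearForm _)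
      (ha j (by omega)) ?_)
    rw [show d - (j + 1) + 1 = d - j by omega]
    exact ih (by omega)

theorem VanishesAbove.of_sectionIdeal {I : Ideal (MvPolynomial (Fin n) R₀)} (hI : IsHomog I)
    {a : ℕ → Fin n → R₀} {d : ℕ}
    (ha : ∀ j < d, FilterRegular (HilbertReg.sectionIdeal I a j) (linearForm (a j))) {r : ℤ}
    (h0 : ∀ j ≤ d, ∀ t : ℤ, r < t →
      CohomologyVanishes n (quotientGrading (HilbertReg.sectionIdeal I a j)) 0 t) :
    VanishesAbove I d r := by
  suffices h : ∀ k ≤ d, VanishesAbove (HilbertReg.sectionIdeal I a (d - k)) k r by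
    have := h d le_rfl
    rwa [Nat.sub_self, sectionIdeal_zero] at this
  intro k
  induction k with
  | zero =>
    intro _ p hp t ht
    obtain rfl : p = 0 := by omega
    exact h0 d le_rfl t (by simpa using ht)
  | succ k ih =>
    intro hk
    refine VanishesAbove.of_sup_span (isHomog_sectionIdeal hI a _) (isHomogeneous_linearForm _)
      (ha (d - (k + 1)) (by omega)) ?_ (h0 _ (by omega))
    rw [← sectionIdeal_succ, show d - (k + 1) + 1 = d - k by omega]
    exact ih (by omega)

theorem cohomologyVanishes_zero_iff_of_satIdeal_eq_top {J : Ideal (MvPolynomial (Fin n) R₀)}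
    (hJ : satIdeal J = ⊤) {t : ℕ} : CohomologyVanishes n (quotientGrading J) 0 t ↔
      ∀ f : MvPolynomial (Fin n) R₀, f.IsHomogeneous t → f ∈ J := by
  rw [cohomologyVanishes_zero_quotientGrading_iff]
  simp [hJ]

theorem exists_vanishesAbove [IsNoetherianRing R₀] {I : Ideal (MvPolynomial (Fin n) R₀)}
    (hI : IsHomog I) {a : ℕ → Fin n → R₀} {d : ℕ}
    (ha : ∀ j < d, FilterRegular (sectionIdeal I a j) (linearForm (a j))) :
    ∃ r : ℤ, VanishesAbove I d r := by
  choose D hD using fun j => exists_forall_isHomogeneous_mem_of_mem_satIdeal (sectionIdeal I a j)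
  refine ⟨((Finset.range (d + 1)).sup D : ℕ), VanishesAbove.of_sectionIdeal hI ha fun j hj t ht => ?_⟩
  lift t to ℕ using by omega
  refine cohomologyVanishes_zero_quotientGrading_iff.2 fun f hf hfs => ?_
  refine hD j t ?_ f hf hfs
  have := Finset.le_sup (f := D) (Finset.mem_range.2 (show j < d + 1 by omega))
  omega

/-- The last section is all torsion, so it equals its own `H^0`, which inherits the vanishing above
`r`. -/
theorem VanishesAbove.mem_sectionIdeal {I : Ideal (MvPolynomial (Fin n) R₀)} (hI : IsHomog I)
    {a : ℕ → Fin n → R₀} {d : ℕ}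
    (ha : ∀ j < d, FilterRegular (HilbertReg.sectionIdeal I a j) (linearForm (a j)))
    (hsat : satIdeal (HilbertReg.sectionIdeal I a d) = ⊤) {r : ℤ} (h : VanishesAbove I d r) {t : ℕ}
    (ht : r < t) {f : MvPolynomial (Fin n) R₀} (hf : f.IsHomogeneous t) :
    f ∈ HilbertReg.sectionIdeal I a d :=
  (cohomologyVanishes_zero_iff_of_satIdeal_eq_top hsat).1
    (h.sectionIdeal hI ha d le_rfl 0 (by omega) t (by simpa using ht)) f hf

theorem one_notMem_of_le_idealOfVars [Nontrivial R₀] {J : Ideal (MvPolynomial (Fin n) R₀)}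
    (hJ : J ≤ idealOfVars (Fin n) R₀) : (1 : MvPolynomial (Fin n) R₀) ∉ J := fun h => by
  simpa using mem_idealOfVars_iff.1 (hJ h)

/-- The regularity of `R / I` is a non-negative integer. -/
theorem exists_regularity_eq [IsNoetherianRing R₀] [IsLocalRing R₀]
    {I : Ideal (MvPolynomial (Fin n) R₀)} (hI : IsHomog I) (hIX : I ≤ idealOfVars (Fin n) R₀)
    {a : ℕ → Fin n → R₀} {d : ℕ}
    (ha : ∀ j < d, FilterRegular (sectionIdeal I a j) (linearForm (a j)))
    (hsat : satIdeal (sectionIdeal I a d) = ⊤)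
    (hdim : ringKrullDim (MvPolynomial (Fin n) R₀ ⧸ I) = d) :
    ∃ r : ℕ, regularity n (quotientGrading I) = ((r : ℝ) : EReal) ∧ VanishesAbove I d r ∧
      ∀ s : ℤ, VanishesAbove I d s → (r : ℤ) ≤ s := by
  -- A negative bound would put `1` into the last section ideal, which lies in `R_+`.
  have hpos : ∀ s : ℤ, VanishesAbove I d s → 0 ≤ s := by
    intro s hs
    by_contra! hlt
    exact one_notMem_of_le_idealOfVars (sectionIdeal_le_idealOfVars hIX a d)
      (hs.mem_sectionIdeal hI ha hsat (t := 0) (by simpa using hlt) (isHomogeneous_one _ _))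
  obtain ⟨r, hr, hmin⟩ := Int.exists_least_of_bdd ⟨0, hpos⟩ (exists_vanishesAbove hI ha)
  lift r to ℕ using hpos r hr
  refine ⟨r, le_antisymm ?_ ?_, hr, hmin⟩
  · refine iSup₂_le fun p hp => ?_
    rw [Module.supportDim_quotient_eq_ringKrullDim, hdim] at hp
    have hp' : p ≤ d := by exact_mod_cast hp
    have : aInvariant n (quotientGrading I) p ≤ (((r : ℝ) - (p : ℝ) : ℝ) : EReal) := by
      refine iSup₂_le fun t ht => ?_
      rw [EReal.coe_le_coe_iff]
      rw [nontrivial_localCohomologyPiece_iff] at ht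
      have : t + p ≤ r := by
        by_contra! h
        exact ht (hr p hp' t h)
      rw [le_sub_iff_add_le]
      exact_mod_cast this
    refine (add_le_add_left this _).trans ?_
    rw [← EReal.coe_add, sub_add_cancel]
  -- By minimality some nonzero piece has `t + p` equal to `r`, so the supremum is attained. The
  -- subtraction is in `ℤ`, so `r = 0` is no exception.
  · have hnot : ¬ VanishesAbove I d (r - 1) := fun h => by
      have := hmin _ h
      omega
    simp only [VanishesAbove, not_forall] at hnot
    obtain ⟨p, hp, t, ht, hne⟩ := hnot
    have htr : t + p = r := by
      by_contra h
      exact hne (hr p hp t (by omega))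
    have h1 : ((t : ℝ) : EReal) ≤ aInvariant n (quotientGrading I) p :=
      le_iSup₂ (f := fun (t : ℤ) (_ : Nontrivial (LocalCohomologyPiece n (quotientGrading I) p t)) =>
        ((t : ℝ) : EReal)) t (nontrivial_localCohomologyPiece_iff.2 hne)
    have hp' : (p : WithBot ℕ∞) ≤ Module.supportDim (MvPolynomial (Fin n) R₀)
        (MvPolynomial (Fin n) R₀ ⧸ I) := by
      rw [Module.supportDim_quotient_eq_ringKrullDim, hdim]
      exact_mod_cast hp
    refine le_trans ?_ (le_iSup₂ (f := fun (p : ℕ) (_ : (p : WithBot ℕ∞) ≤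
      Module.supportDim (MvPolynomial (Fin n) R₀) (MvPolynomial (Fin n) R₀ ⧸ I)) =>
        (aInvariant n (quotientGrading I) p + ((p : ℝ) : EReal))) p hp')
    refine le_trans ?_ (add_le_add_left h1 _)
    rw [← EReal.coe_add, EReal.coe_le_coe_iff]
    exact_mod_cast htr.ge

end Regularity

/-! ### Lengths of graded pieces and the Hilbert series of a section. -/

section Lengths

variable {R₀ : Type u} [CommRing R₀] {n : ℕ}

theorem card_degree_eq (n t : ℕ) :
    ENat.card {α : Fin n →₀ ℕ | α.degree = t} = (n.multichoose t : ℕ) := by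
  classical
  have h : {α : Fin n →₀ ℕ | α.degree = t} =
      ((Finset.univ : Finset (Fin n)).finsuppAntidiag t : Set (Fin n →₀ ℕ)) := by
    ext α
    simp [Finset.mem_finsuppAntidiag, Finsupp.degree_eq_sum]
  rw [h, ENat.card_coe_set_eq, Set.encard_coe_eq_coe_finsetCard,
    Finset.card_finsuppAntidiag_nat_eq_multichoose, Finset.card_univ, Fintype.card_fin]

theorem length_homogeneousSubmodule (n t : ℕ) :
    Module.length R₀ (homogeneousSubmodule (Fin n) R₀ t) =
      (n.multichoose t : ℕ) * Module.length R₀ R₀ := by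
  have e : homogeneousSubmodule (Fin n) R₀ t ≃ₗ[R₀] ({α : Fin n →₀ ℕ | α.degree = t} →₀ R₀) :=
    (LinearEquiv.ofEq _ _ (homogeneousSubmodule_eq_finsupp_supported _ _ t)).trans
      (AddMonoidAlgebra.supportedEquivFinsupp {α : Fin n →₀ ℕ | α.degree = t})
  rw [e.length_eq, Module.length_finsupp, card_degree_eq]

theorem length_ne_top_of_isArtinianRing [IsArtinianRing R₀] : Module.length R₀ R₀ ≠ ⊤ :=
  Module.length_ne_top

theorem length_quotientGrading_le (J : Ideal (MvPolynomial (Fin n) R₀)) (t : ℕ) :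
    Module.length R₀ (quotientGrading J (t : ℤ)) ≤
      Module.length R₀ (homogeneousSubmodule (Fin n) R₀ t) := by
  have h : quotientGrading J (t : ℤ) =
      (homogeneousSubmodule (Fin n) R₀ t).map (Ideal.Quotient.mkₐ R₀ J).toLinearMap := by
    simp [quotientGrading]
  rw [h]
  exact Module.length_le_of_surjective
    ((Ideal.Quotient.mkₐ R₀ J).toLinearMap.submoduleMap (homogeneousSubmodule (Fin n) R₀ t))
    (LinearMap.submoduleMap_surjective _ _)

theorem length_quotientGrading_ne_top [IsArtinianRing R₀] (J : Ideal (MvPolynomial (Fin n) R₀))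
    (t : ℕ) : Module.length R₀ (quotientGrading J (t : ℤ)) ≠ ⊤ := by
  refine ne_top_of_le_ne_top ?_ (length_quotientGrading_le J t)
  rw [length_homogeneousSubmodule]
  exact WithTop.mul_ne_top (ENat.natCast_ne_top _) length_ne_top_of_isArtinianRing

theorem coe_hilbertFunction [IsArtinianRing R₀] (J : Ideal (MvPolynomial (Fin n) R₀)) (t : ℕ) :
    (hilbertFunction (quotientGrading J) t : ℕ∞) = Module.length R₀ (quotientGrading J (t : ℤ)) :=
  ENat.natCast_toNat (length_quotientGrading_ne_top J t)

/-- The kernel of the multiplication by `y` in degree `t`. -/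
def kernelPiece (J : Ideal (MvPolynomial (Fin n) R₀)) (y : MvPolynomial (Fin n) R₀) (t : ℕ) :
    Submodule R₀ (MvPolynomial (Fin n) R₀ ⧸ J) :=
  quotientGrading J (t : ℤ) ⊓ LinearMap.ker (LinearMap.mulLeft R₀ (Ideal.Quotient.mk J y))

theorem kernelPiece_eq_bot_iff {J : Ideal (MvPolynomial (Fin n) R₀)}
    {y : MvPolynomial (Fin n) R₀} {t : ℕ} : kernelPiece J y t = ⊥ ↔
      ∀ f : MvPolynomial (Fin n) R₀, f.IsHomogeneous t → y * f ∈ J → f ∈ J := by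
  rw [eq_bot_iff]
  constructor
  · intro h f hf hyf
    refine Ideal.Quotient.eq_zero_iff_mem.1 ((Submodule.mem_bot R₀).1 (h ⟨?_, ?_⟩))
    · exact mem_quotientGrading_natCast.2 ⟨f, hf, rfl⟩
    · exact Ideal.Quotient.eq_zero_iff_mem.2 hyf
  · rintro h m ⟨hm, hym⟩
    obtain ⟨f, hf, rfl⟩ := mem_quotientGrading_natCast.1 hm
    exact Ideal.Quotient.eq_zero_iff_mem.2 (h f hf (Ideal.Quotient.eq_zero_iff_mem.1 hym))

/-- The length of the kernel of the multiplication by `y` in degree `t`. -/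
def kernelFunction (J : Ideal (MvPolynomial (Fin n) R₀)) (y : MvPolynomial (Fin n) R₀) (t : ℕ) : ℕ :=
  (Module.length R₀ (kernelPiece J y t)).toNat

theorem length_kernelPiece_le (J : Ideal (MvPolynomial (Fin n) R₀)) (y : MvPolynomial (Fin n) R₀)
    (t : ℕ) : Module.length R₀ (kernelPiece J y t) ≤ Module.length R₀ (quotientGrading J (t : ℤ)) :=
  Module.length_le_of_injective (Submodule.inclusion inf_le_left) (Submodule.inclusion_injective _)

theorem coe_kernelFunction [IsArtinianRing R₀] (J : Ideal (MvPolynomial (Fin n) R₀))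
    (y : MvPolynomial (Fin n) R₀) (t : ℕ) :
    (kernelFunction J y t : ℕ∞) = Module.length R₀ (kernelPiece J y t) :=
  ENat.natCast_toNat (ne_top_of_le_ne_top (length_quotientGrading_ne_top J t)
    (length_kernelPiece_le J y t))

theorem kernelFunction_eq_zero_iff [IsArtinianRing R₀] {J : Ideal (MvPolynomial (Fin n) R₀)}
    {y : MvPolynomial (Fin n) R₀} {t : ℕ} : kernelFunction J y t = 0 ↔
      ∀ f : MvPolynomial (Fin n) R₀, f.IsHomogeneous t → y * f ∈ J → f ∈ J := by
  rw [← kernelPiece_eq_bot_iff, ← Nat.cast_inj (R := ℕ∞), coe_kernelFunction, Nat.cast_zero,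
    Module.length_eq_zero_iff, Submodule.subsingleton_iff_eq_bot]

/-- Additivity of length on `0 → ker y → (R/J)_t → (R/J)_{t+1} → (R/(J,y))_{t+1} → 0`, split at the
image of `y`. Stated without subtraction, it needs no finiteness. -/
theorem length_add_length_section {J : Ideal (MvPolynomial (Fin n) R₀)} (hJ : IsHomog J)
    {y : MvPolynomial (Fin n) R₀} (hy : y.IsHomogeneous 1) (t : ℕ) :
    Module.length R₀ (quotientGrading J ((t + 1 : ℕ) : ℤ)) + Module.length R₀ (kernelPiece J y t) =
      Module.length R₀ (quotientGrading J (t : ℤ)) +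
        Module.length R₀ (quotientGrading (J ⊔ Ideal.span {y}) ((t + 1 : ℕ) : ℤ)) := by
  let μ := LinearMap.mulLeft R₀ (Ideal.Quotient.mk J y)
  let π := (Ideal.Quotient.factorₐ R₀ (le_sup_left : J ≤ J ⊔ Ideal.span {y})).toLinearMap
  have hμ : ∀ m ∈ quotientGrading J (t : ℤ), μ m ∈ quotientGrading J ((t + 1 : ℕ) : ℤ) := by
    intro m hm
    obtain ⟨f, hf, rfl⟩ := mem_quotientGrading_natCast.1 hm
    exact mem_quotientGrading_natCast.2 ⟨y * f, by rw [add_comm]; exact hy.mul hf, rfl⟩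
  have hπ : ∀ m ∈ quotientGrading J ((t + 1 : ℕ) : ℤ),
      π m ∈ quotientGrading (J ⊔ Ideal.span {y}) ((t + 1 : ℕ) : ℤ) := by
    intro m hm
    obtain ⟨f, hf, rfl⟩ := mem_quotientGrading_natCast.1 hm
    exact mem_quotientGrading_natCast.2 ⟨f, hf, rfl⟩
  let φ : quotientGrading J (t : ℤ) →ₗ[R₀] quotientGrading J ((t + 1 : ℕ) : ℤ) := μ.restrict hμ
  let ψ : quotientGrading J ((t + 1 : ℕ) : ℤ) →ₗ[R₀]
    quotientGrading (J ⊔ Ideal.span {y}) ((t + 1 : ℕ) : ℤ) := π.restrict hπ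
  have h1 := Module.length_eq_add_of_exact (R := R₀) (N := LinearMap.ker φ)
    (P := LinearMap.range φ) (LinearMap.ker φ).subtype φ.rangeRestrict
    (Submodule.subtype_injective _) φ.surjective_rangeRestrict (by
      rw [LinearMap.exact_iff, LinearMap.ker_rangeRestrict, Submodule.range_subtype])
  have hψ : Function.Surjective ψ := by
    rintro ⟨m, hm⟩
    obtain ⟨f, hf, rfl⟩ := mem_quotientGrading_natCast.1 hm
    exact ⟨⟨Ideal.Quotient.mk J f, mem_quotientGrading_natCast.2 ⟨f, hf, rfl⟩⟩, Subtype.ext rfl⟩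
  have h2 := Module.length_eq_add_of_exact (R := R₀) (N := LinearMap.range φ)
    (P := quotientGrading (J ⊔ Ideal.span {y}) ((t + 1 : ℕ) : ℤ)) (LinearMap.range φ).subtype ψ
    (Submodule.subtype_injective _) hψ (by
      rw [LinearMap.exact_iff, Submodule.range_subtype]
      ext ⟨m, hm⟩
      obtain ⟨f, hf, rfl⟩ := mem_quotientGrading_natCast.1 hm
      constructor
      · intro h
        have h' : f ∈ J ⊔ Ideal.span {y} :=
          Ideal.Quotient.eq_zero_iff_mem.1 (congrArg Subtype.val (LinearMap.mem_ker.1 h))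
        rcases exists_sub_mul_mem_of_mem_sup_span hJ hy hf h' with ⟨h0, -⟩ | ⟨s, hs, g, hg, hfg⟩
        · omega
        · obtain rfl : t = s := by omega
          exact ⟨⟨Ideal.Quotient.mk J g, mem_quotientGrading_natCast.2 ⟨g, hg, rfl⟩⟩,
            Subtype.ext (Ideal.Quotient.eq.2 hfg).symm⟩
      · rintro ⟨⟨b, hb⟩, h⟩
        obtain ⟨g, hg, rfl⟩ := mem_quotientGrading_natCast.1 hb
        have h' : Ideal.Quotient.mk J (y * g) = Ideal.Quotient.mk J f := congrArg Subtype.val h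
        refine LinearMap.mem_ker.2 (Subtype.ext (Ideal.Quotient.eq_zero_iff_mem.2 ?_ :
          Ideal.Quotient.mk (J ⊔ Ideal.span {y}) f = 0))
        have h3 := Ideal.Quotient.eq.1 h'
        have h4 : f = y * g - (y * g - f) := by ring
        rw [h4]
        exact sub_mem (Ideal.mul_mem_right _ _ (Ideal.mem_sup_right
          (Ideal.mem_span_singleton_self y))) (Ideal.mem_sup_left h3))
  have h3 : Module.length R₀ (LinearMap.ker φ) = Module.length R₀ (kernelPiece J y t) := by
    refine LinearEquiv.length_eq ?_
    refine (Submodule.equivSubtypeMap _ _).trans (LinearEquiv.ofEq _ _ ?_)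
    ext m
    simp only [Submodule.mem_map, LinearMap.mem_ker, Submodule.subtype_apply, Subtype.exists,
      exists_and_right, exists_eq_right, kernelPiece, Submodule.mem_inf]
    constructor
    · rintro ⟨hm, h⟩
      exact ⟨hm, congrArg Subtype.val h⟩
    · rintro ⟨hm, h⟩
      exact ⟨hm, Subtype.ext h⟩
  rw [h2, h1, h3, add_comm, ← add_assoc]

theorem length_section_zero {J : Ideal (MvPolynomial (Fin n) R₀)} (hJ : IsHomog J)
    {y : MvPolynomial (Fin n) R₀} (hy : y.IsHomogeneous 1) :
    Module.length R₀ (quotientGrading (J ⊔ Ideal.span {y}) ((0 : ℕ) : ℤ)) =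
      Module.length R₀ (quotientGrading J ((0 : ℕ) : ℤ)) := by
  let π := (Ideal.Quotient.factorₐ R₀ (le_sup_left : J ≤ J ⊔ Ideal.span {y})).toLinearMap
  have hπ : ∀ m ∈ quotientGrading J ((0 : ℕ) : ℤ),
      π m ∈ quotientGrading (J ⊔ Ideal.span {y}) ((0 : ℕ) : ℤ) := by
    intro m hm
    obtain ⟨f, hf, rfl⟩ := mem_quotientGrading_natCast.1 hm
    exact mem_quotientGrading_natCast.2 ⟨f, hf, rfl⟩
  refine (LinearEquiv.length_eq (LinearEquiv.ofBijective (π.restrict hπ) ⟨?_, ?_⟩)).symm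
  · rw [← LinearMap.ker_eq_bot, LinearMap.ker_eq_bot']
    rintro ⟨m, hm⟩ h
    obtain ⟨f, hf, rfl⟩ := mem_quotientGrading_natCast.1 hm
    have h' : f ∈ J ⊔ Ideal.span {y} :=
      Ideal.Quotient.eq_zero_iff_mem.1 (congrArg Subtype.val h)
    rcases exists_sub_mul_mem_of_mem_sup_span hJ hy hf h' with ⟨-, h0⟩ | ⟨s, hs, -⟩
    · exact Subtype.ext (Ideal.Quotient.eq_zero_iff_mem.2 h0)
    · omega
  · rintro ⟨m, hm⟩
    obtain ⟨f, hf, rfl⟩ := mem_quotientGrading_natCast.1 hm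
    exact ⟨⟨Ideal.Quotient.mk J f, mem_quotientGrading_natCast.2 ⟨f, hf, rfl⟩⟩, Subtype.ext rfl⟩

variable [IsArtinianRing R₀]

/-- The Hilbert series of a hyperplane section. -/
theorem hilbertSeries_section {J : Ideal (MvPolynomial (Fin n) R₀)} (hJ : IsHomog J)
    {y : MvPolynomial (Fin n) R₀} (hy : y.IsHomogeneous 1) :
    hilbertSeries (quotientGrading (J ⊔ Ideal.span {y})) =
      hilbertSeries (quotientGrading J) * (1 - PowerSeries.X) +
        PowerSeries.mk (fun t => (kernelFunction J y t : ℤ)) * PowerSeries.X := by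
  ext t
  rw [map_add, mul_sub, mul_one, map_sub]
  rcases t with _ | t
  · simp only [hilbertSeries, PowerSeries.coeff_mk, PowerSeries.coeff_zero_mul_X, sub_zero, add_zero]
    have := length_section_zero hJ hy
    rw [← coe_hilbertFunction, ← coe_hilbertFunction, Nat.cast_inj] at this
    exact_mod_cast this
  · simp only [hilbertSeries, PowerSeries.coeff_mk, PowerSeries.coeff_succ_mul_X]
    have := length_add_length_section hJ hy t
    rw [← coe_hilbertFunction, ← coe_hilbertFunction, ← coe_hilbertFunction, ← coe_kernelFunction,
      ← Nat.cast_add, ← Nat.cast_add, Nat.cast_inj] at this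
    have h' : (hilbertFunction (quotientGrading J) ((t + 1 : ℕ) : ℤ) : ℤ) + kernelFunction J y t =
      hilbertFunction (quotientGrading J) (t : ℤ) +
        hilbertFunction (quotientGrading (J ⊔ Ideal.span {y})) ((t + 1 : ℕ) : ℤ) := by
      exact_mod_cast this
    linarith

theorem exists_forall_kernelFunction_eq_zero {J : Ideal (MvPolynomial (Fin n) R₀)}
    {y : MvPolynomial (Fin n) R₀} (h : FilterRegular J y) :
    ∃ D : ℕ, ∀ t ≥ D, kernelFunction J y t = 0 := by
  obtain ⟨D, hD⟩ := exists_forall_isHomogeneous_mem_of_mem_satIdeal J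
  exact ⟨D, fun t ht => kernelFunction_eq_zero_iff.2 fun f hf hyf => hD t ht f hf (h f hyf)⟩

end Lengths

/-! ### Power series with denominator `(1 - z)^d`. -/

section PowerSeriesLemmas

theorem exists_coe_polynomial_eq {φ : PowerSeries ℤ} {D : ℕ}
    (h : ∀ t ≥ D, PowerSeries.coeff t φ = 0) :
    ∃ P : Polynomial ℤ, (P : PowerSeries ℤ) = φ ∧
      P.eval 1 = ∑ t ∈ Finset.range D, PowerSeries.coeff t φ := by
  refine ⟨PowerSeries.trunc D φ, ?_, ?_⟩
  · ext t
    rw [Polynomial.coeff_coe, PowerSeries.coeff_trunc]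
    split_ifs with ht
    · rfl
    · exact (h t (by omega)).symm
  · rw [Polynomial.eval, PowerSeries.eval₂_trunc_eq_sum_range]
    simp

/-- Only the polynomiality of `T` matters: one more factor `1 - z` will be multiplied on, which
removes it from the value at `1`. -/
theorem exists_mul_one_sub_pow_eq_sub {φ : ℕ → PowerSeries ℤ} {K : ℕ → Polynomial ℤ} (m : ℕ)
    (h : ∀ j < m, φ (j + 1) = φ j * (1 - PowerSeries.X) + (K j : PowerSeries ℤ) * PowerSeries.X) :
    ∃ T : Polynomial ℤ, φ 0 * (1 - PowerSeries.X) ^ m = φ m - (T : PowerSeries ℤ) := by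
  induction m with
  | zero => exact ⟨0, by simp⟩
  | succ m ih =>
    obtain ⟨T, hT⟩ := ih fun j hj => h j (by omega)
    refine ⟨T * (1 - Polynomial.X) + K m * Polynomial.X, ?_⟩
    rw [pow_succ, ← mul_assoc, hT, h m (by omega)]
    push_cast
    ring

theorem mul_one_sub_pow_eq_of_forall_eq {φ : ℕ → PowerSeries ℤ} (m : ℕ)
    (h : ∀ j < m, φ (j + 1) = φ j * (1 - PowerSeries.X)) :
    φ 0 * (1 - PowerSeries.X) ^ m = φ m := by
  induction m with
  | zero => simp
  | succ m ih => rw [pow_succ, ← mul_assoc, ih fun j hj => h j (by omega), h m (by omega)]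

/-- The Hilbert coefficients read off from the numerator of a Hilbert series. -/
theorem exists_coefficients (d : ℕ) (Q : Polynomial ℤ) (φ : PowerSeries ℤ)
    (h : φ * (1 - PowerSeries.X) ^ d = (Q : PowerSeries ℤ)) :
    ∃ e : ℕ → ℤ, e 0 = Q.eval 1 ∧ ∀ᶠ t : ℕ in Filter.atTop, PowerSeries.coeff t φ =
      ∑ i ∈ Finset.range d, (-1) ^ i * e i * ((t + (d - 1 - i)).choose (d - 1 - i) : ℤ) := by
  induction d generalizing Q φ with
  | zero =>
    -- For `d = 0` the sum is empty and the coefficients are free; this choice keeps the claim about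
    -- `e 0` true.
    refine ⟨fun _ => Q.eval 1, rfl, ?_⟩
    filter_upwards [Filter.eventually_gt_atTop Q.natDegree] with t ht
    rw [pow_zero, mul_one] at h
    rw [h, Polynomial.coeff_coe, Polynomial.coeff_eq_zero_of_natDegree_lt ht]
    simp
  | succ d ih =>
    -- With `Q = Q(1) + (z - 1) Q'`, the constant yields the leading binomial and the rest is `-Q' /
    -- (1 - z)^d`, handled by induction. Shifting the index by one accounts for the sign in the
    -- final coefficients.
    obtain ⟨Q', hQ'⟩ := Polynomial.dvd_iff_isRoot.2
      (show (Q - Polynomial.C (Q.eval 1)).IsRoot 1 by simp)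
    let β : PowerSeries ℤ := PowerSeries.mk fun t => ((d + t).choose d : ℤ)
    have hβ : β * (1 - PowerSeries.X) ^ (d + 1) = 1 :=
      PowerSeries.mk_add_choose_mul_one_sub_pow_eq_one ℤ d
    have hQ : (Q : PowerSeries ℤ) = PowerSeries.C (Q.eval 1) +
        (PowerSeries.X - 1) * (Q' : PowerSeries ℤ) := by
      have := congrArg (fun P : Polynomial ℤ => (P : PowerSeries ℤ)) hQ'
      simp only [Polynomial.coe_sub, Polynomial.coe_mul, Polynomial.coe_C, Polynomial.coe_X] at this
      rw [← sub_eq_iff_eq_add', this]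
      simp
    have hu : IsUnit (1 - PowerSeries.X : PowerSeries ℤ) := by
      rw [PowerSeries.isUnit_iff_constantCoeff]
      simp
    obtain ⟨e, he0, he⟩ := ih (-Q') (φ - PowerSeries.C (Q.eval 1) * β) (by
      have := hu.mul_right_cancel (a := (φ - PowerSeries.C (Q.eval 1) * β) *
        (1 - PowerSeries.X) ^ d) (c := -(Q' : PowerSeries ℤ)) (by
          rw [mul_assoc, ← pow_succ, sub_mul, mul_assoc _ β, hβ, h, hQ]
          ring)
      rw [this]
      push_cast
      rfl)
    refine ⟨fun i => if i = 0 then Q.eval 1 else -e (i - 1), by simp, ?_⟩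
    filter_upwards [he] with t ht
    rw [map_sub, PowerSeries.coeff_C_mul, PowerSeries.coeff_mk, sub_eq_iff_eq_add] at ht
    rw [ht, Finset.sum_range_succ']
    congr 1
    · refine Finset.sum_congr rfl fun i hi => ?_
      rw [show d + 1 - 1 - (i + 1) = d - 1 - i by omega, if_neg (by omega), pow_succ]
      simp
    · simp [add_comm]

theorem sum_multichoose (c a : ℕ) :
    ∑ i ∈ Finset.range (a + 1), c.multichoose i = (a + c).choose c := by
  have h : ∑ i ∈ Finset.range (a + 1), c.multichoose i = (c + 1).multichoose a := by
    induction a with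
    | zero => simp
    | succ a ih => rw [Finset.sum_range_succ, ih, Nat.multichoose_succ_succ, add_comm]
  rw [h, Nat.multichoose_eq, show c + 1 + a - 1 = a + c by omega]
  exact Nat.choose_symm_add

end PowerSeriesLemmas

/-! ### Eliminating the first `d` linear forms. -/

section Bound

variable {R₀ : Type u} [CommRing R₀] {n : ℕ}

theorem isHomogeneous_aeval_linearForm {m : ℕ} (v : Fin m → Fin n → R₀) {t : ℕ}
    {f : MvPolynomial (Fin m) R₀} (hf : f.IsHomogeneous t) :
    (aeval (fun k => linearForm (v k)) f).IsHomogeneous t := by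
  have := hf.aeval (fun k => linearForm (v k)) (fun k => isHomogeneous_linearForm (v k))
  rwa [one_mul] at this

/-- Modulo the first `d` general linear forms, every form is a form in the last `n - d` ones. -/
theorem exists_isHomogeneous_sub_mem (I : Ideal (MvPolynomial (Fin n) R₀)) {a : ℕ → Fin n → R₀}
    {b : Fin n → Fin n → R₀} (hb : ∀ i, X i = ∑ j : Fin n, b i j • linearForm (a j)) {d : ℕ}
    (hdn : d ≤ n) {t : ℕ} {f : MvPolynomial (Fin n) R₀} (hf : f.IsHomogeneous t) :
    ∃ g : MvPolynomial (Fin (n - d)) R₀, g.IsHomogeneous t ∧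
      f - aeval (fun k : Fin (n - d) => linearForm (a (d + k))) g ∈ sectionIdeal I a d := by
  let b' : Fin n → ℕ → R₀ := fun i j => if h : j < n then b i ⟨j, h⟩ else 0
  have hb' : ∀ i, X i = ∑ j ∈ Finset.range n, b' i j • linearForm (a j) := by
    intro i
    rw [hb i, ← Fin.sum_univ_eq_sum_range (fun j => b' i j • linearForm (a j))]
    exact Finset.sum_congr rfl fun j _ => by simp [b']
  have hsplit : ∀ i, ∑ j ∈ Finset.range n, b' i j • linearForm (a j) =
      ∑ j ∈ Finset.range d, b' i j • linearForm (a j) +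
        ∑ j ∈ Finset.range (n - d), b' i (d + j) • linearForm (a (d + j)) := by
    intro i
    rw [← Finset.sum_range_add (fun j => b' i j • linearForm (a j)) d (n - d),
      Nat.add_sub_cancel' hdn]
  let w : Fin n → Fin (n - d) → R₀ := fun i k => b' i (d + k)
  refine ⟨aeval (fun i => linearForm (w i)) f, isHomogeneous_aeval_linearForm w hf, ?_⟩
  rw [← Ideal.Quotient.eq]
  -- Rewriting a variable in the new forms and dropping the first `d` of them changes nothing modulo
  -- the section ideal; algebra maps agreeing on variables are equal.
  have h : (Ideal.Quotient.mkₐ R₀ (sectionIdeal I a d)) =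
      ((Ideal.Quotient.mkₐ R₀ (sectionIdeal I a d)).comp
        (aeval (fun k : Fin (n - d) => linearForm (a (d + k))))).comp
          (aeval (fun i => linearForm (w i))) := by
    ext i
    simp only [AlgHom.comp_apply, aeval_X, linearForm_apply (w i), map_sum, map_smul]
    rw [hb' i, hsplit i, map_add]
    rw [Ideal.Quotient.mkₐ_eq_mk, Ideal.Quotient.eq_zero_iff_mem.2, zero_add,
      ← Fin.sum_univ_eq_sum_range (fun j => b' i (d + j) • linearForm (a (d + j))), map_sum]
    · refine Finset.sum_congr rfl fun k _ => ?_
      rw [← Ideal.Quotient.mkₐ_eq_mk R₀, map_smul]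
    · refine Ideal.sum_mem _ fun j hj => ?_
      rw [smul_eq_C_mul]
      exact Ideal.mul_mem_left _ _ (linearForm_mem_sectionIdeal I a (Finset.mem_range.1 hj))
  exact DFunLike.congr_fun h f

end Bound

/-! ### The value of the numerator at `1` and its bound. -/

section Multiplicity

variable {R₀ : Type u} [CommRing R₀] {n : ℕ}

theorem length_sectionIdeal_le (I : Ideal (MvPolynomial (Fin n) R₀)) {a : ℕ → Fin n → R₀}
    {b : Fin n → Fin n → R₀} (hb : ∀ i, X i = ∑ j : Fin n, b i j • linearForm (a j)) {d : ℕ}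
    (hdn : d ≤ n) (t : ℕ) :
    Module.length R₀ (quotientGrading (sectionIdeal I a d) (t : ℤ)) ≤
      ((n - d).multichoose t : ℕ) * Module.length R₀ R₀ := by
  let φ := (Ideal.Quotient.mkₐ R₀ (sectionIdeal I a d)).comp
    (aeval (fun k : Fin (n - d) => linearForm (a (d + k))))
  have hφ : quotientGrading (sectionIdeal I a d) (t : ℤ) =
      (homogeneousSubmodule (Fin (n - d)) R₀ t).map φ.toLinearMap := by
    ext m
    rw [mem_quotientGrading_natCast, Submodule.mem_map]
    constructor
    · rintro ⟨f, hf, rfl⟩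
      obtain ⟨g, hg, hfg⟩ := exists_isHomogeneous_sub_mem I hb hdn hf
      exact ⟨g, hg, (Ideal.Quotient.eq.2 hfg).symm⟩
    · rintro ⟨g, hg, rfl⟩
      exact ⟨_, isHomogeneous_aeval_linearForm (fun k : Fin (n - d) => a (d + k)) hg, rfl⟩
  rw [hφ, ← length_homogeneousSubmodule]
  exact Module.length_le_of_surjective
    (φ.toLinearMap.submoduleMap (homogeneousSubmodule (Fin (n - d)) R₀ t))
    (LinearMap.submoduleMap_surjective _ _)

variable [IsArtinianRing R₀]

theorem coe_toNat_length : ((Module.length R₀ R₀).toNat : ℕ∞) = Module.length R₀ R₀ :=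
  ENat.natCast_toNat length_ne_top_of_isArtinianRing

theorem hilbertFunction_eq_zero_iff {J : Ideal (MvPolynomial (Fin n) R₀)} {t : ℕ} :
    hilbertFunction (quotientGrading J) t = 0 ↔
      ∀ f : MvPolynomial (Fin n) R₀, f.IsHomogeneous t → f ∈ J := by
  rw [← Nat.cast_inj (R := ℕ∞), coe_hilbertFunction, Nat.cast_zero, Module.length_eq_zero_iff,
    Submodule.subsingleton_iff_eq_bot, Submodule.eq_bot_iff]
  constructor
  · intro h f hf
    exact Ideal.Quotient.eq_zero_iff_mem.1 (h _ (mem_quotientGrading_natCast.2 ⟨f, hf, rfl⟩))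
  · intro h m hm
    obtain ⟨f, hf, rfl⟩ := mem_quotientGrading_natCast.1 hm
    exact Ideal.Quotient.eq_zero_iff_mem.2 (h f hf)

theorem hilbertFunction_sectionIdeal_le (I : Ideal (MvPolynomial (Fin n) R₀)) {a : ℕ → Fin n → R₀}
    {b : Fin n → Fin n → R₀} (hb : ∀ i, X i = ∑ j : Fin n, b i j • linearForm (a j)) {d : ℕ}
    (hdn : d ≤ n) (t : ℕ) :
    hilbertFunction (quotientGrading (sectionIdeal I a d)) t ≤
      (n - d).multichoose t * (Module.length R₀ R₀).toNat := by
  have := length_sectionIdeal_le I hb hdn t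
  rw [← coe_hilbertFunction, ← coe_toNat_length] at this
  exact_mod_cast this

theorem hilbertSeries_sectionIdeal_succ {I : Ideal (MvPolynomial (Fin n) R₀)} (hI : IsHomog I)
    (a : ℕ → Fin n → R₀) (j : ℕ) :
    hilbertSeries (quotientGrading (sectionIdeal I a (j + 1))) =
      hilbertSeries (quotientGrading (sectionIdeal I a j)) * (1 - PowerSeries.X) +
        PowerSeries.mk (fun t => (kernelFunction (sectionIdeal I a j) (linearForm (a j)) t : ℤ)) *
          PowerSeries.X := by
  rw [sectionIdeal_succ]
  exact hilbertSeries_section (isHomog_sectionIdeal hI a j) (isHomogeneous_linearForm _)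

/-- The numerator of the Hilbert series in terms of general linear sections. -/
theorem exists_numerator {I : Ideal (MvPolynomial (Fin n) R₀)} (hI : IsHomog I)
    {a : ℕ → Fin n → R₀} {m : ℕ}
    (ha : ∀ j < m + 1, FilterRegular (sectionIdeal I a j) (linearForm (a j)))
    (hsat : satIdeal (sectionIdeal I a (m + 1)) = ⊤) :
    ∃ (Q : Polynomial ℤ) (D : ℕ),
      hilbertSeries (quotientGrading I) * (1 - PowerSeries.X) ^ (m + 1) = (Q : PowerSeries ℤ) ∧
      Q.eval 1 = ∑ t ∈ Finset.range D,
          (hilbertFunction (quotientGrading (sectionIdeal I a (m + 1))) t : ℤ) -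
        ∑ t ∈ Finset.range D, (kernelFunction (sectionIdeal I a m) (linearForm (a m)) t : ℤ) ∧
      ∀ t ≥ D, hilbertFunction (quotientGrading (sectionIdeal I a (m + 1))) t = 0 ∧
        kernelFunction (sectionIdeal I a m) (linearForm (a m)) t = 0 := by
  choose! E hE using fun j (hj : j < m + 1) => exists_forall_kernelFunction_eq_zero (ha j hj)
  obtain ⟨D', hD'⟩ := exists_forall_isHomogeneous_mem_of_mem_satIdeal (sectionIdeal I a (m + 1))
  have hpol : ∀ j < m + 1, ∃ P : Polynomial ℤ, (P : PowerSeries ℤ) =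
      PowerSeries.mk (fun t => (kernelFunction (sectionIdeal I a j) (linearForm (a j)) t : ℤ)) := by
    intro j hj
    obtain ⟨P, hP, -⟩ := exists_coe_polynomial_eq (φ := PowerSeries.mk (fun t =>
      (kernelFunction (sectionIdeal I a j) (linearForm (a j)) t : ℤ))) (D := E j) (fun t ht => by
        rw [PowerSeries.coeff_mk, hE j hj t ht, Nat.cast_zero])
    exact ⟨P, hP⟩
  choose! K hK using hpol
  -- Only the first `m` sections are collected in `T`; the last is kept apart because its kernel
  -- contributes to the value at `1`.
  obtain ⟨T, hT⟩ := exists_mul_one_sub_pow_eq_sub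
    (φ := fun j => hilbertSeries (quotientGrading (sectionIdeal I a j))) (K := K) m (by
      intro j hj
      rw [hK j (by omega)]
      exact hilbertSeries_sectionIdeal_succ hI a j)
  have hzero : ∀ t ≥ max (E m) D',
      hilbertFunction (quotientGrading (sectionIdeal I a (m + 1))) t = 0 ∧
        kernelFunction (sectionIdeal I a m) (linearForm (a m)) t = 0 := fun t ht =>
    ⟨hilbertFunction_eq_zero_iff.2 fun f hf =>
      hD' t (le_trans (le_max_right _ _) ht) f hf (hsat ▸ Submodule.mem_top),
      hE m (by omega) t (le_trans (le_max_left _ _) ht)⟩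
  obtain ⟨P, hP, hP1⟩ := exists_coe_polynomial_eq
    (φ := hilbertSeries (quotientGrading (sectionIdeal I a (m + 1)))) (D := max (E m) D')
    (fun t ht => by
      have := (hzero t ht).1
      simp [hilbertSeries, this])
  obtain ⟨P', hP', hP1'⟩ := exists_coe_polynomial_eq
    (φ := PowerSeries.mk (fun t =>
      (kernelFunction (sectionIdeal I a m) (linearForm (a m)) t : ℤ))) (D := max (E m) D')
    (fun t ht => by
      rw [PowerSeries.coeff_mk, (hzero t ht).2, Nat.cast_zero])
  -- Here `P - z P'` is `1 - z` times the series of the `m`-th section, with `P` and `P'` the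
  -- polynomials of the last section and of the last kernel.
  refine ⟨P - P' * Polynomial.X - T * (1 - Polynomial.X), max (E m) D', ?_, ?_, hzero⟩
  · rw [sectionIdeal_zero] at hT
    have h := hilbertSeries_sectionIdeal_succ hI a m
    rw [← hP'] at h
    have h' : (P : PowerSeries ℤ) = _ := hP.trans h
    rw [pow_succ, ← mul_assoc, hT]
    push_cast
    rw [h']
    ring
  · simp only [Polynomial.eval_sub, Polynomial.eval_mul, Polynomial.eval_X, Polynomial.eval_one,
      sub_self, mul_zero, mul_one, sub_zero, hP1, hP1']
    simp [hilbertSeries]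

/-- Vanishing of cohomology above `r` bounds the multiplicity. -/
theorem exists_numerator_le {I : Ideal (MvPolynomial (Fin n) R₀)} (hI : IsHomog I)
    {a : ℕ → Fin n → R₀} {b : Fin n → Fin n → R₀}
    (hb : ∀ i, X i = ∑ j : Fin n, b i j • linearForm (a j)) {m : ℕ} (hmn : m + 1 ≤ n)
    (ha : ∀ j < m + 1, FilterRegular (sectionIdeal I a j) (linearForm (a j)))
    (hsat : satIdeal (sectionIdeal I a (m + 1)) = ⊤) {r : ℕ} (hr : VanishesAbove I (m + 1) r) :
    ∃ Q : Polynomial ℤ,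
      hilbertSeries (quotientGrading I) * (1 - PowerSeries.X) ^ (m + 1) = (Q : PowerSeries ℤ) ∧
      Q.eval 1 ≤ (((Module.length R₀ R₀).toNat *
        (r + (n - (m + 1))).choose (n - (m + 1)) : ℕ) : ℤ) ∧
      (Q.eval 1 = (((Module.length R₀ R₀).toNat *
        (r + (n - (m + 1))).choose (n - (m + 1)) : ℕ) : ℤ) →
        (∀ t, kernelFunction (sectionIdeal I a m) (linearForm (a m)) t = 0) ∧
        ∀ t ≤ r, hilbertFunction (quotientGrading (sectionIdeal I a (m + 1))) t =
          (n - (m + 1)).multichoose t * (Module.length R₀ R₀).toNat) := by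
  obtain ⟨Q, D, hQ, hQ1, hD⟩ := exists_numerator hI ha hsat
  have hzero : ∀ t : ℕ, r < t →
      hilbertFunction (quotientGrading (sectionIdeal I a (m + 1))) t = 0 := fun t ht =>
    hilbertFunction_eq_zero_iff.2 fun f hf =>
      hr.mem_sectionIdeal hI ha hsat (by exact_mod_cast ht) hf
  set c := n - (m + 1) with hc
  set ℓ := (Module.length R₀ R₀).toNat
  set h : ℕ → ℕ := fun t => hilbertFunction (quotientGrading (sectionIdeal I a (m + 1))) t with hh
  -- Both ranges contain the support of `h`: one by finite length, the other by the vanishing above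
  -- `r`.
  have hsum : ∑ t ∈ Finset.range D, h t = ∑ t ∈ Finset.range (r + 1), h t := by
    trans ∑ t ∈ Finset.range (max D (r + 1)), h t
    · refine Finset.sum_subset (Finset.range_mono (le_max_left _ _)) fun t _ ht => ?_
      exact (hD t (by simpa using ht)).1
    · refine (Finset.sum_subset (Finset.range_mono (le_max_right _ _)) fun t _ ht => ?_).symm
      exact hzero t (by simpa using ht)
  have hbin : ℓ * (r + c).choose c = ∑ t ∈ Finset.range (r + 1), c.multichoose t * ℓ := by
    rw [← Finset.sum_mul, sum_multichoose, mul_comm]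
  have hle : ∀ t ∈ Finset.range (r + 1), h t ≤ c.multichoose t * ℓ := fun t _ =>
    hilbertFunction_sectionIdeal_le I hb hmn t
  have hQ2 : Q.eval 1 + ((∑ t ∈ Finset.range D,
      kernelFunction (sectionIdeal I a m) (linearForm (a m)) t : ℕ) : ℤ) =
        ((∑ t ∈ Finset.range (r + 1), h t : ℕ) : ℤ) := by
    rw [hQ1, ← hsum]
    push_cast
    ring
  have hle' := Finset.sum_le_sum hle
  refine ⟨Q, hQ, ?_, ?_⟩
  · rw [hbin]
    zify at hle' ⊢
    have : (0 : ℤ) ≤ ((∑ t ∈ Finset.range D,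
      kernelFunction (sectionIdeal I a m) (linearForm (a m)) t : ℕ) : ℤ) := Nat.cast_nonneg _
    push_cast at this hQ2
    linarith
  · intro heq
    -- Equality leaves no slack: the kernel lengths sum to zero and every termwise bound on `h` is
    -- attained.
    rw [heq, hbin, ← Nat.cast_add, Nat.cast_inj] at hQ2
    have h0 : ∑ t ∈ Finset.range D,
      kernelFunction (sectionIdeal I a m) (linearForm (a m)) t = 0 := by omega
    refine ⟨fun t => ?_, fun t ht => ?_⟩
    · by_cases htD : t < D
      · exact Finset.sum_eq_zero_iff.1 h0 t (Finset.mem_range.2 htD)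
      · exact (hD t (by omega)).2
    · exact (Finset.sum_eq_sum_iff_of_le hle).1 (by omega) t (Finset.mem_range.2 (by omega))

end Multiplicity

/-! ### Monic polynomials in distinct variables. -/

section RegularSequences

/-- An ideal generated by constants is extended from `A`, so the quotient is a polynomial ring over
a quotient of `A`, where a monic polynomial is a nonzerodivisor. -/
theorem mem_span_of_mul_mem_of_monic {A S : Type*} [CommRing A] [CommRing S]
    (e : S ≃+* Polynomial A) {g : S} (hg : (e g).Monic) {s : Set S}
    (hs : ∀ x ∈ s, ∃ p, e x = Polynomial.C p) {f : S} (h : g * f ∈ Ideal.span s) :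
    f ∈ Ideal.span s := by
  let I : Ideal A := Ideal.span {p | Polynomial.C p ∈ e '' s}
  have hI : (Ideal.span s).map e = I.map Polynomial.C := by
    rw [Ideal.map_span, Ideal.map_span]
    congr 1
    ext x
    constructor
    · rintro ⟨y, hy, rfl⟩
      obtain ⟨p, hp⟩ := hs y hy
      exact ⟨p, ⟨y, hy, hp⟩, hp.symm⟩
    · rintro ⟨p, hp, rfl⟩
      exact hp
  have hmem : ∀ x, e x ∈ (Ideal.span s).map e ↔ x ∈ Ideal.span s := by
    intro x
    rw [Ideal.mem_map_iff_of_surjective _ e.surjective]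
    exact ⟨fun ⟨y, hy, h⟩ => e.injective h ▸ hy, fun h => ⟨x, h, rfl⟩⟩
  have key : ∀ x, x ∈ Ideal.span s ↔ Polynomial.map (Ideal.Quotient.mk I) (e x) = 0 := by
    intro x
    rw [← hmem, hI, Ideal.mem_map_C_iff]
    simp [Polynomial.ext_iff, Ideal.Quotient.eq_zero_iff_mem]
  rw [key, map_mul, Polynomial.map_mul] at h
  rw [key]
  exact (hg.map _).mul_right_eq_zero_iff.1 h

/-- The polynomial ring in the variables `X i` as a polynomial ring in `X k` over the polynomial ring
in the other variables. -/
def singleOutEquiv (A : Type u) [CommRing A] {d : ℕ} (k : Fin d) :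
    MvPolynomial (Fin d) A ≃ₐ[A] Polynomial (MvPolynomial {i : Fin d // i ≠ k} A) :=
  (renameEquiv A (Equiv.optionSubtypeNe k).symm).trans (optionEquivLeft A _)

theorem singleOutEquiv_X_self (A : Type u) [CommRing A] {d : ℕ} (k : Fin d) :
    singleOutEquiv A k (X k) = Polynomial.X := by
  simp [singleOutEquiv]

theorem singleOutEquiv_X_of_ne (A : Type u) [CommRing A] {d : ℕ} {k i : Fin d} (h : i ≠ k) :
    singleOutEquiv A k (X i) = Polynomial.C (X ⟨i, h⟩) := by
  simp [singleOutEquiv, Equiv.optionSubtypeNe_symm_of_ne h]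

theorem monic_singleOutEquiv_aeval {A : Type u} [CommRing A] {d : ℕ} (k : Fin d)
    {F : Polynomial A} (hF : F.Monic) :
    (singleOutEquiv A k (Polynomial.aeval (X k) F)).Monic := by
  have h : singleOutEquiv A k (Polynomial.aeval (X k) F) =
      F.map (algebraMap A (MvPolynomial {i : Fin d // i ≠ k} A)) := by
    have := Polynomial.aeval_algHom_apply (singleOutEquiv A k).toAlgHom (X k) F
    rw [AlgEquiv.toAlgHom_apply, singleOutEquiv_X_self] at this
    exact this.symm.trans (Polynomial.aeval_X_left_eq_map F)
  rw [h]
  exact hF.map _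

theorem singleOutEquiv_aeval_of_ne {A : Type u} [CommRing A] {d : ℕ} {k i : Fin d} (h : i ≠ k)
    (F : Polynomial A) : singleOutEquiv A k (Polynomial.aeval (X i) F) =
      Polynomial.C (Polynomial.aeval (X ⟨i, h⟩) F) := by
  have := Polynomial.aeval_algHom_apply (singleOutEquiv A k).toAlgHom (X i) F
  rw [AlgEquiv.toAlgHom_apply, singleOutEquiv_X_of_ne A h] at this
  refine this.symm.trans ?_
  rw [← Polynomial.algebraMap_eq, Polynomial.aeval_algebraMap_apply]

/-- Monic polynomials in distinct variables form a weakly regular sequence. -/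
theorem isWeaklyRegular_ofFn_aeval_X {A : Type u} [CommRing A] {d : ℕ} (F : Fin d → Polynomial A)
    (hF : ∀ i, (F i).Monic) :
    RingTheory.Sequence.IsWeaklyRegular (MvPolynomial (Fin d) A)
      (List.ofFn fun i => Polynomial.aeval (X i : MvPolynomial (Fin d) A) (F i)) := by
  refine ⟨fun k hk => (isSMulRegular_quotient_iff_mem_of_smul_mem _ _).2 fun f hf => ?_⟩
  have hk' : k < d := by rwa [List.length_ofFn] at hk
  rw [smul_eq_mul, Ideal.mul_top] at hf
  rw [smul_eq_mul, Ideal.mul_top]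
  -- Viewed as polynomials in the `k`-th variable, the earlier members of the sequence are constants
  -- and the `k`-th stays monic.
  refine mem_span_of_mul_mem_of_monic (singleOutEquiv A ⟨k, hk'⟩).toRingEquiv ?_ ?_ hf
  · rw [List.getElem_ofFn]
    exact monic_singleOutEquiv_aeval _ (hF _)
  · intro x hx
    obtain ⟨i, hi, rfl⟩ := List.mem_take_iff_getElem.1 hx
    rw [List.getElem_ofFn]
    exact ⟨_, singleOutEquiv_aeval_of_ne (by simp; omega) _⟩

end RegularSequences

/-! ### Flat algebras over polynomial rings with Artinian base. -/

section CohenMacaulay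

/-- At a maximal ideal `m`, each coordinate satisfies a monic equation over `R₀` modulo `m`.
Evaluating these polynomials at the variables gives a regular sequence, and flatness followed by
localization keeps it regular. Its length `d` bounds the local dimension from below, and the
dimension of `B` bounds it from above. -/
theorem isCohenMacaulayRing_of_flat {R₀ : Type u} [CommRing R₀] [IsArtinianRing R₀] {d : ℕ}
    (B : Type u) [CommRing B] [Algebra R₀ B] [Algebra.FiniteType R₀ B]
    [Algebra (MvPolynomial (Fin d) R₀) B] [IsScalarTower R₀ (MvPolynomial (Fin d) R₀) B]
    [Module.Flat (MvPolynomial (Fin d) R₀) B] (hdim : ringKrullDim B ≤ d) :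
    IsCohenMacaulayRing B := by
  have hB : IsNoetherianRing B := Algebra.FiniteType.isNoetherianRing R₀ B
  refine ⟨hB, fun m hm => ⟨inferInstance, inferInstance, ?_⟩⟩
  let y : Fin d → B := fun i => algebraMap (MvPolynomial (Fin d) R₀) B (X i)
  have hint : ∀ i, ∃ F : Polynomial R₀, F.Monic ∧ Polynomial.aeval (y i) F ∈ m := by
    intro i
    let _ := Ideal.Quotient.field m
    -- The Nullstellensatz over the Jacobson ring `R₀`.
    have : Module.Finite R₀ (B ⧸ m) := finite_of_finite_type_of_isJacobsonRing R₀ (B ⧸ m)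
    obtain ⟨F, hF, h⟩ := Algebra.IsIntegral.isIntegral (R := R₀) (Ideal.Quotient.mk m (y i))
    refine ⟨F, hF, Ideal.Quotient.eq_zero_iff_mem.1 ?_⟩
    rw [← Ideal.Quotient.mkₐ_eq_mk R₀, ← Polynomial.aeval_algHom_apply]
    exact h
  choose F hF hFm using hint
  have hreg := (isWeaklyRegular_ofFn_aeval_X F hF).of_flat (S := B)
  have hmem : ∀ b ∈ (List.ofFn fun i => Polynomial.aeval (X i : MvPolynomial (Fin d) R₀)
      (F i)).map (algebraMap (MvPolynomial (Fin d) R₀) B), b ∈ m := by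
    intro b hb
    rw [List.mem_map] at hb
    obtain ⟨s, hs, rfl⟩ := hb
    obtain ⟨i, rfl⟩ := (List.mem_ofFn' _ _).1 hs
    rw [← Polynomial.aeval_algebraMap_apply]
    exact hFm i
  have hreg' := hreg.isRegular_of_isLocalization_of_mem (Localization.AtPrime m) m hmem
  refine ⟨_, hreg', ?_⟩
  have hlen := ringKrullDim_add_length_eq_ringKrullDim_of_isRegular _ hreg'
  have hnt : Nontrivial (Localization.AtPrime m ⧸ Ideal.ofList
      (((List.ofFn fun i => Polynomial.aeval (X i : MvPolynomial (Fin d) R₀) (F i)).map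
        (algebraMap (MvPolynomial (Fin d) R₀) B)).map (algebraMap B (Localization.AtPrime m)))) := by
    refine Ideal.Quotient.nontrivial_iff.2 fun h => hreg'.2 ?_
    rw [h, smul_eq_mul, Ideal.mul_top]
  refine le_antisymm ?_ ?_
  · rw [← hlen]
    exact le_add_of_nonneg_left ringKrullDim_nonneg_of_nontrivial
  · rw [IsLocalization.AtPrime.ringKrullDim_eq_height m (Localization.AtPrime m)]
    refine (Ideal.height_le_ringKrullDim_of_isPrime).trans (hdim.trans ?_)
    simp

end CohenMacaulay

/-! ### Saturated ideals and regular linear forms. -/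

section Saturation

variable {R₀ : Type u} [CommRing R₀] {n : ℕ}

theorem mem_of_forall_homogeneousComponent_mem {J : Ideal (MvPolynomial (Fin n) R₀)}
    {f : MvPolynomial (Fin n) R₀} (h : ∀ k, homogeneousComponent k f ∈ J) : f ∈ J := by
  rw [← sum_homogeneousComponent f]
  exact J.sum_mem fun k _ => h k

theorem mem_of_mul_mem_of_kernelFunction_eq_zero [IsArtinianRing R₀]
    {J : Ideal (MvPolynomial (Fin n) R₀)} (hJ : IsHomog J) {y : MvPolynomial (Fin n) R₀}
    (hy : y.IsHomogeneous 1) (h : ∀ t, kernelFunction J y t = 0) {f : MvPolynomial (Fin n) R₀}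
    (hf : y * f ∈ J) : f ∈ J := by
  refine mem_of_forall_homogeneousComponent_mem fun k => ?_
  refine kernelFunction_eq_zero_iff.1 (h k) _ (homogeneousComponent_isHomogeneous k f) ?_
  rw [← homogeneousComponent_mul_of_isHomogeneous hy]
  exact hJ.component_mem _ hf

/-- A power of `y ∈ R_+` multiplies a given element of the saturation into `J`, and the factors `y`
cancel one at a time. -/
theorem satIdeal_le_of_forall_mul_mem {J : Ideal (MvPolynomial (Fin n) R₀)}
    {y : MvPolynomial (Fin n) R₀} (hy : y ∈ idealOfVars (Fin n) R₀)
    (h : ∀ f, y * f ∈ J → f ∈ J) : satIdeal J ≤ J := by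
  intro f hf
  have hle : idealOfVars (Fin n) R₀ ≤ (Submodule.colon J {f}).radical := by
    refine idealOfVars_le_of_forall_X_mem fun i => ?_
    obtain ⟨N, hN⟩ := hf i
    exact ⟨N, Submodule.mem_colon_singleton.2 hN⟩
  obtain ⟨N, hN⟩ := hle hy
  have hN' : y ^ N * f ∈ J := Submodule.mem_colon_singleton.1 hN
  clear hN
  induction N with
  | zero => simpa using hN'
  | succ N ih =>
    refine ih (h _ ?_)
    rwa [← mul_assoc, ← pow_succ']

/-- Induction on the degree: an element of the saturation is `y g` modulo `J` with `g` of smaller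
degree, and filter-regularity of `y` makes `g` lie in the saturation again. -/
theorem satIdeal_le_of_sup_span {J : Ideal (MvPolynomial (Fin n) R₀)} (hJ : IsHomog J)
    {y : MvPolynomial (Fin n) R₀} (hy : y.IsHomogeneous 1) (hreg : FilterRegular J y)
    (h : satIdeal (J ⊔ Ideal.span {y}) ≤ J ⊔ Ideal.span {y}) : satIdeal J ≤ J := by
  suffices H : ∀ t, ∀ f : MvPolynomial (Fin n) R₀, f.IsHomogeneous t → f ∈ satIdeal J → f ∈ J by
    intro f hf
    exact mem_of_forall_homogeneousComponent_mem fun k =>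
      H k _ (homogeneousComponent_isHomogeneous k f) (hJ.satIdeal hf)
  intro t
  induction t with
  | zero =>
    intro f hf hfs
    rcases exists_sub_mul_mem_of_mem_sup_span hJ hy hf (h (satIdeal_mono le_sup_left hfs)) with
      ⟨-, h0⟩ | ⟨s, hs, -⟩
    · exact h0
    · omega
  | succ t ih =>
    intro f hf hfs
    rcases exists_sub_mul_mem_of_mem_sup_span hJ hy hf (h (satIdeal_mono le_sup_left hfs)) with
      ⟨-, h0⟩ | ⟨s, hs, g, hg, hfg⟩
    · exact h0
    · obtain rfl : t = s := by omega
      have hyg : y * g ∈ satIdeal J := by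
        rw [← sub_sub_cancel f (y * g)]
        exact sub_mem hfs (le_satIdeal J hfg)
      have hgs : g ∈ satIdeal J := mem_satIdeal_of_X_pow_mul_mem fun i => by
        obtain ⟨N, hN⟩ := hyg i
        exact ⟨N, hreg _ (by rwa [mul_left_comm])⟩
      rw [← sub_add_cancel f (y * g)]
      exact J.add_mem hfg (J.mul_mem_left _ (ih g hg hgs))

theorem linearForm_mem_idealOfVars (v : Fin n → R₀) : linearForm v ∈ idealOfVars (Fin n) R₀ := by
  have := mem_pow_idealOfVars_of_isHomogeneous (isHomogeneous_linearForm v)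
  rwa [pow_one] at this

/-- If the last of a sequence of filter-regular linear forms is regular, then they all are. -/
theorem mem_sectionIdeal_of_mul_mem [IsArtinianRing R₀] {I : Ideal (MvPolynomial (Fin n) R₀)}
    (hI : IsHomog I) {a : ℕ → Fin n → R₀} {m : ℕ}
    (ha : ∀ j < m + 1, FilterRegular (sectionIdeal I a j) (linearForm (a j)))
    (h : ∀ t, kernelFunction (sectionIdeal I a m) (linearForm (a m)) t = 0) :
    ∀ j < m + 1, ∀ f, linearForm (a j) * f ∈ sectionIdeal I a j → f ∈ sectionIdeal I a j := by
  have hsat : ∀ k ≤ m, satIdeal (sectionIdeal I a (m - k)) ≤ sectionIdeal I a (m - k) := by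
    intro k
    induction k with
    | zero =>
      intro _
      exact satIdeal_le_of_forall_mul_mem (linearForm_mem_idealOfVars _) fun f hf =>
        mem_of_mul_mem_of_kernelFunction_eq_zero (isHomog_sectionIdeal hI a m)
          (isHomogeneous_linearForm _) h hf
    | succ k ih =>
      intro hk
      refine satIdeal_le_of_sup_span (isHomog_sectionIdeal hI a _) (isHomogeneous_linearForm _)
        (ha (m - (k + 1)) (by omega)) ?_
      rw [← sectionIdeal_succ, show m - (k + 1) + 1 = m - k by omega]
      exact ih (by omega)
  intro j hj f hf
  have := hsat (m - j) (by omega)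
  rw [show m - (m - j) = j by omega] at this
  exact this (ha j hj f hf)

theorem hilbertSeries_mul_pow_eq [IsArtinianRing R₀] {I : Ideal (MvPolynomial (Fin n) R₀)}
    (hI : IsHomog I) {a : ℕ → Fin n → R₀} {d : ℕ}
    (h : ∀ j < d, ∀ f, linearForm (a j) * f ∈ sectionIdeal I a j → f ∈ sectionIdeal I a j) :
    hilbertSeries (quotientGrading I) * (1 - PowerSeries.X) ^ d =
      hilbertSeries (quotientGrading (sectionIdeal I a d)) := by
  have := mul_one_sub_pow_eq_of_forall_eq
    (φ := fun j => hilbertSeries (quotientGrading (sectionIdeal I a j))) d (by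
      intro j hj
      have hk : ∀ t, kernelFunction (sectionIdeal I a j) (linearForm (a j)) t = 0 := fun t =>
        kernelFunction_eq_zero_iff.2 fun f _ hf => h j hj f hf
      have h0 : (PowerSeries.mk fun _ => 0 : PowerSeries ℤ) = 0 := by
        ext
        simp
      have := hilbertSeries_sectionIdeal_succ hI a j
      simp only [hk, Nat.cast_zero, h0, zero_mul, add_zero] at this
      exact this)
  rwa [sectionIdeal_zero] at this

end Saturation

/-! ### Independence of the complementary monomials. -/

section Freeness

variable {R₀ : Type u} [CommRing R₀] {n : ℕ}

theorem homogeneousComponent_aeval_linearForm {m : ℕ} (w : Fin m → Fin n → R₀) (t : ℕ)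
    (g : MvPolynomial (Fin m) R₀) :
    homogeneousComponent t (aeval (fun k => linearForm (w k)) g) =
      aeval (fun k => linearForm (w k)) (homogeneousComponent t g) := by
  conv_lhs => rw [← sum_homogeneousComponent g, map_sum, map_sum]
  have h : ∀ i, homogeneousComponent t (aeval (fun k => linearForm (w k))
      (homogeneousComponent i g)) =
      if i = t then aeval (fun k => linearForm (w k)) (homogeneousComponent i g) else 0 := by
    intro i
    rw [homogeneousComponent_of_mem
      (isHomogeneous_aeval_linearForm w (homogeneousComponent_isHomogeneous i g))]
    simp [eq_comm]
  simp only [h, Finset.sum_ite_eq', Finset.mem_range]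
  split_ifs with ht
  · rfl
  · rw [homogeneousComponent_eq_zero _ _ (by omega), map_zero]

variable [IsArtinianRing R₀]

/-- Forms of degree `t` in the complementary linear forms are independent modulo the general
section if its Hilbert function is maximal in degree `t`. -/
theorem eq_zero_of_aeval_mem_sectionIdeal (I : Ideal (MvPolynomial (Fin n) R₀))
    {a : ℕ → Fin n → R₀} {b : Fin n → Fin n → R₀}
    (hb : ∀ i, X i = ∑ j : Fin n, b i j • linearForm (a j)) {d : ℕ} (hdn : d ≤ n) {t : ℕ}
    (h : hilbertFunction (quotientGrading (sectionIdeal I a d)) t =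
      (n - d).multichoose t * (Module.length R₀ R₀).toNat)
    {g : MvPolynomial (Fin (n - d)) R₀} (hg : g.IsHomogeneous t)
    (hmem : aeval (fun k : Fin (n - d) => linearForm (a (d + k))) g ∈ sectionIdeal I a d) :
    g = 0 := by
  let φ := (Ideal.Quotient.mkₐ R₀ (sectionIdeal I a d)).comp
    (aeval (fun k : Fin (n - d) => linearForm (a (d + k))))
  have hφ : ∀ g ∈ homogeneousSubmodule (Fin (n - d)) R₀ t,
      φ.toLinearMap g ∈ quotientGrading (sectionIdeal I a d) (t : ℤ) := fun g hg =>
    mem_quotientGrading_natCast.2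
      ⟨_, isHomogeneous_aeval_linearForm (fun k : Fin (n - d) => a (d + k)) hg, rfl⟩
  let ψ := φ.toLinearMap.restrict hφ
  have hψ : Function.Surjective ψ := by
    rintro ⟨m, hm⟩
    obtain ⟨f, hf, rfl⟩ := mem_quotientGrading_natCast.1 hm
    obtain ⟨g, hg, hfg⟩ := exists_isHomogeneous_sub_mem I hb hdn hf
    exact ⟨⟨g, hg⟩, Subtype.ext (Ideal.Quotient.eq.2 hfg).symm⟩
  have hlen := Module.length_eq_add_of_exact (R := R₀) (N := LinearMap.ker ψ)
    (P := quotientGrading (sectionIdeal I a d) (t : ℤ)) (LinearMap.ker ψ).subtype ψ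
    (Submodule.subtype_injective _) hψ (by rw [LinearMap.exact_iff, Submodule.range_subtype])
  rw [length_homogeneousSubmodule, ← coe_hilbertFunction, h, Nat.cast_mul, coe_toNat_length]
    at hlen
  have hker : Module.length R₀ (LinearMap.ker ψ) = 0 := by
    have hfin : ((n - d).multichoose t : ℕ∞) * Module.length R₀ R₀ ≠ ⊤ :=
      WithTop.mul_ne_top (ENat.natCast_ne_top _) length_ne_top_of_isArtinianRing
    -- A surjection between modules of the same finite length has kernel of length zero.
    refine (ENat.add_left_injective_of_ne_top hfin) ?_
    simpa using hlen.symm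
  rw [Module.length_eq_zero_iff, Submodule.subsingleton_iff_eq_bot] at hker
  have : (⟨g, hg⟩ : homogeneousSubmodule (Fin (n - d)) R₀ t) ∈ LinearMap.ker ψ :=
    LinearMap.mem_ker.2 (Subtype.ext (Ideal.Quotient.eq_zero_iff_mem.2 hmem))
  rw [hker, Submodule.mem_bot] at this
  exact congrArg Subtype.val this

/-- The monomials in the complementary linear forms. -/
def complementaryMonomial (a : ℕ → Fin n → R₀) (d : ℕ) (α : Fin (n - d) →₀ ℕ) :
    MvPolynomial (Fin n) R₀ :=
  aeval (fun k : Fin (n - d) => linearForm (a (d + k))) (monomial α (1 : R₀))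

omit [IsArtinianRing R₀] in
theorem aeval_linearForm_mem_sectionIdeal (I : Ideal (MvPolynomial (Fin n) R₀))
    (a : ℕ → Fin n → R₀) {d j : ℕ} {p : MvPolynomial (Fin d) R₀}
    (hp : p ∈ Ideal.span (X '' {i : Fin d | (i : ℕ) < j})) :
    aeval (fun i : Fin d => linearForm (a i)) p ∈ sectionIdeal I a j := by
  rw [← Ideal.mem_comap]
  refine Ideal.span_le.2 ?_ hp
  rintro _ ⟨i, hi, rfl⟩
  rw [SetLike.mem_coe, Ideal.mem_comap, aeval_X]
  exact linearForm_mem_sectionIdeal I a hi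

/-- Modulo the section ideal only the constant terms of the coefficients survive. They form a
relation over `R₀` among complementary monomials, which is trivial in each degree at most `r` by
maximality of the Hilbert function. -/
theorem coefficients_mem_of_sum_mem_sectionIdeal {I : Ideal (MvPolynomial (Fin n) R₀)}
    (hI : IsHomog I) {a : ℕ → Fin n → R₀} {b : Fin n → Fin n → R₀}
    (hb : ∀ i, X i = ∑ j : Fin n, b i j • linearForm (a j)) {d : ℕ} (hdn : d ≤ n) {r : ℕ}
    (hmax : ∀ t ≤ r, hilbertFunction (quotientGrading (sectionIdeal I a d)) t =
      (n - d).multichoose t * (Module.length R₀ R₀).toNat)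
    (s : Finset {α : Fin (n - d) →₀ ℕ // α.degree ≤ r})
    (p : {α : Fin (n - d) →₀ ℕ // α.degree ≤ r} → MvPolynomial (Fin d) R₀)
    (h : ∑ α ∈ s, aeval (fun i : Fin d => linearForm (a i)) (p α) * complementaryMonomial a d α.1 ∈
      sectionIdeal I a d) :
    ∀ α ∈ s, p α ∈ Ideal.span (X '' {i : Fin d | (i : ℕ) < d}) := by
  classical
  have hset : Ideal.span (X '' {i : Fin d | (i : ℕ) < d}) = idealOfVars (Fin d) R₀ := by
    simp [idealOfVars]
  let g : MvPolynomial (Fin (n - d)) R₀ := ∑ α ∈ s, monomial α.1 (constantCoeff (p α))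
  have hg : aeval (fun k : Fin (n - d) => linearForm (a (d + k))) g ∈ sectionIdeal I a d := by
    have hsub : ∑ α ∈ s, aeval (fun i : Fin d => linearForm (a i))
        (p α - C (constantCoeff (p α))) * complementaryMonomial a d α.1 ∈ sectionIdeal I a d := by
      refine Ideal.sum_mem _ fun α _ => Ideal.mul_mem_right _ _ ?_
      refine aeval_linearForm_mem_sectionIdeal I a ?_
      rw [hset]
      exact sub_C_constantCoeff_mem_idealOfVars _
    have heq : aeval (fun k : Fin (n - d) => linearForm (a (d + k))) g =
        ∑ α ∈ s, aeval (fun i : Fin d => linearForm (a i)) (p α) * complementaryMonomial a d α.1 -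
          ∑ α ∈ s, aeval (fun i : Fin d => linearForm (a i)) (p α - C (constantCoeff (p α))) *
            complementaryMonomial a d α.1 := by
      rw [← Finset.sum_sub_distrib, map_sum]
      refine Finset.sum_congr rfl fun α _ => ?_
      rw [← sub_mul, ← map_sub, sub_sub_cancel, complementaryMonomial, ← algebraMap_eq,
        AlgHom.commutes, ← Algebra.smul_def, ← map_smul, smul_monomial, smul_eq_mul, mul_one]
    rw [heq]
    exact sub_mem h hsub
  have hg0 : g = 0 := by
    rw [← sum_homogeneousComponent g]
    refine Finset.sum_eq_zero fun t _ => ?_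
    by_cases ht : t ≤ r
    · refine eq_zero_of_aeval_mem_sectionIdeal I hb hdn (hmax t ht)
        (homogeneousComponent_isHomogeneous t g) ?_
      rw [← homogeneousComponent_aeval_linearForm (fun k : Fin (n - d) => a (d + k))]
      exact (isHomog_sectionIdeal hI a d).component_mem t hg
    · refine homogeneousComponent_eq_zero _ _ (lt_of_le_of_lt ?_ (not_le.1 ht))
      exact (totalDegree_finsetSum _ _).trans (Finset.sup_le fun α _ =>
        (totalDegree_monomial_le _ _).trans α.2)
  intro α hα
  rw [hset, mem_idealOfVars_iff]
  have := congrArg (coeff α.1) hg0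
  rw [coeff_sum, Finset.sum_eq_single_of_mem α hα] at this
  · simpa using this
  · intro β _ hβ
    rw [coeff_monomial, if_neg fun h => hβ (Subtype.ext h)]

/-- The key step in the proof of freeness over the polynomial ring in the general linear forms. -/
theorem coefficients_mem_span_of_sum_mem {I : Ideal (MvPolynomial (Fin n) R₀)}
    (hI : IsHomog I) {a : ℕ → Fin n → R₀} {b : Fin n → Fin n → R₀}
    (hb : ∀ i, X i = ∑ j : Fin n, b i j • linearForm (a j)) {d : ℕ} (hdn : d ≤ n) {r : ℕ}
    (hmax : ∀ t ≤ r, hilbertFunction (quotientGrading (sectionIdeal I a d)) t =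
      (n - d).multichoose t * (Module.length R₀ R₀).toNat)
    (hreg : ∀ j < d, ∀ f, linearForm (a j) * f ∈ sectionIdeal I a j → f ∈ sectionIdeal I a j)
    (s : Finset {α : Fin (n - d) →₀ ℕ // α.degree ≤ r}) :
    ∀ k ≤ d, ∀ p : {α : Fin (n - d) →₀ ℕ // α.degree ≤ r} → MvPolynomial (Fin d) R₀,
      ∑ α ∈ s, aeval (fun i : Fin d => linearForm (a i)) (p α) * complementaryMonomial a d α.1 ∈
        sectionIdeal I a (d - k) →
      ∀ α ∈ s, p α ∈ Ideal.span (X '' {i : Fin d | (i : ℕ) < d - k}) := by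
  intro k
  induction k with
  | zero => exact fun _ p h => coefficients_mem_of_sum_mem_sectionIdeal hI hb hdn hmax s p h
  | succ k ih =>
    intro hk
    obtain ⟨j, hj⟩ : ∃ j, j + 1 = d - k := ⟨d - (k + 1), by omega⟩
    obtain rfl : d - (k + 1) = j := by omega
    set j := d - (k + 1)
    have hjd : j < d := by omega
    rw [← hj] at ih
    replace ih := ih (by omega)
    let e : Fin d := ⟨j, hjd⟩
    -- Descent from `j + 1` to `j`: write each coefficient as `x_j q` plus a remainder free of
    -- `x_j`. The remainder lies in the ideal of the earlier variables, and regularity of the `j`-th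
    -- form gives the same kind of relation for `q`. The induction is on a bound for the exponent of
    -- `x_j` in the monomial considered.
    have key : ∀ N : ℕ, ∀ p : {α : Fin (n - d) →₀ ℕ // α.degree ≤ r} → MvPolynomial (Fin d) R₀,
        ∑ α ∈ s, aeval (fun i : Fin d => linearForm (a i)) (p α) *
          complementaryMonomial a d α.1 ∈ sectionIdeal I a j →
        ∀ α ∈ s, ∀ x ∈ (p α).support, x e < N → ∃ i : Fin d, (i : ℕ) < j ∧ x i ≠ 0 := by
      intro N
      induction N with
      | zero => exact fun _ _ _ _ x _ hx => absurd hx (Nat.not_lt_zero _)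
      | succ N ihN =>
        intro p hp α hα x hx hxN
        have hpj := ih p (sectionIdeal_mono I a (Nat.le_succ j) hp)
        by_cases hxe : x e = 0
        · obtain ⟨i, hi, hxi⟩ := mem_ideal_span_X_image.1 (hpj α hα) x hx
          refine ⟨i, lt_of_le_of_ne (Nat.lt_succ_iff.1 hi) fun h => hxi ?_, hxi⟩
          rwa [show i = e from Fin.ext h]
        · let q : {α : Fin (n - d) →₀ ℕ // α.degree ≤ r} → MvPolynomial (Fin d) R₀ := fun α =>
            (p α).divMonomial (Finsupp.single e 1)
          have hmod : ∀ α ∈ s, (p α).modMonomial (Finsupp.single e 1) ∈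
              Ideal.span (X '' {i : Fin d | (i : ℕ) < j}) := by
            intro α hα
            rw [mem_ideal_span_X_image]
            intro x hx
            have hle : ¬ Finsupp.single e 1 ≤ x := fun h =>
              mem_support_iff.1 hx (coeff_modMonomial_of_le _ h)
            rw [mem_support_iff, coeff_modMonomial_of_not_le _ hle, ← mem_support_iff] at hx
            obtain ⟨i, hi, hxi⟩ := mem_ideal_span_X_image.1 (hpj α hα) x hx
            refine ⟨i, lt_of_le_of_ne (Nat.lt_succ_iff.1 hi) fun h => hle ?_, hxi⟩
            rw [Finsupp.single_le_iff, ← show i = e from Fin.ext h]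
            omega
          have hsum : ∑ α ∈ s, aeval (fun i : Fin d => linearForm (a i)) (q α) *
              complementaryMonomial a d α.1 ∈ sectionIdeal I a j := by
            refine hreg j hjd _ ?_
            have heq : linearForm (a j) * ∑ α ∈ s, aeval (fun i : Fin d => linearForm (a i)) (q α) *
                complementaryMonomial a d α.1 =
              ∑ α ∈ s, aeval (fun i : Fin d => linearForm (a i)) (p α) *
                complementaryMonomial a d α.1 -
              ∑ α ∈ s, aeval (fun i : Fin d => linearForm (a i))
                ((p α).modMonomial (Finsupp.single e 1)) * complementaryMonomial a d α.1 := by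
              rw [← Finset.sum_sub_distrib, Finset.mul_sum]
              refine Finset.sum_congr rfl fun α _ => ?_
              rw [← sub_mul, ← map_sub, ← mul_assoc]
              congr 1
              have := divMonomial_add_modMonomial_single (p α) e
              rw [← eq_sub_iff_add_eq] at this
              rw [← this, map_mul, aeval_X]
            rw [heq]
            exact sub_mem hp (Ideal.sum_mem _ fun α hα =>
              Ideal.mul_mem_right _ _ (aeval_linearForm_mem_sectionIdeal I a (hmod α hα)))
          have hle : Finsupp.single e 1 ≤ x := by
            rw [Finsupp.single_le_iff]
            omega
          obtain ⟨i, hi, hxi⟩ := ihN q hsum α hα (x - Finsupp.single e 1) (by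
            rw [mem_support_iff, coeff_divMonomial, add_tsub_cancel_of_le hle]
            exact mem_support_iff.1 hx) (by
            rw [Finsupp.tsub_apply, Finsupp.single_eq_same]
            omega)
          refine ⟨i, hi, fun h => hxi ?_⟩
          rw [Finsupp.tsub_apply, h, Nat.zero_sub]
    intro p hp α hα
    rw [mem_ideal_span_X_image]
    exact fun x hx => key _ p hp α hα x hx (Nat.lt_succ_self _)

end Freeness

/-! ### A basis over the polynomial ring in the first `d` forms. -/

section Flatness

variable {R₀ : Type u} [CommRing R₀] {n : ℕ}

/-- The structure of an algebra over the polynomial ring in the first `d` linear forms. -/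
abbrev sectionAlgebra (I : Ideal (MvPolynomial (Fin n) R₀)) (a : ℕ → Fin n → R₀) (d : ℕ) :
    Algebra (MvPolynomial (Fin d) R₀) (MvPolynomial (Fin n) R₀ ⧸ I) :=
  ((Ideal.Quotient.mkₐ R₀ I).comp (aeval fun i : Fin d => linearForm (a i))).toRingHom.toAlgebra

theorem sectionAlgebra_smul_mk (I : Ideal (MvPolynomial (Fin n) R₀)) (a : ℕ → Fin n → R₀) (d : ℕ)
    (p : MvPolynomial (Fin d) R₀) (f : MvPolynomial (Fin n) R₀) :
    letI := sectionAlgebra I a d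
    p • Ideal.Quotient.mk I f =
      Ideal.Quotient.mk I (aeval (fun i : Fin d => linearForm (a i)) p * f) := rfl

/-- Graded Nakayama, by induction on the degree: modulo the section ideal a form is a combination of
complementary monomials, and the difference is, up to `I`, a combination of the first `d` forms with
cofactors of smaller degree. -/
theorem mk_mem_span_complementaryMonomial {I : Ideal (MvPolynomial (Fin n) R₀)} (hI : IsHomog I)
    {a : ℕ → Fin n → R₀} {b : Fin n → Fin n → R₀}
    (hb : ∀ i, X i = ∑ j : Fin n, b i j • linearForm (a j)) {d : ℕ} (hdn : d ≤ n) {r : ℕ}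
    (hzero : ∀ t : ℕ, r < t → ∀ f : MvPolynomial (Fin n) R₀, f.IsHomogeneous t →
      f ∈ sectionIdeal I a d) (f : MvPolynomial (Fin n) R₀) :
    letI := sectionAlgebra I a d
    Ideal.Quotient.mk I f ∈ Submodule.span (MvPolynomial (Fin d) R₀)
      (Set.range fun α : {α : Fin (n - d) →₀ ℕ // α.degree ≤ r} =>
        Ideal.Quotient.mk I (complementaryMonomial a d α.1)) := by
  let _ := sectionAlgebra I a d
  let _ : Module (MvPolynomial (Fin d) R₀) (MvPolynomial (Fin n) R₀ ⧸ I) := Algebra.toModule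
  set N := Submodule.span (MvPolynomial (Fin d) R₀)
      (Set.range fun α : {α : Fin (n - d) →₀ ℕ // α.degree ≤ r} =>
        Ideal.Quotient.mk I (complementaryMonomial a d α.1)) with hN
  suffices H : ∀ t : ℕ, ∀ f : MvPolynomial (Fin n) R₀, f.IsHomogeneous t →
      Ideal.Quotient.mk I f ∈ N by
    rw [← sum_homogeneousComponent f, map_sum]
    exact Submodule.sum_mem _ fun k _ => H k _ (homogeneousComponent_isHomogeneous k f)
  intro t
  induction t using Nat.strong_induction_on with
  | _ t ih =>
    have hsec : ∀ j ≤ d, ∀ f : MvPolynomial (Fin n) R₀, f.IsHomogeneous t →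
        f ∈ sectionIdeal I a j → Ideal.Quotient.mk I f ∈ N := by
      intro j
      induction j with
      | zero =>
        intro _ f _ hf
        rw [sectionIdeal_zero] at hf
        rw [Ideal.Quotient.eq_zero_iff_mem.2 hf]
        exact zero_mem _
      | succ j ihj =>
        intro hj f hf hfj
        rw [sectionIdeal_succ] at hfj
        rcases exists_sub_mul_mem_of_mem_sup_span (isHomog_sectionIdeal hI a j)
          (isHomogeneous_linearForm (a j)) hf hfj with ⟨-, h0⟩ | ⟨s, rfl, g, hg, hfg⟩
        · exact ihj (by omega) f hf h0
        · have h1 := ihj (by omega) (f - linearForm (a j) * g)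
            (hf.sub (by rw [add_comm]; exact (isHomogeneous_linearForm (a j)).mul hg)) hfg
          have h2 := N.smul_mem (X ⟨j, by omega⟩) (ih s (Nat.lt_succ_self s) g hg)
          rw [sectionAlgebra_smul_mk, aeval_X] at h2
          have := N.add_mem h1 h2
          rwa [← map_add, sub_add_cancel] at this
    intro f hf
    by_cases ht : r < t
    · exact hsec d le_rfl f hf (hzero t ht f hf)
    · obtain ⟨g, hg, hfg⟩ := exists_isHomogeneous_sub_mem I hb hdn hf
      have hgN : Ideal.Quotient.mk I (aeval (fun k : Fin (n - d) => linearForm (a (d + k))) g) ∈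
          N := by
        rw [g.as_sum, map_sum, map_sum]
        refine Submodule.sum_mem _ fun α hα => ?_
        have hα' : α.degree ≤ r := by
          by_contra h
          exact mem_support_iff.1 hα (hg.coeff_eq_zero (by omega))
        have h1 : monomial α (coeff α g) = coeff α g • monomial α (1 : R₀) := by
          rw [smul_monomial, smul_eq_mul, mul_one]
        have h2 := N.smul_mem (C (coeff α g)) (Submodule.subset_span ⟨⟨α, hα'⟩, rfl⟩)
        rw [sectionAlgebra_smul_mk, ← algebraMap_eq, AlgHom.commutes, ← Algebra.smul_def,
          complementaryMonomial, ← map_smul, ← h1] at h2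
        exact h2
      have h1 := hsec d le_rfl _
        (hf.sub (isHomogeneous_aeval_linearForm (fun k : Fin (n - d) => a (d + k)) hg)) hfg
      have := N.add_mem h1 hgN
      rwa [← map_add, sub_add_cancel] at this

variable [IsArtinianRing R₀]

theorem linearIndependent_complementaryMonomial {I : Ideal (MvPolynomial (Fin n) R₀)}
    (hI : IsHomog I) {a : ℕ → Fin n → R₀} {b : Fin n → Fin n → R₀}
    (hb : ∀ i, X i = ∑ j : Fin n, b i j • linearForm (a j)) {d : ℕ} (hdn : d ≤ n) {r : ℕ}
    (hmax : ∀ t ≤ r, hilbertFunction (quotientGrading (sectionIdeal I a d)) t =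
      (n - d).multichoose t * (Module.length R₀ R₀).toNat)
    (hreg : ∀ j < d, ∀ f, linearForm (a j) * f ∈ sectionIdeal I a j → f ∈ sectionIdeal I a j) :
    letI := sectionAlgebra I a d
    LinearIndependent (MvPolynomial (Fin d) R₀)
      (fun α : {α : Fin (n - d) →₀ ℕ // α.degree ≤ r} =>
        Ideal.Quotient.mk I (complementaryMonomial a d α.1)) := by
  let _ := sectionAlgebra I a d
  let _ : Module (MvPolynomial (Fin d) R₀) (MvPolynomial (Fin n) R₀ ⧸ I) := Algebra.toModule
  rw [linearIndependent_iff']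
  intro s p hp α hα
  -- After all `d` descents no variable is left to generate the ideal, so the coefficients are zero.
  have := coefficients_mem_span_of_sum_mem hI hb hdn hmax hreg s d le_rfl p (by
    rw [Nat.sub_self, sectionIdeal_zero, ← Ideal.Quotient.eq_zero_iff_mem, map_sum]
    exact hp) α hα
  simpa using this

/-- If the Hilbert function of the general section is maximal up to degree `r` and vanishes in
larger degrees, and the general linear forms are a regular sequence, then `R / I` is
Cohen–Macaulay. -/
theorem isCohenMacaulayRing_quotient {I : Ideal (MvPolynomial (Fin n) R₀)}
    (hI : IsHomog I) {a : ℕ → Fin n → R₀} {b : Fin n → Fin n → R₀}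
    (hb : ∀ i, X i = ∑ j : Fin n, b i j • linearForm (a j)) {d : ℕ} (hdn : d ≤ n) {r : ℕ}
    (hmax : ∀ t ≤ r, hilbertFunction (quotientGrading (sectionIdeal I a d)) t =
      (n - d).multichoose t * (Module.length R₀ R₀).toNat)
    (hzero : ∀ t : ℕ, r < t → ∀ f : MvPolynomial (Fin n) R₀, f.IsHomogeneous t →
      f ∈ sectionIdeal I a d)
    (hreg : ∀ j < d, ∀ f, linearForm (a j) * f ∈ sectionIdeal I a j → f ∈ sectionIdeal I a j)
    (hdim : ringKrullDim (MvPolynomial (Fin n) R₀ ⧸ I) ≤ d) :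
    IsCohenMacaulayRing (MvPolynomial (Fin n) R₀ ⧸ I) := by
  let _ := sectionAlgebra I a d
  have : IsScalarTower R₀ (MvPolynomial (Fin d) R₀) (MvPolynomial (Fin n) R₀ ⧸ I) :=
    IsScalarTower.of_algebraMap_eq' (AlgHom.comp_algebraMap
      ((Ideal.Quotient.mkₐ R₀ I).comp (aeval fun i : Fin d => linearForm (a i)))).symm
  have hfree : Module.Free (MvPolynomial (Fin d) R₀) (MvPolynomial (Fin n) R₀ ⧸ I) :=
    Module.Free.of_basis (Module.Basis.mk
      (linearIndependent_complementaryMonomial hI hb hdn hmax hreg) (by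
        rintro x -
        obtain ⟨f, rfl⟩ := Ideal.Quotient.mk_surjective x
        exact mk_mem_span_complementaryMonomial hI hb hdn hzero f))
  exact isCohenMacaulayRing_of_flat (R₀ := R₀) (d := d) _ hdim

end Flatness

/-! ### Depth modulo a regular element. -/

section Depth

open CategoryTheory Abelian RingTheory.Sequence IsLocalRing

theorem maximalIdeal_smul_top_lt_top {A : Type u} [CommRing A] [IsLocalRing A] (M : Type u)
    [AddCommGroup M] [Module A M] [Module.Finite A M] [Nontrivial M] :
    maximalIdeal A • (⊤ : Submodule A M) < ⊤ := by
  refine lt_top_iff_ne_top.2 (Ne.symm ?_)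
  exact Submodule.top_ne_ideal_smul_of_le_jacobson_annihilator (maximalIdeal_le_jacobson _)

/-- The depth drops by one modulo a regular element. -/
theorem exists_isRegular_quotSMulTop {A : Type u} [CommRing A] [IsNoetherianRing A] [IsLocalRing A]
    (M : Type u) [AddCommGroup M] [Module A M] [Module.Finite A M] {x : A}
    (hxm : x ∈ maximalIdeal A) (hx : IsSMulRegular M x) {e : ℕ}
    (h : ∃ rs : List A, rs.length = e + 1 ∧ (∀ r ∈ rs, r ∈ maximalIdeal A) ∧ IsRegular M rs) :
    ∃ rs : List A, rs.length = e ∧ (∀ r ∈ rs, r ∈ maximalIdeal A) ∧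
      IsRegular (QuotSMulTop x M) rs := by
  have hM : Nontrivial M := by
    obtain ⟨rs, -, -, h⟩ := h
    exact h.nontrivial
  have hM' : Nontrivial (QuotSMulTop x M) := nontrivial_quotSMulTop_of_mem_maximalIdeal M hxm
  -- Depth is read as vanishing of `Ext`. The group for `M / x M` in degree `i` lies between those
  -- for `M` in degrees `i` and `i + 1`, so the choice of `x` is irrelevant.
  have h1 := ((ModuleCat.exists_isRegular_tfae (maximalIdeal A) (e + 1) (ModuleCat.of A M)
    (maximalIdeal_smul_top_lt_top M)).out 3 1).1 h
  refine ((ModuleCat.exists_isRegular_tfae (maximalIdeal A) e (ModuleCat.of A (QuotSMulTop x M))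
    (maximalIdeal_smul_top_lt_top (QuotSMulTop x M))).out 1 3).1 fun i hi => ?_
  have zero1 := AddCommGrpCat.isZero_of_iff_subsingleton.mpr (h1 i (by omega))
  have zero2 := AddCommGrpCat.isZero_of_iff_subsingleton.mpr (h1 (i + 1) (by omega))
  have hx' : IsSMulRegular (ModuleCat.of A M) x := hx
  exact AddCommGrpCat.subsingleton_of_isZero <| ShortComplex.Exact.isZero_of_both_zeros
    ((Ext.covariant_sequence_exact₃' _ hx'.smulShortComplex_shortExact) i (i + 1) rfl)
    (zero1.eq_zero_of_src _) (zero2.eq_zero_of_tgt _)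

end Depth

/-! ### Linear sections at the graded maximal ideal. -/

section LocalSection

variable {R₀ : Type u} [CommRing R₀] [IsLocalRing R₀] {n : ℕ}

theorem mem_gradedMaximalIdeal_iff {f : MvPolynomial (Fin n) R₀} :
    f ∈ gradedMaximalIdeal R₀ n ↔ constantCoeff f ∈ IsLocalRing.maximalIdeal R₀ := Iff.rfl

instance isMaximal_gradedMaximalIdeal : (gradedMaximalIdeal R₀ n).IsMaximal :=
  Ideal.comap_isMaximal_of_surjective _ fun c => ⟨C c, constantCoeff_C _ c⟩

/-- Outside the graded maximal ideal the constant term of `s` is a unit, and the degree `t`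
component of `s f` is that unit times `f`. So localizing loses no homogeneous information. -/
theorem mem_of_mul_mem_of_notMem_gradedMaximalIdeal {J : Ideal (MvPolynomial (Fin n) R₀)}
    (hJ : IsHomog J) {s f : MvPolynomial (Fin n) R₀} {t : ℕ} (hf : f.IsHomogeneous t)
    (hs : s ∉ gradedMaximalIdeal R₀ n) (h : s * f ∈ J) : f ∈ J := by
  have h1 := hJ.component_mem (t + 0) h
  rw [mul_comm, homogeneousComponent_mul_of_isHomogeneous hf, homogeneousComponent_zero] at h1
  have hu : IsUnit (coeff 0 s) := by
    rwa [mem_gradedMaximalIdeal_iff, IsLocalRing.mem_maximalIdeal, mem_nonunits_iff, not_not] at hs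
  exact (Ideal.mul_unit_mem_iff_mem J (hu.map C)).1 h1

/-- A prime containing the colon ideal contains all variables and, the base being Artinian, the
maximal ideal of `R₀` as well. -/
theorem exists_pow_mul_mem_of_mem_satIdeal [IsArtinianRing R₀]
    {J : Ideal (MvPolynomial (Fin n) R₀)} {f : MvPolynomial (Fin n) R₀} (hf : f ∈ satIdeal J)
    {g : MvPolynomial (Fin n) R₀} (hg : g ∈ gradedMaximalIdeal R₀ n) :
    ∃ N : ℕ, g ^ N * f ∈ J := by
  suffices h : gradedMaximalIdeal R₀ n ≤ (Submodule.colon J {f}).radical by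
    obtain ⟨N, hN⟩ := h hg
    exact ⟨N, Submodule.mem_colon_singleton.1 hN⟩
  rw [Ideal.radical_eq_sInf]
  refine le_sInf fun P hP => ?_
  have hprime : P.IsPrime := hP.2
  refine gradedMaximalIdeal_le_of_forall_X_mem fun i => ?_
  obtain ⟨N, hN⟩ := hf i
  exact hprime.mem_of_pow_mem N (hP.1 (Submodule.mem_colon_singleton.2 hN))

variable {I : Ideal (MvPolynomial (Fin n) R₀)} {q : Ideal (MvPolynomial (Fin n) R₀ ⧸ I)} [q.IsPrime]
variable (A : Type u) [CommRing A] [Algebra (MvPolynomial (Fin n) R₀ ⧸ I) A]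

/-- The map from the polynomial ring to a localization of its quotient. -/
abbrev toLocal (I : Ideal (MvPolynomial (Fin n) R₀)) [Algebra (MvPolynomial (Fin n) R₀ ⧸ I) A] :
    MvPolynomial (Fin n) R₀ →+* A :=
  (algebraMap (MvPolynomial (Fin n) R₀ ⧸ I) A).comp (Ideal.Quotient.mk I)

variable [IsLocalization.AtPrime A q]

theorem toLocal_mem_map_iff
    (hq : ∀ f, Ideal.Quotient.mk I f ∈ q ↔ f ∈ gradedMaximalIdeal R₀ n)
    {J : Ideal (MvPolynomial (Fin n) R₀)} (hIJ : I ≤ J) {f : MvPolynomial (Fin n) R₀} :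
    toLocal A I f ∈ J.map (toLocal A I) ↔ ∃ s ∉ gradedMaximalIdeal R₀ n, s * f ∈ J := by
  rw [toLocal, ← Ideal.map_map, RingHom.comp_apply,
    IsLocalization.algebraMap_mem_map_algebraMap_iff q.primeCompl]
  constructor
  · rintro ⟨s, hs, h⟩
    obtain ⟨s, rfl⟩ := Ideal.Quotient.mk_surjective s
    exact ⟨s, fun h' => hs ((hq s).2 h'), (Ideal.mem_quotient_iff_mem hIJ).1 h⟩
  · rintro ⟨s, hs, h⟩
    exact ⟨Ideal.Quotient.mk I s, fun h' => hs ((hq s).1 h'), (Ideal.mem_quotient_iff_mem hIJ).2 h⟩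

omit [IsLocalRing R₀] in
theorem exists_toLocal_mul_eq (q : Ideal (MvPolynomial (Fin n) R₀ ⧸ I)) [q.IsPrime]
    [IsLocalization.AtPrime A q] (z : A) :
    ∃ f s : MvPolynomial (Fin n) R₀, IsUnit (toLocal A I s) ∧ z * toLocal A I s = toLocal A I f := by
  obtain ⟨⟨f, s⟩, h⟩ := IsLocalization.surj q.primeCompl z
  obtain ⟨f, rfl⟩ := Ideal.Quotient.mk_surjective f
  obtain ⟨s', hs'⟩ := Ideal.Quotient.mk_surjective (s : MvPolynomial (Fin n) R₀ ⧸ I)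
  refine ⟨f, s', ?_, ?_⟩
  · rw [RingHom.comp_apply, hs']
    exact IsLocalization.map_units A s
  · rw [RingHom.comp_apply, hs']
    exact h

/-- A regular element of the local maximal ideal excludes torsion: one of its powers kills each
homogeneous element of the saturation, which therefore lies in the localized ideal, and hence in `J`
by homogeneity. -/
theorem satIdeal_le_of_isSMulRegular [IsArtinianRing R₀] [IsLocalRing A]
    (hq : ∀ f, Ideal.Quotient.mk I f ∈ q ↔ f ∈ gradedMaximalIdeal R₀ n)
    {J : Ideal (MvPolynomial (Fin n) R₀)} (hJ : IsHomog J) (hIJ : I ≤ J) {x : A}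
    (hx : x ∈ IsLocalRing.maximalIdeal A) (hreg : IsSMulRegular (A ⧸ J.map (toLocal A I)) x) :
    satIdeal J ≤ J := by
  intro f hf
  refine mem_of_forall_homogeneousComponent_mem fun k => ?_
  have hf' := hJ.satIdeal (k := k) hf
  obtain ⟨g, s, hs, h⟩ := exists_toLocal_mul_eq A q x
  have hg : g ∈ gradedMaximalIdeal R₀ n := by
    rw [← hq, ← IsLocalization.AtPrime.to_map_mem_maximal_iff A q]
    change toLocal A I g ∈ _
    rw [← h]
    exact Ideal.mul_mem_right _ _ hx
  obtain ⟨N, hN⟩ := exists_pow_mul_mem_of_mem_satIdeal hf' hg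
  have h1 : x ^ N • toLocal A I (homogeneousComponent k f) ∈ J.map (toLocal A I) := by
    have h2 := Ideal.mem_map_of_mem (toLocal A I) hN
    rw [map_mul, map_pow, ← h, mul_pow, mul_right_comm] at h2
    exact (Ideal.mul_unit_mem_iff_mem _ (hs.pow N)).1 h2
  have h3 := (isSMulRegular_quotient_iff_mem_of_smul_mem _ _).1 (hreg.pow N) _ h1
  obtain ⟨s', hs', h4⟩ := (toLocal_mem_map_iff A hq hIJ).1 h3
  exact mem_of_mul_mem_of_notMem_gradedMaximalIdeal hJ (homogeneousComponent_isHomogeneous k f) hs' h4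

theorem isSMulRegular_toLocal
    (hq : ∀ f, Ideal.Quotient.mk I f ∈ q ↔ f ∈ gradedMaximalIdeal R₀ n)
    {J : Ideal (MvPolynomial (Fin n) R₀)} (hIJ : I ≤ J) {y : MvPolynomial (Fin n) R₀}
    (hsat : satIdeal J ≤ J) (hy : FilterRegular J y) :
    IsSMulRegular (A ⧸ J.map (toLocal A I)) (toLocal A I y) := by
  rw [isSMulRegular_quotient_iff_mem_of_smul_mem]
  intro z hz
  obtain ⟨f, s, hs, h⟩ := exists_toLocal_mul_eq A q z
  have h1 : toLocal A I (y * f) ∈ J.map (toLocal A I) := by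
    rw [map_mul, ← h, ← mul_assoc]
    exact Ideal.mul_mem_right _ _ hz
  obtain ⟨s', hs', h2⟩ := (toLocal_mem_map_iff A hq hIJ).1 h1
  have h3 : s' * f ∈ J := hsat (hy _ (by rwa [mul_left_comm]))
  rw [← Ideal.mul_unit_mem_iff_mem _ hs, h]
  exact (toLocal_mem_map_iff A hq hIJ).2 ⟨s', hs', h3⟩

theorem satIdeal_eq_top_of_ringKrullDim_local_le_zero [IsArtinianRing R₀] [IsLocalRing A]
    (hq : ∀ f, Ideal.Quotient.mk I f ∈ q ↔ f ∈ gradedMaximalIdeal R₀ n)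
    {J : Ideal (MvPolynomial (Fin n) R₀)} (hJ : IsHomog J) (hIJ : I ≤ J)
    (hJX : J ≤ gradedMaximalIdeal R₀ n) (h : ringKrullDim (A ⧸ J.map (toLocal A I)) ≤ 0) :
    satIdeal J = ⊤ := by
  apply satIdeal_eq_top_of_mem_minimalPrimes hJ
  obtain ⟨Q, hQ, hle⟩ := Ideal.exists_minimalPrimes_le hJX
  have hQprime : Q.IsPrime := hQ.1.1
  suffices hge : gradedMaximalIdeal R₀ n ≤ Q by rwa [le_antisymm hge hle]
  intro g hg
  have h0 : Ring.KrullDimLE 0 (A ⧸ J.map (toLocal A I)) := Ring.krullDimLE_iff.2 (by simpa using h)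
  rw [Ideal.krullDimLE_zero_quotient_iff_forall_minimalPrimes_isMaximal] at h0
  have hrad : toLocal A I g ∈ (J.map (toLocal A I)).radical := by
    rw [← Ideal.sInf_minimalPrimes, Ideal.mem_sInf]
    intro P hP
    rw [IsLocalRing.eq_maximalIdeal (h0 P hP)]
    exact (IsLocalization.AtPrime.to_map_mem_maximal_iff A q _).2 ((hq g).2 hg)
  obtain ⟨N, hN⟩ := hrad
  rw [← map_pow] at hN
  obtain ⟨s, hs, h1⟩ := (toLocal_mem_map_iff A hq hIJ).1 hN
  rcases hQprime.mem_or_mem (hQ.1.2 h1) with h2 | h2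
  · exact absurd (hle h2) hs
  · exact hQprime.mem_of_pow_mem N h2

omit [IsLocalRing R₀] in
theorem map_sectionIdeal_succ (a : ℕ → Fin n → R₀) (j : ℕ) :
    (sectionIdeal I a (j + 1)).map (toLocal A I) =
      (sectionIdeal I a j).map (toLocal A I) ⊔ Ideal.span {toLocal A I (linearForm (a j))} := by
  rw [sectionIdeal_succ, Ideal.map_sup, Ideal.map_span, Set.image_singleton]

/-- If the localization of `R / I` at the graded maximal ideal is Cohen–Macaulay of dimension `d'`,
then the first `d'` general linear forms are a regular sequence, and their quotient has finite
length. -/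
theorem exists_regular_of_isCohenMacaulayLocalRing [IsArtinianRing R₀] [IsLocalRing A]
    [IsNoetherianRing A] (hq : ∀ f, Ideal.Quotient.mk I f ∈ q ↔ f ∈ gradedMaximalIdeal R₀ n)
    (hI : IsHomog I) (hIX : I ≤ idealOfVars (Fin n) R₀) {a : ℕ → Fin n → R₀} {d d' : ℕ}
    (ha : ∀ j < d, FilterRegular (sectionIdeal I a j) (linearForm (a j))) (hd : d' ≤ d)
    (hdim : ringKrullDim A = d')
    (hrs : ∃ rs : List A, rs.length = d' ∧ RingTheory.Sequence.IsRegular A rs) :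
    (∀ j < d', satIdeal (sectionIdeal I a j) ≤ sectionIdeal I a j) ∧
      satIdeal (sectionIdeal I a d') = ⊤ := by
  -- A regular sequence of length `d' - j` and dimension `d' - j` are carried along together. While
  -- `j < d'` the sequence is nonempty, which saturates `J_j` and makes the next general form
  -- regular; it can then replace the first member of the given sequence.
  have key : ∀ j ≤ d', (∃ rs : List A, rs.length = d' - j ∧
      (∀ r ∈ rs, r ∈ IsLocalRing.maximalIdeal A) ∧
        RingTheory.Sequence.IsRegular (A ⧸ (sectionIdeal I a j).map (toLocal A I)) rs) ∧
      ringKrullDim (A ⧸ (sectionIdeal I a j).map (toLocal A I)) + j = d' ∧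
      ∀ i < j, satIdeal (sectionIdeal I a i) ≤ sectionIdeal I a i := by
    intro j
    induction j with
    | zero =>
      intro _
      have hbot : (sectionIdeal I a 0).map (toLocal A I) = ⊥ := by
        rw [sectionIdeal_zero, toLocal, ← Ideal.map_map, Ideal.map_quotient_self, Ideal.map_bot]
      obtain ⟨rs, hlen, hreg⟩ := hrs
      refine ⟨⟨rs, hlen, fun r hr => ?_, ?_⟩, ?_, by simp⟩
      · refine IsLocalRing.le_maximalIdeal (J := Ideal.ofList rs) (fun h => hreg.2 ?_)
          (Ideal.subset_span hr)
        rw [h, smul_eq_mul, Ideal.mul_top]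
      · exact ((Submodule.quotEquivOfEqBot _ hbot).symm.isRegular_congr rs).1 hreg
      · rw [Nat.cast_zero, add_zero, ← hdim]
        exact ringKrullDim_eq_of_ringEquiv
          ((Ideal.quotEquivOfEq hbot).trans (RingEquiv.quotientBot A))
    | succ j ih =>
      intro hj
      obtain ⟨⟨rs, hlen, hmem, hreg⟩, hd', hsat⟩ := ih (by omega)
      have hsatj : satIdeal (sectionIdeal I a j) ≤ sectionIdeal I a j := by
        rcases rs with _ | ⟨x, rs⟩
        · simp at hlen
          omega
        · exact satIdeal_le_of_isSMulRegular A hq (isHomog_sectionIdeal hI a j)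
            (le_sectionIdeal I a j) (hmem x (by simp))
            ((RingTheory.Sequence.isRegular_cons_iff _ _ _).1 hreg).1
      have hyreg := isSMulRegular_toLocal A hq (le_sectionIdeal I a j) hsatj (ha j (by omega))
      have hymem : toLocal A I (linearForm (a j)) ∈ IsLocalRing.maximalIdeal A :=
        (IsLocalization.AtPrime.to_map_mem_maximal_iff A q _).2 ((hq _).2
          (idealOfVars_le_gradedMaximalIdeal (linearForm_mem_idealOfVars _)))
      have hnt : Nontrivial (A ⧸ (sectionIdeal I a j).map (toLocal A I)) := hreg.nontrivial
      rw [map_sectionIdeal_succ]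
      refine ⟨?_, ?_, ?_⟩
      · obtain ⟨rs', hlen', hmem', hreg'⟩ := exists_isRegular_quotSMulTop
          (A ⧸ (sectionIdeal I a j).map (toLocal A I)) hymem hyreg (e := d' - (j + 1))
          ⟨rs, by omega, hmem, hreg⟩
        exact ⟨rs', hlen', hmem', ((quotSMulTopQuotientEquiv _ _).isRegular_congr rs').1 hreg'⟩
      · rw [← hd', ← supportDim_quotSMulTop_quotient, ← Module.supportDim_quotient_eq_ringKrullDim,
          ← Module.supportDim_quotSMulTop_succ_eq_supportDim hyreg hymem, Nat.cast_succ, add_assoc,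
          add_comm 1]
      · intro i hi
        rcases Nat.lt_succ_iff_lt_or_eq.1 hi with h | rfl
        · exact hsat i h
        · exact hsatj
  obtain ⟨-, hd', hsat⟩ := key d' le_rfl
  refine ⟨hsat, satIdeal_eq_top_of_ringKrullDim_local_le_zero A hq (isHomog_sectionIdeal hI a d')
    (le_sectionIdeal I a d')
    ((sectionIdeal_le_idealOfVars hIX a d').trans idealOfVars_le_gradedMaximalIdeal) ?_⟩
  exact withBot_enat_le_zero_of_add_le hd'.le

end LocalSection

/-! ### The extremal numerator. -/

section ExtremalSeries

theorem coeff_sum_C_mul_X_pow (f : ℕ → ℤ) (a t : ℕ) :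
    PowerSeries.coeff t (∑ i ∈ Finset.range (a + 1), PowerSeries.C (f i) * PowerSeries.X ^ i) =
      if t ≤ a then f t else 0 := by
  simp only [map_sum, PowerSeries.coeff_C_mul, PowerSeries.coeff_X_pow, mul_ite, mul_one, mul_zero,
    Finset.sum_ite_eq, Finset.mem_range, Nat.lt_succ_iff]

theorem coe_sum_C_mul_X_pow (f : ℕ → ℤ) (a : ℕ) :
    ((∑ i ∈ Finset.range (a + 1), Polynomial.C (f i) * Polynomial.X ^ i : Polynomial ℤ) :
      PowerSeries ℤ) = ∑ i ∈ Finset.range (a + 1), PowerSeries.C (f i) * PowerSeries.X ^ i := by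
  rw [← Polynomial.coeToPowerSeries.ringHom_apply, map_sum]
  exact Finset.sum_congr rfl fun i _ => by
    rw [Polynomial.coeToPowerSeries.ringHom_apply, Polynomial.coe_mul, Polynomial.coe_C,
      Polynomial.coe_pow, Polynomial.coe_X]

/-- A hockey-stick sum. For `c = 0` truncated subtraction gives `1` at `i = 0` and `0` afterwards,
in accordance with `binom(-1, 0) = 1`. -/
theorem eval_one_sum_C_mul_X_pow (ℓ c a : ℕ) :
    (∑ i ∈ Finset.range (a + 1), Polynomial.C ((ℓ * (c + i - 1).choose i : ℕ) : ℤ) *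
      Polynomial.X ^ i : Polynomial ℤ).eval 1 = ((ℓ * (a + c).choose c : ℕ) : ℤ) := by
  rw [← sum_multichoose, Finset.mul_sum, Nat.cast_sum, Polynomial.eval_finsetSum]
  exact Finset.sum_congr rfl fun i _ => by simp [Nat.multichoose_eq]

end ExtremalSeries

/-! ### From the extremal series to regularity, and the conclusion. -/

section Main

variable {R₀ : Type u} [CommRing R₀] [IsLocalRing R₀] [IsArtinianRing R₀] {n : ℕ}

theorem le_of_ringKrullDim_quotient_eq {I : Ideal (MvPolynomial (Fin n) R₀)} {d : ℕ}
    (hdim : ringKrullDim (MvPolynomial (Fin n) R₀ ⧸ I) = d) : d ≤ n := by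
  have h := ringKrullDim_quotient_le I
  rw [hdim, MvPolynomial.ringKrullDim_of_isNoetherianRing, ringKrullDimZero_iff_ringKrullDim_eq_zero.1 inferInstance]
    at h
  simpa using h

omit [IsLocalRing R₀] [IsArtinianRing R₀] in
theorem le_idealOfVars_of_le_irrelevant {I : Ideal (MvPolynomial (Fin n) R₀)}
    (h : I ≤ (HomogeneousIdeal.irrelevant (homogeneousSubmodule (Fin n) R₀)).toIdeal) :
    I ≤ idealOfVars (Fin n) R₀ := by
  intro f hf
  have h' := (HomogeneousIdeal.mem_irrelevant_iff _ _).1 (h hf)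
  rw [GradedRing.proj_apply, DirectSum.decompose, Equiv.coe_fn_mk, decomposition.decompose'_apply,
    homogeneousComponent_zero] at h'
  rw [mem_idealOfVars_iff, constantCoeff_eq]
  simpa using h'

omit [IsLocalRing R₀] [IsArtinianRing R₀] in
theorem forall_mul_mem_of_satIdeal_le {I : Ideal (MvPolynomial (Fin n) R₀)} {a : ℕ → Fin n → R₀}
    {d d' : ℕ} (hd : d' ≤ d)
    (ha : ∀ j < d, FilterRegular (sectionIdeal I a j) (linearForm (a j)))
    (h : ∀ j < d', satIdeal (sectionIdeal I a j) ≤ sectionIdeal I a j) :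
    ∀ j < d', ∀ f, linearForm (a j) * f ∈ sectionIdeal I a j → f ∈ sectionIdeal I a j :=
  fun j hj f hf => h j hj (ha j (by omega) f hf)

theorem one_le_toNat_length : 1 ≤ (Module.length R₀ R₀).toNat := by
  rw [Nat.one_le_iff_ne_zero]
  intro h
  have := coe_toNat_length (R₀ := R₀)
  rw [h, Nat.cast_zero, eq_comm, Module.length_eq_zero_iff] at this
  exact not_subsingleton R₀ this

/-- If `R / I` is Cohen–Macaulay and its Hilbert series is extremal, then the cohomology vanishes
above the degree of the numerator. -/
theorem vanishesAbove_of_isCohenMacaulayRing {I : Ideal (MvPolynomial (Fin n) R₀)} (hI : IsHomog I)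
    (hIX : I ≤ idealOfVars (Fin n) R₀) {a : ℕ → Fin n → R₀} {d : ℕ}
    (ha : ∀ j < d, FilterRegular (sectionIdeal I a j) (linearForm (a j)))
    (hsat : satIdeal (sectionIdeal I a d) = ⊤)
    (hdim : ringKrullDim (MvPolynomial (Fin n) R₀ ⧸ I) = d)
    (hCM : IsCohenMacaulayRing (MvPolynomial (Fin n) R₀ ⧸ I)) {k c : ℕ}
    (hHS : hilbertSeries (quotientGrading I) * (1 - PowerSeries.X) ^ d =
      ∑ i ∈ Finset.range (k + 1),
        PowerSeries.C ((((Module.length R₀ R₀).toNat * (c + i - 1).choose i : ℕ) : ℤ)) *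
          PowerSeries.X ^ i) : VanishesAbove I d k := by
  let q := (gradedMaximalIdeal R₀ n).map (Ideal.Quotient.mk I)
  have hle : I ≤ gradedMaximalIdeal R₀ n := hIX.trans idealOfVars_le_gradedMaximalIdeal
  have hq : ∀ f, Ideal.Quotient.mk I f ∈ q ↔ f ∈ gradedMaximalIdeal R₀ n := fun f =>
    Ideal.mem_quotient_iff_mem hle
  have hqmax : q.IsMaximal := by
    refine (Ideal.map_eq_top_or_isMaximal_of_surjective _ Ideal.Quotient.mk_surjective
      isMaximal_gradedMaximalIdeal).resolve_left fun h => ?_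
    have : (1 : MvPolynomial (Fin n) R₀) ∈ gradedMaximalIdeal R₀ n := by
      rw [← hq, map_one, show q = ⊤ from h]
      exact Submodule.mem_top
    exact isPrime_gradedMaximalIdeal.one_notMem this
  obtain ⟨hN, -, rs, hrs, hlen⟩ := hCM.2 q
  have hd' : rs.length ≤ d := by
    have h := Ideal.height_le_ringKrullDim_of_isPrime (I := q)
    rw [← IsLocalization.AtPrime.ringKrullDim_eq_height q (Localization.AtPrime q), ← hlen, hdim]
      at h
    exact_mod_cast h
  obtain ⟨hsat', htop⟩ := exists_regular_of_isCohenMacaulayLocalRing (q := q)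
    (Localization.AtPrime q) hq hI hIX ha hd' hlen.symm ⟨rs, rfl, hrs⟩
  obtain ⟨D, hD⟩ := exists_forall_isHomogeneous_mem_of_mem_satIdeal (sectionIdeal I a rs.length)
  obtain ⟨P, hP, -⟩ := exists_coe_polynomial_eq
    (φ := hilbertSeries (quotientGrading (sectionIdeal I a rs.length))) (D := D) (fun t ht => by
      rw [hilbertSeries, PowerSeries.coeff_mk, hilbertFunction_eq_zero_iff.2 fun f hf =>
        hD t ht f hf (htop ▸ Submodule.mem_top), Nat.cast_zero])
  have hHS' := hilbertSeries_mul_pow_eq hI (forall_mul_mem_of_satIdeal_le hd' ha hsat')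
  -- If the local dimension is `d`, the numerator is the Hilbert series of the last section and the
  -- earlier sections have no `H^0`. A smaller one would leave a factor `1 - z` in a numerator with
  -- positive value at `1`.
  obtain heq | hlt := hd'.eq_or_lt
  · rw [heq] at hHS' hsat'
    rw [hHS'] at hHS
    refine VanishesAbove.of_sectionIdeal hI ha fun j hj t ht => ?_
    lift t to ℕ using by omega
    rw [cohomologyVanishes_zero_quotientGrading_iff]
    intro f hf hfs
    obtain rfl | hjd := hj.eq_or_lt
    · refine hilbertFunction_eq_zero_iff.1 ?_ f hf
      have := congrArg (PowerSeries.coeff t) hHS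
      rw [coeff_sum_C_mul_X_pow (fun i => (((Module.length R₀ R₀).toNat *
        (c + i - 1).choose i : ℕ) : ℤ)), if_neg (by omega), hilbertSeries,
        PowerSeries.coeff_mk] at this
      exact_mod_cast this
    · exact hsat' j hjd hfs
  · exfalso
    obtain ⟨m, hm⟩ := Nat.exists_eq_add_of_lt hlt
    rw [hm, add_assoc, pow_add, ← mul_assoc, hHS', ← hP, ← coe_sum_C_mul_X_pow (fun i =>
      (((Module.length R₀ R₀).toNat * (c + i - 1).choose i : ℕ) : ℤ))] at hHS
    have hpoly : P * (1 - Polynomial.X) ^ (m + 1) = ∑ i ∈ Finset.range (k + 1),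
        Polynomial.C (((Module.length R₀ R₀).toNat * (c + i - 1).choose i : ℕ) : ℤ) *
          Polynomial.X ^ i := by
      rw [← Polynomial.coe_inj, ← hHS]
      push_cast
      rfl
    have heval := congrArg (Polynomial.eval 1) hpoly
    rw [eval_one_sum_C_mul_X_pow] at heval
    simp only [Polynomial.eval_mul, Polynomial.eval_pow, Polynomial.eval_sub, Polynomial.eval_one,
      Polynomial.eval_X, sub_self, zero_pow (Nat.succ_ne_zero m), mul_zero] at heval
    have hpos : 0 < (Module.length R₀ R₀).toNat * (k + c).choose c :=
      Nat.mul_pos one_le_toNat_length (Nat.choose_pos (by omega))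
    rw [eq_comm, Nat.cast_eq_zero] at heval
    omega

end Main

end HilbertReg
end

open HilbertReg in
theorem propositionD1 {R₀ : Type*} [CommRing R₀] [IsLocalRing R₀] [IsArtinianRing R₀]
    [Infinite (IsLocalRing.ResidueField R₀)] (n d : ℕ) (I : Ideal (MvPolynomial (Fin n) R₀))
    (hI : I.IsHomogeneous (MvPolynomial.homogeneousSubmodule (Fin n) R₀))
    (hIplus : I ≤ (HomogeneousIdeal.irrelevant
      (MvPolynomial.homogeneousSubmodule (Fin n) R₀)).toIdeal)
    (hd : 1 ≤ d) (hdim : ringKrullDim (MvPolynomial (Fin n) R₀ ⧸ I) = d) :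
    ∃ (r : ℕ) (e : ℕ → ℤ),
      regularity n (quotientGrading I) = ((r : ℝ) : EReal) ∧
      IsHilbertCoefficients (quotientGrading I) d e ∧
      e 0 ≤ (((Module.length R₀ R₀).toNat * (r + (n - d)).choose (n - d) : ℕ) : ℤ) ∧
      (e 0 = (((Module.length R₀ R₀).toNat * (r + (n - d)).choose (n - d) : ℕ) : ℤ) ↔
        IsCohenMacaulayRing (MvPolynomial (Fin n) R₀ ⧸ I) ∧
        ∃ a : ℕ, hilbertSeries (quotientGrading I) * (1 - PowerSeries.X) ^ d =
          ∑ i ∈ Finset.range (a + 1),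
            PowerSeries.C ((((Module.length R₀ R₀).toNat * (n - d + i - 1).choose i : ℕ) : ℤ)) *
              PowerSeries.X ^ i) := by
  have hIX := le_idealOfVars_of_le_irrelevant hIplus
  have hdn := le_of_ringKrullDim_quotient_eq hdim
  obtain ⟨a, hgen, hass⟩ := exists_general_linearForms I
  obtain ⟨b, hb⟩ := exists_X_eq_sum_linearForm hgen
  have ha : ∀ j < d, FilterRegular (sectionIdeal I a j) (linearForm (a j)) := fun j hj =>
    filterRegular_of_forall_associatedPrimes (hass j (by omega))
  have hsat := satIdeal_sectionIdeal_eq_top hI hIX hdn hdim.le hass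
  obtain ⟨r, hreg, hr, hmin⟩ := exists_regularity_eq hI hIX ha hsat hdim
  obtain ⟨m, rfl⟩ : ∃ m, d = m + 1 := ⟨d - 1, by omega⟩
  obtain ⟨Q, hQ, hle, heq⟩ := exists_numerator_le hI hb hdn ha hsat hr
  obtain ⟨e, he0, he⟩ := exists_coefficients (m + 1) Q _ hQ
  refine ⟨r, e, hreg, ?_, he0 ▸ hle, fun h => ?_, fun ⟨hCM, k, hk⟩ => ?_⟩
  · filter_upwards [he] with t ht
    rwa [hilbertSeries, PowerSeries.coeff_mk] at ht
  · obtain ⟨hker, hmax⟩ := heq (he0 ▸ h)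
    have hmul := mem_sectionIdeal_of_mul_mem hI ha hker
    have hzero : ∀ t : ℕ, r < t → ∀ f : MvPolynomial (Fin n) R₀, f.IsHomogeneous t →
        f ∈ sectionIdeal I a (m + 1) := fun t ht f hf =>
      hr.mem_sectionIdeal hI ha hsat (by exact_mod_cast ht) hf
    -- The degree of truncation in the extremal series is taken to be the regularity.
    refine ⟨isCohenMacaulayRing_quotient hI hb hdn hmax hzero hmul hdim.le, r, ?_⟩
    rw [hilbertSeries_mul_pow_eq hI hmul]
    ext t
    rw [coeff_sum_C_mul_X_pow (fun i => (((Module.length R₀ R₀).toNat *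
      (n - (m + 1) + i - 1).choose i : ℕ) : ℤ)), hilbertSeries, PowerSeries.coeff_mk]
    split_ifs with ht
    · rw [hmax t ht, Nat.multichoose_eq, mul_comm]
    · rw [hilbertFunction_eq_zero_iff.2 (hzero t (by omega)), Nat.cast_zero]
  -- Minimality of the regularity gives `r ≤ k`. The extremal numerator has value `ℓ(R₀) binom(k +
  -- c, c)` at `1`, so monotonicity of the binomial supplies the missing inequality.
  · have hrk := hmin k (vanishesAbove_of_isCohenMacaulayRing hI hIX ha hsat hdim hCM hk)
    have hQ1 := eval_one_sum_C_mul_X_pow (Module.length R₀ R₀).toNat (n - (m + 1)) k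
    rw [← coe_sum_C_mul_X_pow (fun i => (((Module.length R₀ R₀).toNat *
      (n - (m + 1) + i - 1).choose i : ℕ) : ℤ)), hQ, Polynomial.coe_inj] at hk
    rw [← hk] at hQ1
    refine le_antisymm (he0 ▸ hle) ?_
    rw [he0, hQ1, Nat.cast_le]
    exact Nat.mul_le_mul_left _ (Nat.choose_le_choose _ (by omega))
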